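/- \textbf{Setting.} For an operator $C^{ij}=g^{ij}(u)\,\partial_x+b^{ij}_k(u)\,u^k_x+\omega^{ij}(u)$ in $n$ field variables write $\mathcal C_{(1)}=g^{ij}\partial_x+b^{ij}_ku^k_x$ and $\mathcal C_{(0)}=\omega^{ij}$ for its first-order and zero-order parts. A smooth function $F$ on an open set $D\subseteq\mathbb R^n$ is a (hydrodynamic) Casimir of an operator if the operator annihilates the vector $(\partial F/\partial u^j)_j$ along every smooth field $u(x)$ with values in $D$. The field variables are $(u,v)$ for $n=2$ and $(u,v,w)$ for $n=3$. Throughout, $D$ is open and connected, contained in the set where the operator is defined ($u\ne0$ for $C_{2,2},C_{3,4},C_{3,5}$; $v\neq0$ for $C_{3,7},C_{3,10}$; $uw\ne v$ for $C_{3,8}$; $uw\neq v$ and $w>0$ for $C_{3,11}$). The coefficient functions are smooth, on an open interval containing the relevant coordinate of the points of $D$ if they depend on one variable, on such an open rectangle $I\times J$ if they depend on $(v,w)$, and on $D$ in the case of $C_{3,1}$. For such a coefficient, "$=0$" means identically zero and "$\neq0$" means nowhere zero, on that domain; $c$ is a real constant of the operator; $c_1,c_2$ are arbitrary real constants on $D$;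 $\varphi$ is an arbitrary smooth function, where "$F=\varphi(\xi)$" (and likewise for several arguments, or for a summand or factor $\varphi(\xi)$ of $F$) is understood locally: around each point of $D$ the function, summand or factor equals $\varphi\circ\xi$ for some smooth $\varphi$. Integrals are taken from an arbitrary fixed point of the interval. $\mathrm{sk}(a,b,d)$ is the skew $3\times3$ matrix with entries $a,b,d$ in positions $(1,2),(1,3),(2,3)$. Then the Casimirs of the following operators are exactly the functions listed (every listed form is understood as "$F$ is a Casimir on $D$ if and only if $F$ has this form on $D$"). \textbf{Two components}, $g=\mathrm{diag}(1,0)$. \begin{itemize} \item $C_{2,1}$: $b=0$, $\omega^{12}=f(v)$. $\mathcal C_{(1)}$: $c_1u+\varphi(v)$. If $f\ne0$: $\mathcal C_{(0)}$ and $\mathcal C_{(1+0)}$: constants. \item $C_{2,2}$: $b^{ij}_ku^k_x$ skew with $(1,2)$ entry $-v_x/u$, $\omega^{12}=f(v)/u$. $\mathcal C_{(1)}$ and $\mathcal C_{(1+0)}$: constants; if $f\ne0$, also $\mathcal C_{(0)}$: constants. \end{itemize} \textbf{Three components.} \begin{itemize} \item $C_{3,1}$: $g=0$, $b^{ij}_ku^k_x=\mathrm{sk}(w_x,0,0)$,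 $\omega=\mathrm{sk}(f(u,v,w),0,0)$. $\mathcal C_{(1)}$, $\mathcal C_{(1+0)}$ and, if $f\neq0$, $\mathcal C_{(0)}$: $\varphi(w)$. \item $C_{3,2}$: $g=\mathrm{diag}(1,0,0)$, $b=0$, $\omega=\mathrm{sk}(f,g,h)$ with $f,g,h$ functions of $(v,w)$ satisfying the closure relation $fh_v-hf_v+gh_w-hg_w=0$. $C_{3,5}$: $g=\mathrm{diag}(1,0,0)$, $b^{ij}_ku^k_x=\frac1u\mathrm{sk}(-v_x,-w_x,0)$, $\omega=\frac1u\mathrm{sk}(f,g,h)$, with the same $f,g,h$ and closure relation. For both, $F$ is a Casimir of $\mathcal C_{(0)}$ iff \[ fF_v+gF_w=0,\qquad fF_u-hF_w=0,\qquad gF_u+hF_v=0; \tag{S}\] in particular the Casimirs of $\mathcal C_{(0)}$ coincide. For $C_{3,5}$, $\mathcal C_{(1)}$ and $\mathcal C_{(1+0)}$: constants. For $C_{3,2}$, $\mathcal C_{(1)}$: $c_1u+\varphi(v,w)$; $\mathcal C_{(1+0)}$: those of these functions that satisfy (S). Moreover, with $\mathcal C_{(0)}$ referring to both operators and $\mathcal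 C_{(1+0)}$ to $C_{3,2}$: \begin{itemize} \item $f=0$, $g,h\neq0$: $g/h=\ell(v)$ depends on $v$ only; $\mathcal C_{(0)}$: $\varphi(u-\int\ell\,dv)$; $\mathcal C_{(1+0)}$: $c_1(u-\int\ell\,dv)+c_2$. \item $f=g=0$, $h\ne0$: $\mathcal C_{(0)}$: $\varphi(u)$; $\mathcal C_{(1+0)}$: $c_1u+c_2$. \item $f=h=0$, $g\neq0$: $\mathcal C_{(0)}$ and $\mathcal C_{(1+0)}$: $\varphi(v)$. \item $g=0$, $f,h\ne0$: $f/h=\ell(w)$ depends on $w$ only; $\mathcal C_{(0)}$: $\varphi(u+\int\ell\,dw)$; $\mathcal C_{(1+0)}$: $c_1(u+\int\ell\,dw)+c_2$. \item $g=h=0$, $f\neq0$: $\mathcal C_{(0)}$ and $\mathcal C_{(1+0)}$: $\varphi(w)$. \item $h=0$, $f,g\neq0$: $\mathcal C_{(0)}$ and $\mathcal C_{(1+0)}$: those $F=\varphi(v,w)$ with $fF_v+gF_w=0$. \end{itemize} \item $C_{3,3}$: $g=\mathrm{diag}(1,0,0)$, $b^{ij}_ku^k_x=\mathrm{sk}(w_x,0,0)$,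 $\omega=\mathrm{sk}(f(v,w),0,0)$. $\mathcal C_{(1)}$, $\mathcal C_{(1+0)}$ and, if $f\ne0$, $\mathcal C_{(0)}$: $\varphi(w)$. \item $C_{3,4}$: $g=\mathrm{diag}(1,0,0)$, $b^{ij}_ku^k_x=\mathrm{sk}(0,-w_x/u,0)$, $\omega=\mathrm{sk}(0,f(v,w)/u,0)$. $\mathcal C_{(1)}$, $\mathcal C_{(1+0)}$ and, if $f\neq0$, $\mathcal C_{(0)}$: $\varphi(v)$. \item $C_{3,6}$: $g=\mathrm{diag}(1,1,0)$, $b=0$, $\omega=\mathrm{sk}(f(w),g(w),c\,g(w))$. $\mathcal C_{(1)}$: $c_1u+c_2v+\varphi(w)$. If $g=0$, $f\ne0$: $\mathcal C_{(0)}$ and $\mathcal C_{(1+0)}$: $\varphi(w)$. If $g\neq0$: $\mathcal C_{(0)}$: $\varphi(\xi)$; $\mathcal C_{(1+0)}$: $c_1\xi+c_2$, where $\xi=v-\int\frac fg\,dw-cu$. \item $C_{3,7}$: $g=\mathrm{diag}(1,1,0)$, $b^{ij}_ku^k_x=\mathrm{sk}(0,0,-w_x/v)$, $\omega=\mathrm{sk}(0,cf(w),(1-cu)f(w)/v)$.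 $\mathcal C_{(1)}$: $c_1u+c_2$. If $f\ne0$, $c=0$: $\mathcal C_{(0)}$: $\varphi(u)$; $\mathcal C_{(1+0)}$: $c_1u+c_2$. If $f\neq0$, $c\ne0$: $\mathcal C_{(0)}$: $\varphi\big(\frac{c(u^2+v^2)-2u}{c}\big)$; $\mathcal C_{(1+0)}$: constants. \item $C_{3,8}$: $g=\mathrm{diag}(1,1,0)$, $b^{ij}_ku^k_x=\frac{w_x}{uw-v}\mathrm{sk}(0,-w,1)$, $\omega=(1+w^2)f(w)\,\mathrm{sk}\big(\frac1{1+w^2},\frac{w-cv\sqrt{1+w^2}}{uw-v},-\frac{1-cu\sqrt{1+w^2}}{uw-v}\big)$. Let $\xi=\frac{vw+u}{\sqrt{w^2+1}}$. $\mathcal C_{(1)}$: $c_1\xi+c_2$. If $f\ne0$, $c=0$: $\mathcal C_{(0)}$: $\varphi(\xi)$; $\mathcal C_{(1+0)}$: $c_1\xi+c_2$. If $f\neq0$, $c\ne0$: $\mathcal C_{(0)}$: $\varphi(2\xi-c(u^2+v^2))$; $\mathcal C_{(1+0)}$: constants. \item $C_{3,9}$: $g^{12}=g^{21}=1$ and the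 other $g^{ij}=0$, $b=0$, $\omega=\mathrm{sk}(f(w),c\,g(w),g(w))$. $\mathcal C_{(1)}$: $c_1u+c_2v+\varphi(w)$. If $g=0$, $f\ne0$: $\mathcal C_{(0)}$ and $\mathcal C_{(1+0)}$: $\varphi(w)$. If $g\neq0$: $\mathcal C_{(0)}$: $\varphi(\xi)$; $\mathcal C_{(1+0)}$: $c_1\xi+c_2$, where $\xi=cv-\int\frac fg\,dw-u$. \item $C_{3,10}$: $g^{12}=g^{21}=1$ and the other $g^{ij}=0$, $b^{ij}_ku^k_x=\mathrm{sk}(0,-w_x/v,0)$, $\omega=\mathrm{sk}\big(f(w),\frac{h(w)-u\,g(w)}v,g(w)\big)$, where $fg+gh'-hg'=0$ (the Jacobi identity for $\omega$). $\mathcal C_{(1)}$: $\varphi(w)v+c_2$. Further: \begin{itemize} \item $f=g=0$, $h\ne0$: $\mathcal C_{(0)}$: $\varphi(v)$; $\mathcal C_{(1+0)}$: $c_1v+c_2$. \item $f=h=0$, $g\neq0$: $\mathcal C_{(0)}$: $\varphi(uv)$; $\mathcal C_{(1+0)}$: constants. \item $g=h=0$, $f\ne0$: $\mathcal C_{(0)}$: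 $\varphi(w)$; $\mathcal C_{(1+0)}$: constants. \item $g=0$, $f,h\neq0$: with $\xi=v\exp(-\int\frac fh\,dw)$, $\mathcal C_{(0)}$: $\varphi(\xi)$; $\mathcal C_{(1+0)}$: $c_1\xi+c_2$. \item $g\ne0$: $\mathcal C_{(0)}$: $\varphi\big(v\,\frac{ug-h}{g}\big)$; $\mathcal C_{(1+0)}$: constants. \end{itemize} \item $C_{3,11}$: $g^{12}=g^{21}=1$ and the other $g^{ij}=0$, $b^{ij}_ku^k_x=\frac{w_x}{uw-v}\mathrm{sk}(0,1,-w)$, $\omega=f(w)\,\mathrm{sk}\big(\frac c{\sqrt w},\frac{uw-2c\sqrt w}{uw-v},-\frac{w(v-2c\sqrt w)}{uw-v}\big)$. $\mathcal C_{(1)}$: $c_1\big(\frac v{\sqrt w}+\sqrt w\,u\big)+c_2$. If $f\neq0$: $\mathcal C_{(0)}$: $\varphi\big(2cu\sqrt w+\frac{2vc}{\sqrt w}-uv\big)$; $\mathcal C_{(1+0)}$: constants. \end{itemize} -/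

import Mathlib

open scoped ContDiff Topology

noncomputable section

/-- The coefficients of a differential operator of type `(1+0)` in `n` field variables,
`C^{ij} = g^{ij}(u) ∂ₓ + b^{ij}_k(u) u^k_x + ω^{ij}(u)`.
Here `g u i j = g^{ij}(u)`, `b u k i j = b^{ij}_k(u)` and `om u i j = ω^{ij}(u)`. -/
structure HydroOperator (n : ℕ) where
  g : (Fin n → ℝ) → Matrix (Fin n) (Fin n) ℝ
  b : (Fin n → ℝ) → Fin n → Matrix (Fin n) (Fin n) ℝ
  om : (Fin n → ℝ) → Matrix (Fin n) (Fin n) ℝ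

namespace HydroOperator

/-- The homogeneous first-order part `g^{ij} ∂ₓ + b^{ij}_k u^k_x`. -/
def firstOrder {n : ℕ} (C : HydroOperator n) : HydroOperator n where
  g := C.g
  b := C.b
  om := fun _ => 0

/-- The homogeneous zero-order (ultralocal) part `ω^{ij}`. -/
def zeroOrder {n : ℕ} (C : HydroOperator n) : HydroOperator n where
  g := fun _ => 0
  b := fun _ _ => 0
  om := C.om

end HydroOperator

/-- The partial derivative `∂F/∂u^j`. -/
def pd {n : ℕ} (j : Fin n) (F : (Fin n → ℝ) → ℝ) (p : Fin n → ℝ) : ℝ :=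
  fderiv ℝ F p (Pi.single j 1)

namespace HydroOperator

/-- The `i`-th component of `C^{ij} (δ𝓕/δu^j)` at the field `x ↦ u x`, for the functional
`𝓕 = ∫ F(u) dx` with hydrodynamic density `F`, whose variational derivative is `∂F/∂u^j`. -/
def applyGradient {n : ℕ} (C : HydroOperator n) (F : (Fin n → ℝ) → ℝ)
    (u : ℝ → Fin n → ℝ) (x : ℝ) (i : Fin n) : ℝ :=
  ∑ j, (C.g (u x) i j * deriv (fun y => pd j F (u y)) x
    + (∑ k, C.b (u x) k i j * deriv (fun y => u y k) x) * pd j F (u x)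
    + C.om (u x) i j * pd j F (u x))

/-- `F` is (the density of) a hydrodynamic Casimir of `C` on `D`: `C^{ij} (δ𝓕/δu^j)` vanishes
at every smooth field `u(x)`, wherever the field takes values in `D`. -/
def IsCasimir {n : ℕ} (C : HydroOperator n) (D : Set (Fin n → ℝ))
    (F : (Fin n → ℝ) → ℝ) : Prop :=
  ∀ u : ℝ → Fin n → ℝ, ContDiff ℝ ∞ u → ∀ x : ℝ, u x ∈ D → ∀ i, C.applyGradient F u x i = 0

end HydroOperator

/-- `F` is locally on `D` a smooth function of `θ`: around every point of `D` one has
`F = φ ∘ θ` with a smooth function `φ`. -/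
def IsLocalFunctionOf {n : ℕ} {E : Type*} [NormedAddCommGroup E] [NormedSpace ℝ E]
    (D : Set (Fin n → ℝ)) (θ : (Fin n → ℝ) → E) (F : (Fin n → ℝ) → ℝ) : Prop :=
  ∀ p ∈ D, ∃ (W : Set E) (φ : E → ℝ), IsOpen W ∧ θ p ∈ W ∧ ContDiffOn ℝ ∞ φ W ∧
    ∀ᶠ q in 𝓝 p, θ q ∈ W ∧ F q = φ (θ q)

/-- `F = c₁ θ + c₂` on `D` with constants `c₁`, `c₂`. -/
def IsAffineFunctionOf {n : ℕ} (D : Set (Fin n → ℝ)) (θ : (Fin n → ℝ) → ℝ)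
    (F : (Fin n → ℝ) → ℝ) : Prop :=
  ∃ c₁ c₂ : ℝ, ∀ p ∈ D, F p = c₁ * θ p + c₂

/-- `F` is constant on `D`. -/
def IsConstantOn {n : ℕ} (D : Set (Fin n → ℝ)) (F : (Fin n → ℝ) → ℝ) : Prop :=
  ∃ c₁ : ℝ, ∀ p ∈ D, F p = c₁

/-! The degenerate operators. The field variables are `(u, v) = (p 0, p 1)` for two components
and `(u, v, w) = (p 0, p 1, p 2)` for three. The entries of `b p` are the coefficient matrices
of `u_x`, `v_x` (and `w_x`), in this order. -/

def C21 (f : ℝ → ℝ) : HydroOperator 2 where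
  g := fun _ => !![1, 0; 0, 0]
  b := fun _ => 0
  om := fun p => !![0, f (p 1); -f (p 1), 0]

def C22 (f : ℝ → ℝ) : HydroOperator 2 where
  g := fun _ => !![1, 0; 0, 0]
  b := fun p => ![0, !![0, -1 / p 0; 1 / p 0, 0]]
  om := fun p => !![0, f (p 1) / p 0; -f (p 1) / p 0, 0]

def C31 (f : ℝ → ℝ → ℝ → ℝ) : HydroOperator 3 where
  g := fun _ => 0
  b := fun _ => ![0, 0, !![0, 1, 0; -1, 0, 0; 0, 0, 0]]
  om := fun p => !![0, f (p 0) (p 1) (p 2), 0; -f (p 0) (p 1) (p 2), 0, 0; 0, 0, 0]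

def C32 (f g h : ℝ → ℝ → ℝ) : HydroOperator 3 where
  g := fun _ => !![1, 0, 0; 0, 0, 0; 0, 0, 0]
  b := fun _ => 0
  om := fun p =>
    !![0, f (p 1) (p 2), g (p 1) (p 2);
       -f (p 1) (p 2), 0, h (p 1) (p 2);
       -g (p 1) (p 2), -h (p 1) (p 2), 0]

def C33 (f : ℝ → ℝ → ℝ) : HydroOperator 3 where
  g := fun _ => !![1, 0, 0; 0, 0, 0; 0, 0, 0]
  b := fun _ => ![0, 0, !![0, 1, 0; -1, 0, 0; 0, 0, 0]]
  om := fun p => !![0, f (p 1) (p 2), 0; -f (p 1) (p 2), 0, 0; 0, 0, 0]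

def C34 (f : ℝ → ℝ → ℝ) : HydroOperator 3 where
  g := fun _ => !![1, 0, 0; 0, 0, 0; 0, 0, 0]
  b := fun p => ![0, 0, !![0, 0, -1 / p 0; 0, 0, 0; 1 / p 0, 0, 0]]
  om := fun p =>
    !![0, 0, f (p 1) (p 2) / p 0; 0, 0, 0; -f (p 1) (p 2) / p 0, 0, 0]

def C35 (f g h : ℝ → ℝ → ℝ) : HydroOperator 3 where
  g := fun _ => !![1, 0, 0; 0, 0, 0; 0, 0, 0]
  b := fun p =>
    ![0,
      (1 / p 0) • !![0, -1, 0; 1, 0, 0; 0, 0, 0],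
      (1 / p 0) • !![0, 0, -1; 0, 0, 0; 1, 0, 0]]
  om := fun p =>
    (1 / p 0) •
      !![0, f (p 1) (p 2), g (p 1) (p 2);
         -f (p 1) (p 2), 0, h (p 1) (p 2);
         -g (p 1) (p 2), -h (p 1) (p 2), 0]

def C36 (f g : ℝ → ℝ) (c : ℝ) : HydroOperator 3 where
  g := fun _ => !![1, 0, 0; 0, 1, 0; 0, 0, 0]
  b := fun _ => 0
  om := fun p =>
    !![0, f (p 2), g (p 2); -f (p 2), 0, c * g (p 2); -g (p 2), -(c * g (p 2)), 0]

def C37 (f : ℝ → ℝ) (c : ℝ) : HydroOperator 3 where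
  g := fun _ => !![1, 0, 0; 0, 1, 0; 0, 0, 0]
  b := fun p => ![0, 0, !![0, 0, 0; 0, 0, -1 / p 1; 0, 1 / p 1, 0]]
  om := fun p =>
    !![0, 0, c * f (p 2);
       0, 0, (1 - c * p 0) * f (p 2) / p 1;
       -(c * f (p 2)), -((1 - c * p 0) * f (p 2) / p 1), 0]

def C38 (f : ℝ → ℝ) (c : ℝ) : HydroOperator 3 where
  g := fun _ => !![1, 0, 0; 0, 1, 0; 0, 0, 0]
  b := fun p =>
    ![0, 0,
      !![0, 0, -(p 2 / (p 0 * p 2 - p 1));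
         0, 0, 1 / (p 0 * p 2 - p 1);
         p 2 / (p 0 * p 2 - p 1), -(1 / (p 0 * p 2 - p 1)), 0]]
  om := fun p =>
    ((1 + p 2 ^ 2) * f (p 2)) •
      !![0, 1 / (1 + p 2 ^ 2), (p 2 - c * p 1 * √(1 + p 2 ^ 2)) / (p 0 * p 2 - p 1);
         -(1 / (1 + p 2 ^ 2)), 0, -((1 - c * p 0 * √(1 + p 2 ^ 2)) / (p 0 * p 2 - p 1));
         -((p 2 - c * p 1 * √(1 + p 2 ^ 2)) / (p 0 * p 2 - p 1)),
           (1 - c * p 0 * √(1 + p 2 ^ 2)) / (p 0 * p 2 - p 1), 0]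

def C39 (f g : ℝ → ℝ) (c : ℝ) : HydroOperator 3 where
  g := fun _ => !![0, 1, 0; 1, 0, 0; 0, 0, 0]
  b := fun _ => 0
  om := fun p =>
    !![0, f (p 2), c * g (p 2); -f (p 2), 0, g (p 2); -(c * g (p 2)), -g (p 2), 0]

def C310 (f g h : ℝ → ℝ) : HydroOperator 3 where
  g := fun _ => !![0, 1, 0; 1, 0, 0; 0, 0, 0]
  b := fun p => ![0, 0, !![0, 0, -1 / p 1; 0, 0, 0; 1 / p 1, 0, 0]]
  om := fun p =>
    !![0, f (p 2), (h (p 2) - p 0 * g (p 2)) / p 1;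
       -f (p 2), 0, g (p 2);
       -((h (p 2) - p 0 * g (p 2)) / p 1), -g (p 2), 0]

def C311 (f : ℝ → ℝ) (c : ℝ) : HydroOperator 3 where
  g := fun _ => !![0, 1, 0; 1, 0, 0; 0, 0, 0]
  b := fun p =>
    ![0, 0,
      !![0, 0, 1 / (p 0 * p 2 - p 1);
         0, 0, -(p 2 / (p 0 * p 2 - p 1));
         -(1 / (p 0 * p 2 - p 1)), p 2 / (p 0 * p 2 - p 1), 0]]
  om := fun p =>
    f (p 2) •
      !![0, c / √(p 2), (p 0 * p 2 - 2 * c * √(p 2)) / (p 0 * p 2 - p 1);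
         -(c / √(p 2)), 0, -(p 2 * (p 1 - 2 * c * √(p 2)) / (p 0 * p 2 - p 1));
         -((p 0 * p 2 - 2 * c * √(p 2)) / (p 0 * p 2 - p 1)),
           p 2 * (p 1 - 2 * c * √(p 2)) / (p 0 * p 2 - p 1), 0]

/-- The closure relation (Jacobi identity of the zero-order part) for the operators `C32`, `C35`:
`f h_v - h f_v + g h_w - h g_w = 0` for `v ∈ I`, `w ∈ J`. -/
def ClosureRelation (I J : Set ℝ) (f g h : ℝ → ℝ → ℝ) : Prop :=
  ∀ v ∈ I, ∀ w ∈ J,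
    f v w * deriv (fun s => h s w) v - h v w * deriv (fun s => f s w) v
      + g v w * deriv (fun s => h v s) w - h v w * deriv (fun s => g v s) w = 0

/-- The linear system for the Casimirs of the zero-order part of `C32`, `C35`. -/
def UltralocalSystem (D : Set (Fin 3 → ℝ)) (f g h : ℝ → ℝ → ℝ) (F : (Fin 3 → ℝ) → ℝ) : Prop :=
  ∀ p ∈ D,
    f (p 1) (p 2) * pd 1 F p + g (p 1) (p 2) * pd 2 F p = 0 ∧
    f (p 1) (p 2) * pd 0 F p - h (p 1) (p 2) * pd 2 F p = 0 ∧
    g (p 1) (p 2) * pd 0 F p + h (p 1) (p 2) * pd 1 F p = 0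

/-- `F = c u + φ(v, w)` on `D`, with a constant `c` and, locally, a smooth function `φ`. -/
def IsLinearPlusFunctionVW (D : Set (Fin 3 → ℝ)) (F : (Fin 3 → ℝ) → ℝ) : Prop :=
  ∃ (c : ℝ) (G : (Fin 3 → ℝ) → ℝ), IsLocalFunctionOf D (fun p => (p 1, p 2)) G ∧
    ∀ p ∈ D, F p = c * p 0 + G p

/-- `F = c₁ u + c₂ v + φ(w)` on `D`, with constants `c₁`, `c₂` and, locally, a smooth `φ`. -/
def IsLinearPlusFunctionW (D : Set (Fin 3 → ℝ)) (F : (Fin 3 → ℝ) → ℝ) : Prop :=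
  ∃ (c₁ c₂ : ℝ) (G : (Fin 3 → ℝ) → ℝ), IsLocalFunctionOf D (fun p => p 2) G ∧
    ∀ p ∈ D, F p = c₁ * p 0 + c₂ * p 1 + G p

end

/-! At a fixed point the condition on a field is affine in the velocity `u_x`, and straight-line
fields realise every velocity. Comparing coefficients turns the Casimir property into a pointwise
linear system for the first and second partial derivatives of `F` (`isCasimir_iff`). In particular
the Casimirs of the full operator are the common Casimirs of its two homogeneous parts
(`isCasimir_iff_firstOrder_and_zeroOrder`), so each operator needs only two separate computations
and an intersection.

Zero-order part. A nonzero skew matrix sk(a, b, d) has as kernel the line spanned by (d, -b, a).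
Whenever this vector equals m∇θ with m ≠ 0, Casimirs are the functions whose gradient is at each
point a multiple of ∇θ (`zeroOrder_isCasimir_iff_proportional`). Since ∇θ ≠ 0, θ can be taken as a
coordinate by the inverse function theorem, and these are locally the smooth functions of θ
(`isLocalFunctionOf_iff`). The closure relations are what make the kernel direction integrable in
this way. In the simplest cases the system just says that some partial derivatives vanish.

First-order part. Rows in which the metric vanishes are algebraic in ∇F. Differentiating such a
relation and inserting it in the remaining rows leaves a linear ODE for one partial derivative of
`F`, or forces derivatives to vanish. After multiplication by an integrating factor the surviving
derivative has zero gradient, hence is constant because the domain is connected. For `C38` and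
`C311` this gives ∇F = k∇ξ with one constant k on the whole domain; for `C310` the constant is F -
vF_v.

Full operator. A pointwise multiplier l of ∇θ must agree with the global constants of the
first-order part. Either this makes l constant and `F` affine in θ, or comparison of the components
of k∇ξ = l∇θ forces l = 0 and `F` constant. -/

noncomputable section

/-! ### Partial derivatives and functional dependence. -/

section PartialDerivatives

variable {n : ℕ} {D : Set (Fin n → ℝ)} {F G θ : (Fin n → ℝ) → ℝ} {p : Fin n → ℝ}

theorem pd_congr {j : Fin n} (h : F =ᶠ[𝓝 p] G) : pd j F p = pd j G p := by
  simp [pd, h.fderiv_eq]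

theorem pd_congr_on (hD : IsOpen D) (h : ∀ q ∈ D, F q = G q) (hp : p ∈ D) (j : Fin n) :
    pd j F p = pd j G p :=
  pd_congr (Filter.eventually_of_mem (hD.mem_nhds hp) h)

theorem clm_apply_eq_sum_single (L : (Fin n → ℝ) →L[ℝ] ℝ) (q : Fin n → ℝ) :
    L q = ∑ k, q k * L (Pi.single k 1) := by
  have h := LinearMap.pi_apply_eq_sum_univ (L : (Fin n → ℝ) →ₗ[ℝ] ℝ) q
  simp only [ContinuousLinearMap.coe_coe, smul_eq_mul] at h
  rw [h]
  refine Finset.sum_congr rfl fun k _ => ?_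
  congr 2
  ext j
  simp [Pi.single_apply, eq_comm]

theorem fderiv_apply_eq_sum_pd (F : (Fin n → ℝ) → ℝ) (p q : Fin n → ℝ) :
    fderiv ℝ F p q = ∑ k, q k * pd k F p :=
  clm_apply_eq_sum_single _ _

theorem fderiv_eq_zero_of_pd (h : ∀ i, pd i F p = 0) : fderiv ℝ F p = 0 := by
  ext q
  simp [fderiv_apply_eq_sum_pd, h]

theorem contDiffOn_pd (hD : IsOpen D) (hF : ContDiffOn ℝ ∞ F D) (j : Fin n) :
    ContDiffOn ℝ ∞ (pd j F) D :=
  (hF.fderiv_of_isOpen hD (m := ∞) (by simp)).clm_apply contDiffOn_const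

theorem differentiableAt_of_contDiffOn (hD : IsOpen D) (hF : ContDiffOn ℝ ∞ F D) (hp : p ∈ D) :
    DifferentiableAt ℝ F p :=
  (hF.contDiffAt (hD.mem_nhds hp)).differentiableAt (by simp)

theorem pd_comm (hD : IsOpen D) (hF : ContDiffOn ℝ ∞ F D) (hp : p ∈ D) (i j : Fin n) :
    pd i (pd j F) p = pd j (pd i F) p := by
  have hs : IsSymmSndFDerivAt ℝ F p :=
    (hF.contDiffAt (hD.mem_nhds hp)).isSymmSndFDerivAt (by
      rw [minSmoothness_of_isRCLikeNormedField]
      exact WithTop.coe_le_coe.2 (le_top (a := (2 : ℕ∞))))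
  have hd : DifferentiableAt ℝ (fderiv ℝ F) p :=
    ((hF.fderiv_of_isOpen hD (m := ∞) (by simp)).contDiffAt (hD.mem_nhds hp)).differentiableAt
      (by simp)
  have key : ∀ k l : Fin n, pd k (pd l F) p
      = fderiv ℝ (fderiv ℝ F) p (Pi.single k 1) (Pi.single l 1) := by
    intro k l
    have := (hd.hasFDerivAt.clm_apply (hasFDerivAt_const (Pi.single l (1 : ℝ)) p)).fderiv
    unfold pd
    rw [this]
    simp
  rw [key, key]
  exact hs _ _

/-- Restriction to a coordinate line reduces gradients to one-variable calculus. Differentiability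
of `F` has to be known beforehand, since a derivative along one line does not give it. -/
theorem pd_eq_of_hasDerivAt {j : Fin n} {F' : ℝ} (hF : DifferentiableAt ℝ F p)
    (h : HasDerivAt (fun t => F (Function.update p j t)) F' (p j)) : pd j F p = F' := by
  have h1 : HasDerivAt (fun t => Function.update p j t) (Pi.single j (1 : ℝ)) (p j) :=
    hasDerivAt_update p j (p j)
  have h2 : HasFDerivAt F (fderiv ℝ F p) (Function.update p j (p j)) := by
    simpa using hF.hasFDerivAt
  exact (h2.comp_hasDerivAt (p j) h1).unique h

theorem pd_sub (hF : DifferentiableAt ℝ F p) (hG : DifferentiableAt ℝ G p) (j : Fin n) :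
    pd j (fun q => F q - G q) p = pd j F p - pd j G p := by
  unfold pd
  rw [fderiv_fun_sub hF hG]
  simp

theorem pd_add (hF : DifferentiableAt ℝ F p) (hG : DifferentiableAt ℝ G p) (j : Fin n) :
    pd j (fun q => F q + G q) p = pd j F p + pd j G p := by
  unfold pd
  rw [fderiv_fun_add hF hG]
  simp

theorem pd_mul (hF : DifferentiableAt ℝ F p) (hG : DifferentiableAt ℝ G p) (j : Fin n) :
    pd j (fun q => F q * G q) p = pd j F p * G p + F p * pd j G p := by
  unfold pd
  rw [fderiv_fun_mul hF hG]
  simp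
  ring

theorem pd_const (c : ℝ) (j : Fin n) : pd j (fun _ => c) p = 0 := by
  simp [pd]

theorem pd_const_mul (hF : DifferentiableAt ℝ F p) (c : ℝ) (j : Fin n) :
    pd j (fun q => c * F q) p = c * pd j F p := by
  rw [pd_mul (differentiableAt_const c) hF, pd_const]
  ring

theorem pd_comp_coord {a : ℝ → ℝ} {a' : ℝ} {i : Fin n} (ha : HasDerivAt a a' (p i))
    (j : Fin n) : pd j (fun q => a (q i)) p = if j = i then a' else 0 := by
  have h := ha.comp_hasFDerivAt p (hasFDerivAt_apply (𝕜 := ℝ) i p)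
  unfold pd
  rw [show (fun q : Fin n → ℝ => a (q i)) = a ∘ fun q => q i from rfl, h.fderiv]
  by_cases hij : j = i
  · subst hij; simp
  · simp [hij, Ne.symm hij]

theorem pd_coord (i j : Fin n) : pd j (fun q => q i) p = if j = i then 1 else 0 :=
  pd_comp_coord (a := fun x => x) (hasDerivAt_id _) j

theorem pd_coord_mul {a : ℝ → ℝ} {a' : ℝ} {i : Fin n} (ha : HasDerivAt a a' (p i))
    (hF : DifferentiableAt ℝ F p) (j : Fin n) :
    pd j (fun q => a (q i) * F q) p = (if j = i then a' else 0) * F p + a (p i) * pd j F p := by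
  rw [pd_mul _ hF, pd_comp_coord ha]
  exact ha.differentiableAt.comp p (differentiableAt_apply i p)

theorem exists_const_of_pd_eq_zero (hD : IsOpen D) (hc : IsPreconnected D)
    (hF : ∀ p ∈ D, DifferentiableAt ℝ F p) (h : ∀ p ∈ D, ∀ i, pd i F p = 0) :
    ∃ c, ∀ p ∈ D, F p = c :=
  hD.exists_is_const_of_fderiv_eq_zero hc
    (fun p hp => (hF p hp).differentiableWithinAt) (fun p hp => fderiv_eq_zero_of_pd (h p hp))

theorem isConstantOn_iff (hD : IsOpen D) (hc : IsPreconnected D) (hF : ContDiffOn ℝ ∞ F D) :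
    IsConstantOn D F ↔ ∀ p ∈ D, ∀ i, pd i F p = 0 := by
  constructor
  · rintro ⟨c, h⟩ p hp i
    rw [pd_congr_on hD h hp, pd_const]
  · exact exists_const_of_pd_eq_zero hD hc fun p hp => differentiableAt_of_contDiffOn hD hF hp

/-- The multiplier c is the same at all points, in contrast with `isLocalFunctionOf_iff`, where it
may vary; connectedness then makes the difference of `F` and cθ a single constant. -/
theorem isAffineFunctionOf_iff (hD : IsOpen D) (hc : IsPreconnected D)
    (hF : ContDiffOn ℝ ∞ F D) (hθ : ∀ p ∈ D, DifferentiableAt ℝ θ p) :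
    IsAffineFunctionOf D θ F ↔ ∃ c, ∀ p ∈ D, ∀ i, pd i F p = c * pd i θ p := by
  constructor
  · rintro ⟨c, d, h⟩
    refine ⟨c, fun p hp i => ?_⟩
    rw [pd_congr_on hD h hp, pd_add ((hθ p hp).const_mul c) (differentiableAt_const d),
      pd_const_mul (hθ p hp), pd_const, add_zero]
  · rintro ⟨c, h⟩
    have hF' := fun p hp => differentiableAt_of_contDiffOn (p := p) hD hF hp
    obtain ⟨d, hd⟩ := exists_const_of_pd_eq_zero (F := fun q => F q - c * θ q) hD hc
      (fun p hp => (hF' p hp).sub ((hθ p hp).const_mul c)) (fun p hp i => by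
        rw [pd_sub (hF' p hp) ((hθ p hp).const_mul c), pd_const_mul (hθ p hp), h p hp, sub_self])
    exact ⟨c, d, fun p hp => by linarith [hd p hp]⟩

/-- Mean value theorem on the segment from x to y: only the derivative in the direction y - x
matters, so other directions are left free. -/
theorem eq_of_fderiv_apply_sub_eq_zero {E : Type*} [NormedAddCommGroup E] [NormedSpace ℝ E]
    {K : E → ℝ} {s : Set E} (hs : Convex ℝ s) (hK : ∀ z ∈ s, DifferentiableAt ℝ K z)
    {x y : E} (hx : x ∈ s) (hy : y ∈ s) (h : ∀ z ∈ s, fderiv ℝ K z (y - x) = 0) : K y = K x := by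
  obtain ⟨z, hz, hz'⟩ := domain_mvt (f := K) (f' := fderiv ℝ K) (s := s)
    (fun z hz => (hK z hz).hasFDerivAt.hasFDerivWithinAt) hs hx hy
  rw [h z (hs.segment_subset hx hy hz)] at hz'
  linarith

theorem pd_of_isLocalFunctionOf {E : Type*} [NormedAddCommGroup E] [NormedSpace ℝ E]
    {θ : (Fin n → ℝ) → E} (h : IsLocalFunctionOf D θ F) (hp : p ∈ D)
    (hθ : DifferentiableAt ℝ θ p) :
    ∃ L : E →L[ℝ] ℝ, ∀ i, pd i F p = L (fderiv ℝ θ p (Pi.single i 1)) := by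
  obtain ⟨W, φ, hW, hpW, hφ, hev⟩ := h p hp
  have hd : DifferentiableAt ℝ φ (θ p) :=
    (hφ.contDiffAt (hW.mem_nhds hpW)).differentiableAt (by simp)
  refine ⟨fderiv ℝ φ (θ p), fun i => ?_⟩
  have : F =ᶠ[𝓝 p] φ ∘ θ := hev.mono fun q hq => hq.2
  rw [pd_congr this, pd, fderiv_comp p hd hθ]
  rfl

/-- Supplies smoothness of the arbitrary summand or factor `G` in the normal forms, which is not
assumed there separately. -/
theorem contDiffOn_of_isLocalFunctionOf {E : Type*} [NormedAddCommGroup E] [NormedSpace ℝ E]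
    {θ : (Fin n → ℝ) → E} (h : IsLocalFunctionOf D θ F) (hθ : ContDiff ℝ ∞ θ) :
    ContDiffOn ℝ ∞ F D := by
  intro p hp
  obtain ⟨W, φ, hW, hpW, hφ, hev⟩ := h p hp
  have : F =ᶠ[𝓝 p] φ ∘ θ := hev.mono fun q hq => hq.2
  exact (((hφ.contDiffAt (hW.mem_nhds hpW)).comp p hθ.contDiffAt).congr_of_eventuallyEq
    this).contDiffWithinAt

/-- The linear automorphism replacing the `j`-th coordinate by a functional `L` with
`L eⱼ ≠ 0`. -/
def replaceCoordEquiv (L : (Fin n → ℝ) →L[ℝ] ℝ) (j : Fin n) (hL : L (Pi.single j 1) ≠ 0) :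
    (Fin n → ℝ) ≃L[ℝ] (Fin n → ℝ) :=
  ContinuousLinearEquiv.equivOfInverse
    (ContinuousLinearMap.id ℝ _
      + (L - ContinuousLinearMap.proj (R := ℝ) (φ := fun _ : Fin n => ℝ) j).smulRight
        (Pi.single j (1 : ℝ)))
    (ContinuousLinearMap.id ℝ _
      + ((L (Pi.single j 1))⁻¹ •
        (ContinuousLinearMap.proj (R := ℝ) (φ := fun _ : Fin n => ℝ) j - L)).smulRight
        (Pi.single j (1 : ℝ)))
    (fun x => by
      ext i
      by_cases hi : i = j
      · subst hi
        simp
        field_simp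
        ring
      · simp [hi])
    (fun x => by
      ext i
      by_cases hi : i = j
      · subst hi
        simp
        field_simp
        ring
      · simp [hi])

/-- Straightening: with θ as the `j`-th coordinate, proportional gradients mean that `F` has no
derivative in the other coordinate directions, so on a small ball it depends on θ alone. -/
theorem exists_local_function_of_pd_proportional (hD : IsOpen D) (hθ : ContDiffOn ℝ ∞ θ D)
    (hF : ContDiffOn ℝ ∞ F D) (h : ∀ p ∈ D, ∃ l : ℝ, ∀ i, pd i F p = l * pd i θ p)
    (hp : p ∈ D) {j : Fin n} (hj : pd j θ p ≠ 0) :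
    ∃ (W : Set ℝ) (φ : ℝ → ℝ), IsOpen W ∧ θ p ∈ W ∧ ContDiffOn ℝ ∞ φ W ∧
      ∀ᶠ q in 𝓝 p, θ q ∈ W ∧ F q = φ (θ q) := by
  -- The new chart keeps every coordinate except the `j`-th, which becomes θ; its derivative is
  -- invertible exactly because θ has nonzero `j`-th partial derivative.
  set Φ : (Fin n → ℝ) → (Fin n → ℝ) := fun q => q + (θ q - q j) • Pi.single j (1 : ℝ) with hΦ
  have hΦj : ∀ q, Φ q j = θ q := fun q => by simp [hΦ]
  have hΦs : ∀ q ∈ D, ContDiffAt ℝ ∞ Φ q := fun q hq =>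
    contDiffAt_id.add (((hθ.contDiffAt (hD.mem_nhds hq)).sub
      (contDiff_apply ℝ ℝ j).contDiffAt).smul contDiffAt_const)
  have hΦd : ∀ q ∈ D, ∀ hq : pd j θ q ≠ 0, HasFDerivAt Φ
      (replaceCoordEquiv (fderiv ℝ θ q) j hq : (Fin n → ℝ) →L[ℝ] (Fin n → ℝ)) q := by
    intro q hq hq0
    have h1 : HasFDerivAt (fun q : Fin n → ℝ => θ q - q j) (fderiv ℝ θ q
        - ContinuousLinearMap.proj (R := ℝ) (φ := fun _ : Fin n => ℝ) j) q :=
      (differentiableAt_of_contDiffOn hD hθ hq).hasFDerivAt.sub (hasFDerivAt_apply (𝕜 := ℝ) j q)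
    exact (hasFDerivAt_id q).add (h1.smul_const (Pi.single j (1 : ℝ) : Fin n → ℝ))
  set e := (hΦs p hp).toOpenPartialHomeomorph Φ (hΦd p hp hj) (by simp) with he
  have hee : ∀ q, e q = Φ q := fun q => rfl
  have hpe : p ∈ e.source := (hΦs p hp).mem_toOpenPartialHomeomorph_source (hΦd p hp hj) (by simp)
  have hpt : Φ p ∈ e.target := e.map_source hpe
  have hsymm : e.symm (Φ p) = p := e.left_inv hpe
  have hcont : ContinuousAt e.symm (Φ p) := e.continuousAt_symm hpt
  -- the good set in the target
  have hD' : D ∩ {q | pd j θ q ≠ 0} ∈ 𝓝 p := Filter.inter_mem (hD.mem_nhds hp)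
    (((contDiffOn_pd hD hθ j).continuousOn.continuousAt (hD.mem_nhds hp)).eventually_ne hj)
  have hT : e.target ∩ e.symm ⁻¹' (D ∩ {q | pd j θ q ≠ 0}) ∈ 𝓝 (Φ p) :=
    Filter.inter_mem (e.open_target.mem_nhds hpt) (hcont (by rwa [hsymm]))
  -- A ball is convex, as the mean value argument needs, and in the sup metric it is a product of
  -- intervals, so altering one coordinate within distance r of the centre stays inside.
  obtain ⟨r, hr, hball⟩ := Metric.mem_nhds_iff.1 hT
  have hsm : ∀ y ∈ Metric.ball (Φ p) r, ContDiffAt ℝ ∞ e.symm y := fun y hy =>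
    e.contDiffAt_symm (hball hy).1 (hΦd _ (hball hy).2.1 (hball hy).2.2) (hΦs _ (hball hy).2.1)
  have hG : ∀ y ∈ Metric.ball (Φ p) r, ContDiffAt ℝ ∞ (F ∘ e.symm) y := fun y hy =>
    (hF.contDiffAt (hD.mem_nhds (hball hy).2.1)).comp y (hsm y hy)
  have hθe : ∀ y ∈ Metric.ball (Φ p) r, θ (e.symm y) = y j := fun y hy => by
    rw [← hΦj, ← hee, e.right_inv (hball hy).1]
  -- In the new chart dF = l dθ and dθ is the `j`-th coordinate form, which kills vectors without a
  -- `j`-th component.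
  have hGd : ∀ y ∈ Metric.ball (Φ p) r, ∀ z : Fin n → ℝ, z j = 0 →
      fderiv ℝ (F ∘ e.symm) y z = 0 := by
    intro y hy z hz
    have hyD := (hball hy).2.1
    have hsd : DifferentiableAt ℝ e.symm y := (hsm y hy).differentiableAt (by simp)
    obtain ⟨l, hl⟩ := h _ hyD
    have hfd : fderiv ℝ F (e.symm y) = l • fderiv ℝ θ (e.symm y) := by
      ext q
      simp only [smul_apply, smul_eq_mul, fderiv_apply_eq_sum_pd,
        Finset.mul_sum, hl]
      exact Finset.sum_congr rfl fun k _ => by ring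
    have hθd : fderiv ℝ (θ ∘ e.symm) y z = 0 := by
      have : θ ∘ e.symm =ᶠ[𝓝 y] fun y => y j :=
        Filter.eventually_of_mem (Metric.isOpen_ball.mem_nhds hy) hθe
      rw [this.fderiv_eq, (hasFDerivAt_apply (𝕜 := ℝ) j y).fderiv]
      simpa using hz
    rw [fderiv_comp y (differentiableAt_of_contDiffOn hD hθ hyD) hsd] at hθd
    rw [fderiv_comp y (differentiableAt_of_contDiffOn hD hF hyD) hsd, hfd]
    simp only [ContinuousLinearMap.smul_comp, smul_apply, hθd, smul_zero]
  have hupd : ∀ t, |t - θ p| < r → Function.update (Φ p) j t ∈ Metric.ball (Φ p) r := by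
    intro t ht
    rw [Metric.mem_ball, dist_pi_lt_iff hr]
    intro i
    by_cases hi : i = j
    · subst hi
      simpa [hΦj, Real.dist_eq] using ht
    · simpa [hi] using hr
  have hupds : ContDiff ℝ ∞ (fun t : ℝ => Function.update (Φ p) j t) := by
    rw [contDiff_pi]
    intro i
    by_cases hi : i = j
    · subst hi
      simpa using contDiff_fun_id
    · simpa [hi] using contDiff_const
  -- φ is `F` read along the `j`-th coordinate line of the new chart through the image of p.
  refine ⟨Metric.ball (θ p) r, fun t => F (e.symm (Function.update (Φ p) j t)),
    Metric.isOpen_ball, Metric.mem_ball_self hr, ?_, ?_⟩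
  · intro t ht
    exact ((hG _ (hupd t ht)).comp t hupds.contDiffAt).contDiffWithinAt
  · have h1 : ∀ᶠ q in 𝓝 p, Φ q ∈ Metric.ball (Φ p) r :=
      (hΦs p hp).continuousAt (Metric.ball_mem_nhds _ hr)
    filter_upwards [h1, e.open_source.mem_nhds hpe] with q hq hqs
    have hqW : θ q ∈ Metric.ball (θ p) r := by
      have := (dist_pi_lt_iff hr).1 hq j
      simpa [hΦj] using this
    refine ⟨hqW, ?_⟩
    have := eq_of_fderiv_apply_sub_eq_zero (K := F ∘ e.symm) (convex_ball (Φ p) r)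
      (fun z hz => (hG z hz).differentiableAt (by simp)) (hupd _ hqW) hq
      (fun z hz => hGd z hz _ (by simp [hΦj]))
    simpa [← hee, e.left_inv hqs] using this

theorem isLocalFunctionOf_iff (hD : IsOpen D) (hθ : ContDiffOn ℝ ∞ θ D)
    (hF : ContDiffOn ℝ ∞ F D) (hθ0 : ∀ p ∈ D, ∃ j, pd j θ p ≠ 0) :
    IsLocalFunctionOf D θ F ↔ ∀ p ∈ D, ∃ l : ℝ, ∀ i, pd i F p = l * pd i θ p := by
  constructor
  · intro h p hp
    obtain ⟨L, hL⟩ := pd_of_isLocalFunctionOf h hp (differentiableAt_of_contDiffOn hD hθ hp)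
    refine ⟨L 1, fun i => ?_⟩
    rw [hL i, ← pd]
    -- A linear form on ℝ is multiplication by its value at 1, which is the multiplier l.
    conv_lhs => rw [← mul_one (pd i θ p), ← smul_eq_mul, map_smul]
    simp [mul_comm]
  · intro h p hp
    obtain ⟨j, hj⟩ := hθ0 p hp
    exact exists_local_function_of_pd_proportional hD hθ hF h hp hj

theorem isLocalFunctionOf_coord_iff (hD : IsOpen D) (hF : ContDiffOn ℝ ∞ F D) (j : Fin n) :
    IsLocalFunctionOf D (fun p => p j) F ↔ ∀ p ∈ D, ∀ i, i ≠ j → pd i F p = 0 := by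
  rw [isLocalFunctionOf_iff hD (contDiff_apply ℝ ℝ j).contDiffOn hF
    (fun p _ => ⟨j, by simp [pd_coord]⟩)]
  refine forall₂_congr fun p hp => ⟨?_, fun h => ⟨pd j F p, fun i => ?_⟩⟩
  · rintro ⟨l, hl⟩ i hi
    simp [hl i, pd_coord, hi]
  · by_cases hi : i = j
    · simp [pd_coord, hi]
    · simp [pd_coord, hi, h i hi]

/-- No straightening is needed for two arguments: φ is the restriction of `F` to the slice u = u(p),
and inside a ball every point is joined to that slice by a segment in the u-direction. -/
theorem isLocalFunctionOf_vw_iff {D : Set (Fin 3 → ℝ)} {F : (Fin 3 → ℝ) → ℝ} (hD : IsOpen D)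
    (hF : ContDiffOn ℝ ∞ F D) :
    IsLocalFunctionOf D (fun p => (p 1, p 2)) F ↔ ∀ p ∈ D, pd 0 F p = 0 := by
  have hproj : ContDiff ℝ ∞ (fun p : Fin 3 → ℝ => (p 1, p 2)) :=
    (contDiff_apply ℝ ℝ 1).prodMk (contDiff_apply ℝ ℝ 2)
  constructor
  · intro h p hp
    obtain ⟨L, hL⟩ := pd_of_isLocalFunctionOf h hp
      (hproj.contDiffAt.differentiableAt (by simp))
    rw [hL, ((hasFDerivAt_apply (𝕜 := ℝ) (1 : Fin 3) p).prodMk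
      (hasFDerivAt_apply (𝕜 := ℝ) (2 : Fin 3) p)).fderiv]
    exact (congrArg L (by simp)).trans (map_zero L)
  · intro h p hp
    obtain ⟨r, hr, hball⟩ := Metric.mem_nhds_iff.1 (hD.mem_nhds hp)
    have hmem : ∀ x : ℝ × ℝ, x ∈ Metric.ball (p 1, p 2) r →
        (![p 0, x.1, x.2] : Fin 3 → ℝ) ∈ Metric.ball p r := by
      intro x hx
      rw [Metric.mem_ball, Prod.dist_eq, max_lt_iff] at hx
      rw [Metric.mem_ball, dist_pi_lt_iff hr]
      intro i
      fin_cases i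
      · simpa using hr
      · exact hx.1
      · exact hx.2
    have hι : ContDiff ℝ ∞ (fun x : ℝ × ℝ => (![p 0, x.1, x.2] : Fin 3 → ℝ)) := by
      rw [contDiff_pi]
      intro i
      fin_cases i
      · exact contDiff_const
      · exact contDiff_fst
      · exact contDiff_snd
    refine ⟨Metric.ball (p 1, p 2) r, fun x => F ![p 0, x.1, x.2], Metric.isOpen_ball,
      Metric.mem_ball_self hr, fun x hx => ?_, ?_⟩
    · exact ((hF.contDiffAt (hD.mem_nhds (hball (hmem x hx)))).comp x
        hι.contDiffAt).contDiffWithinAt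
    · filter_upwards [Metric.ball_mem_nhds p hr] with q hq
      have hqW : (q 1, q 2) ∈ Metric.ball (p 1, p 2) r := by
        have h' := (dist_pi_lt_iff hr).1 hq
        rw [Metric.mem_ball, Prod.dist_eq, max_lt_iff]
        exact ⟨h' 1, h' 2⟩
      refine ⟨hqW, ?_⟩
      refine eq_of_fderiv_apply_sub_eq_zero (K := F) (convex_ball p r)
        (fun z hz => differentiableAt_of_contDiffOn hD hF (hball hz)) (hmem (q 1, q 2) hqW) hq
        (fun z hz => ?_)
      rw [fderiv_apply_eq_sum_pd, Fin.sum_univ_three, h z (hball hz)]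
      simp

end PartialDerivatives

/-! ### The Casimir condition as a pointwise system. -/

section Casimirs

variable {n : ℕ} {D : Set (Fin n → ℝ)} {F : (Fin n → ℝ) → ℝ} (C : HydroOperator n)

/-- The chain rule collects the terms linear in the velocity, separating them from the zero-order
term. -/
theorem applyGradient_eq (hD : IsOpen D) (hF : ContDiffOn ℝ ∞ F D) {u : ℝ → Fin n → ℝ}
    {x : ℝ} (hu : DifferentiableAt ℝ u x) (hx : u x ∈ D) (i : Fin n) :
    C.applyGradient F u x i = ∑ k, deriv u x k *
        (∑ j, (C.g (u x) i j * pd k (pd j F) (u x) + C.b (u x) k i j * pd j F (u x)))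
      + ∑ j, C.om (u x) i j * pd j F (u x) := by
  have h1 : ∀ j, deriv (fun y => pd j F (u y)) x = ∑ k, deriv u x k * pd k (pd j F) (u x) := by
    intro j
    rw [← fderiv_apply_eq_sum_pd]
    exact ((differentiableAt_of_contDiffOn hD (contDiffOn_pd hD hF j)
      hx).hasFDerivAt.comp_hasDerivAt x hu.hasDerivAt).deriv
  have h2 : ∀ k, deriv (fun y => u y k) x = deriv u x k := fun k =>
    (hasDerivAt_pi.1 hu.hasDerivAt k).deriv
  simp only [HydroOperator.applyGradient, h1, h2, Finset.sum_add_distrib, Finset.mul_sum,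
    mul_add, Finset.sum_mul]
  congr 1
  congr 1
  · rw [Finset.sum_comm]
    exact Finset.sum_congr rfl fun k _ => Finset.sum_congr rfl fun j _ => by ring
  · rw [Finset.sum_comm]
    exact Finset.sum_congr rfl fun k _ => Finset.sum_congr rfl fun j _ => by ring

/-- The Casimir condition as a pointwise system of partial differential equations. -/
theorem isCasimir_iff (hD : IsOpen D) (hF : ContDiffOn ℝ ∞ F D) :
    C.IsCasimir D F ↔ ∀ p ∈ D, (∀ i k, ∑ j, (C.g p i j * pd k (pd j F) p
      + C.b p k i j * pd j F p) = 0) ∧ ∀ i, ∑ j, C.om p i j * pd j F p = 0 := by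
  constructor
  · intro h p hp
    have key : ∀ (q : Fin n → ℝ) (i : Fin n), ∑ k, q k *
        (∑ j, (C.g p i j * pd k (pd j F) p + C.b p k i j * pd j F p))
        + ∑ j, C.om p i j * pd j F p = 0 := by
      intro q i
      -- The straight line through p with velocity q is an admissible field, so the affine
      -- expression in q vanishes for every q: q = 0 isolates the zero-order part and basis vectors
      -- then isolate each first-order coefficient.
      have hd : HasDerivAt (fun t : ℝ => p + t • q) q 0 := by
        simpa using ((hasDerivAt_id (0 : ℝ)).smul_const q).const_add p
      have h0 : p + (0 : ℝ) • q = p := by simp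
      have hmem : (fun t : ℝ => p + t • q) 0 ∈ D := by simpa using hp
      have := applyGradient_eq C hD hF hd.differentiableAt hmem i
      rw [h (fun t : ℝ => p + t • q) (contDiff_const.add (contDiff_id.smul contDiff_const)) 0 hmem i, hd.deriv] at this
      simpa only [h0] using this.symm
    have hom : ∀ i, ∑ j, C.om p i j * pd j F p = 0 := fun i => by simpa using key 0 i
    refine ⟨fun i k => ?_, hom⟩
    have := key (Pi.single k 1) i
    rw [hom i, Finset.sum_eq_single k (by intro b _ hb; simp [hb]) (by simp)] at this
    simpa using this
  · intro h u hu x hx i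
    rw [applyGradient_eq C hD hF (hu.contDiffAt.differentiableAt (by simp)) hx]
    simp [(h _ hx).1, (h _ hx).2]

theorem isCasimir_firstOrder_iff (hD : IsOpen D) (hF : ContDiffOn ℝ ∞ F D) :
    C.firstOrder.IsCasimir D F ↔ ∀ p ∈ D, ∀ i k, ∑ j, (C.g p i j * pd k (pd j F) p
      + C.b p k i j * pd j F p) = 0 := by
  rw [isCasimir_iff _ hD hF]
  simp [HydroOperator.firstOrder]

theorem isCasimir_zeroOrder_iff (hD : IsOpen D) (hF : ContDiffOn ℝ ∞ F D) :
    C.zeroOrder.IsCasimir D F ↔ ∀ p ∈ D, ∀ i, ∑ j, C.om p i j * pd j F p = 0 := by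
  rw [isCasimir_iff _ hD hF]
  simp [HydroOperator.zeroOrder]

/-- The two parts have different degree in the velocity and therefore cannot cancel each other. -/
theorem isCasimir_iff_firstOrder_and_zeroOrder (hD : IsOpen D) (hF : ContDiffOn ℝ ∞ F D) :
    C.IsCasimir D F ↔ C.firstOrder.IsCasimir D F ∧ C.zeroOrder.IsCasimir D F := by
  rw [isCasimir_iff _ hD hF, isCasimir_firstOrder_iff _ hD hF, isCasimir_zeroOrder_iff _ hD hF]
  exact ⟨fun h => ⟨fun p hp => (h p hp).1, fun p hp => (h p hp).2⟩,
    fun h p hp => ⟨h.1 p hp, h.2 p hp⟩⟩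

end Casimirs

end

noncomputable section

/-! ### Constant partial derivatives and linear summands. -/

section

variable {n : ℕ} {D : Set (Fin n → ℝ)} {F : (Fin n → ℝ) → ℝ} {p : Fin n → ℝ}

theorem pd_eq_zero_of_eq_const_on (hD : IsOpen D) {c : ℝ} (h : ∀ q ∈ D, F q = c) (hp : p ∈ D)
    (k : Fin n) : pd k F p = 0 := by
  rw [pd_congr_on hD h hp, pd_const]

theorem pd_pd_eq_zero_iff (hD : IsOpen D) (hc : IsPreconnected D) (hF : ContDiffOn ℝ ∞ F D)
    (j : Fin n) :
    (∀ p ∈ D, ∀ k, pd k (pd j F) p = 0) ↔ ∃ c, ∀ p ∈ D, pd j F p = c := by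
  constructor
  · exact exists_const_of_pd_eq_zero hD hc fun p hp =>
      differentiableAt_of_contDiffOn hD (contDiffOn_pd hD hF j) hp
  · rintro ⟨c, h⟩ p hp k
    exact pd_eq_zero_of_eq_const_on hD h hp k

/-- Functions `c u + G` with `∂G/∂u = 0`. -/
theorem exists_linear_add_iff {P : ((Fin n → ℝ) → ℝ) → Prop} {j : Fin n} (hD : IsOpen D)
    (hF : ContDiffOn ℝ ∞ F D)
    (hP : ∀ G, P G → ContDiffOn ℝ ∞ G D)
    (hP' : ∀ G, ContDiffOn ℝ ∞ G D → (P G ↔ ∀ p ∈ D, pd j G p = 0)) :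
    (∃ (c : ℝ) (G : (Fin n → ℝ) → ℝ), P G ∧ ∀ p ∈ D, F p = c * p j + G p) ↔
      ∃ c, ∀ p ∈ D, pd j F p = c := by
  have hlin : ∀ c : ℝ, ContDiff ℝ ∞ (fun q : Fin n → ℝ => c * q j) := fun c =>
    contDiff_const.mul (contDiff_apply ℝ ℝ j)
  have hd : ∀ (c : ℝ) p, DifferentiableAt ℝ (fun q : Fin n → ℝ => c * q j) p := fun c p =>
    (hlin c).contDiffAt.differentiableAt (by simp)
  constructor
  · rintro ⟨c, G, hG, h⟩
    refine ⟨c, fun p hp => ?_⟩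
    rw [pd_congr_on hD h hp, pd_add (hd c p) (differentiableAt_of_contDiffOn hD (hP G hG) hp),
      (hP' G (hP G hG)).1 hG p hp, pd_const_mul (differentiableAt_apply j p), pd_coord]
    simp
  · rintro ⟨c, h⟩
    have hs : ContDiffOn ℝ ∞ (fun q => F q - c * q j) D := hF.sub (hlin c).contDiffOn
    refine ⟨c, fun q => F q - c * q j, (hP' _ hs).2 fun p hp => ?_, fun p _ => by ring⟩
    rw [pd_sub (differentiableAt_of_contDiffOn hD hF hp) (hd c p), h p hp,
      pd_const_mul (differentiableAt_apply j p), pd_coord]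
    simp

end

/-! ### The two-component operators. -/

section TwoComponents

variable {D : Set (Fin 2 → ℝ)} {F : (Fin 2 → ℝ) → ℝ}

theorem exists_linear_add_local_function_iff (hD : IsOpen D) (hF : ContDiffOn ℝ ∞ F D) :
    (∃ (c₁ : ℝ) (G : (Fin 2 → ℝ) → ℝ), IsLocalFunctionOf D (fun p => p 1) G ∧
      ∀ p ∈ D, F p = c₁ * p 0 + G p) ↔ ∃ c, ∀ p ∈ D, pd 0 F p = c :=
  exists_linear_add_iff hD hF
    (fun _ hG => contDiffOn_of_isLocalFunctionOf hG (contDiff_apply ℝ ℝ 1))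
    (fun _ hG => by
      rw [isLocalFunctionOf_coord_iff hD hG]
      simp [Fin.forall_fin_succ])

theorem C21_zeroOrder_iff (hD : IsOpen D) (hc : IsPreconnected D) (hF : ContDiffOn ℝ ∞ F D)
    {f : ℝ → ℝ} (hf : ∀ p ∈ D, f (p 1) ≠ 0) :
    (C21 f).zeroOrder.IsCasimir D F ↔ IsConstantOn D F := by
  rw [isCasimir_zeroOrder_iff _ hD hF, isConstantOn_iff hD hc hF]
  refine forall₂_congr fun p hp => ?_
  simp [C21, Fin.forall_fin_succ, hf p hp, and_comm]

theorem C21_firstOrder_iff (hD : IsOpen D) (hc : IsPreconnected D) (hF : ContDiffOn ℝ ∞ F D)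
    (f : ℝ → ℝ) : (C21 f).firstOrder.IsCasimir D F ↔ ∃ c, ∀ p ∈ D, pd 0 F p = c := by
  rw [isCasimir_firstOrder_iff _ hD hF, ← pd_pd_eq_zero_iff hD hc hF]
  refine forall₂_congr fun p hp => ?_
  simp [C21, Fin.forall_fin_succ]

theorem C21_iff (hD : IsOpen D) (hc : IsPreconnected D) (hF : ContDiffOn ℝ ∞ F D)
    {f : ℝ → ℝ} (hf : ∀ p ∈ D, f (p 1) ≠ 0) : (C21 f).IsCasimir D F ↔ IsConstantOn D F := by
  rw [isCasimir_iff_firstOrder_and_zeroOrder _ hD hF, C21_zeroOrder_iff hD hc hF hf,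
    C21_firstOrder_iff hD hc hF, isConstantOn_iff hD hc hF]
  exact ⟨fun h => h.2, fun h => ⟨⟨0, fun p hp => h p hp 0⟩, h⟩⟩

theorem C22_zeroOrder_iff (hD : IsOpen D) (hc : IsPreconnected D) (hF : ContDiffOn ℝ ∞ F D)
    {f : ℝ → ℝ} (hu : ∀ p ∈ D, p 0 ≠ 0) (hf : ∀ p ∈ D, f (p 1) ≠ 0) :
    (C22 f).zeroOrder.IsCasimir D F ↔ IsConstantOn D F := by
  rw [isCasimir_zeroOrder_iff _ hD hF, isConstantOn_iff hD hc hF]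
  refine forall₂_congr fun p hp => ?_
  simp [C22, Fin.forall_fin_succ, hf p hp, hu p hp, and_comm]

theorem C22_firstOrder_iff (hD : IsOpen D) (hc : IsPreconnected D) (hF : ContDiffOn ℝ ∞ F D)
    (f : ℝ → ℝ) (hu : ∀ p ∈ D, p 0 ≠ 0) :
    (C22 f).firstOrder.IsCasimir D F ↔ IsConstantOn D F := by
  rw [isCasimir_firstOrder_iff _ hD hF, isConstantOn_iff hD hc hF]
  constructor
  · intro h
    simp +contextual [C22, Fin.forall_fin_succ, hu] at h
    -- The second row has no metric term and reads F_u v_x / u = 0. Once F_u vanishes identically,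
    -- the first row reduces to F_v v_x / u = 0.
    have h0 : ∀ p ∈ D, pd 0 F p = 0 := fun p hp => (h p hp).2
    intro p hp
    have h1 := (h p hp).1.2
    rw [pd_eq_zero_of_eq_const_on hD h0 hp] at h1
    simpa [Fin.forall_fin_succ, h0 p hp, hu p hp] using h1
  · intro h p hp
    have h0 := fun k => pd_eq_zero_of_eq_const_on hD (fun q hq => h q hq 0) hp k
    simp [C22, Fin.forall_fin_succ, h p hp, h0]

theorem C22_iff (hD : IsOpen D) (hc : IsPreconnected D) (hF : ContDiffOn ℝ ∞ F D)
    (f : ℝ → ℝ) (hu : ∀ p ∈ D, p 0 ≠ 0) : (C22 f).IsCasimir D F ↔ IsConstantOn D F := by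
  rw [isCasimir_iff_firstOrder_and_zeroOrder _ hD hF, C22_firstOrder_iff hD hc hF f hu,
    and_iff_left_iff_imp, isCasimir_zeroOrder_iff _ hD hF, isConstantOn_iff hD hc hF]
  intro h p hp i
  simp [h p hp]

end TwoComponents

/-! ### Three-component operators with metric of rank at most one. -/

section ThreeComponents

variable {D : Set (Fin 3 → ℝ)} {F : (Fin 3 → ℝ) → ℝ}

theorem isLinearPlusFunctionVW_iff (hD : IsOpen D) (hF : ContDiffOn ℝ ∞ F D) :
    IsLinearPlusFunctionVW D F ↔ ∃ c, ∀ p ∈ D, pd 0 F p = c :=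
  exists_linear_add_iff hD hF
    (fun _ hG => contDiffOn_of_isLocalFunctionOf hG
      ((contDiff_apply ℝ ℝ 1).prodMk (contDiff_apply ℝ ℝ 2)))
    (fun _ hG => isLocalFunctionOf_vw_iff hD hG)

theorem isLinearPlusFunctionW_iff (hD : IsOpen D) (hF : ContDiffOn ℝ ∞ F D) :
    IsLinearPlusFunctionW D F ↔
      (∃ c, ∀ p ∈ D, pd 0 F p = c) ∧ ∃ c, ∀ p ∈ D, pd 1 F p = c := by
  have hlin : ContDiff ℝ ∞ fun p : Fin 3 → ℝ => p 2 := contDiff_apply ℝ ℝ 2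
  constructor
  · rintro ⟨c₁, c₂, G, hG, h⟩
    have hGs := contDiffOn_of_isLocalFunctionOf hG hlin
    rw [isLocalFunctionOf_coord_iff hD hGs] at hG
    have key : ∀ p ∈ D, ∀ j, pd j F p
        = c₁ * (if j = 0 then 1 else 0) + c₂ * (if j = 1 then 1 else 0) + pd j G p := by
      intro p hp j
      have d0 : DifferentiableAt ℝ (fun p : Fin 3 → ℝ => c₁ * p 0) p := by fun_prop
      have d1 : DifferentiableAt ℝ (fun p : Fin 3 → ℝ => c₂ * p 1) p := by fun_prop
      rw [pd_congr_on hD h hp, pd_add (F := fun q => c₁ * q 0 + c₂ * q 1)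
        (by fun_prop) (differentiableAt_of_contDiffOn hD hGs hp),
        pd_add d0 d1, pd_const_mul (differentiableAt_apply 0 p),
        pd_const_mul (differentiableAt_apply 1 p), pd_coord, pd_coord]
    exact ⟨⟨c₁, fun p hp => by simp [key p hp, hG p hp 0]⟩,
      ⟨c₂, fun p hp => by simp [key p hp, hG p hp 1]⟩⟩
  · rintro ⟨⟨c₁, h₁⟩, c₂, h₂⟩
    have hs : ContDiffOn ℝ ∞ (fun q => F q - (c₁ * q 0 + c₂ * q 1)) D :=
      hF.sub (by fun_prop)
    refine ⟨c₁, c₂, fun q => F q - (c₁ * q 0 + c₂ * q 1),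
      (isLocalFunctionOf_coord_iff hD hs 2).2 fun p hp i hi => ?_, fun p _ => by ring⟩
    have d0 : DifferentiableAt ℝ (fun p : Fin 3 → ℝ => c₁ * p 0) p := by fun_prop
    have d1 : DifferentiableAt ℝ (fun p : Fin 3 → ℝ => c₂ * p 1) p := by fun_prop
    rw [pd_sub (differentiableAt_of_contDiffOn hD hF hp)
      (G := fun q => c₁ * q 0 + c₂ * q 1) (by fun_prop),
      pd_add d0 d1, pd_const_mul (differentiableAt_apply 0 p),
      pd_const_mul (differentiableAt_apply 1 p), pd_coord, pd_coord]
    fin_cases i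
    · simp [h₁ p hp]
    · simp [h₂ p hp]
    · exact absurd rfl hi

theorem isLocalFunctionOf_w_iff (hD : IsOpen D) (hF : ContDiffOn ℝ ∞ F D) :
    IsLocalFunctionOf D (fun p => p 2) F ↔ ∀ p ∈ D, pd 0 F p = 0 ∧ pd 1 F p = 0 := by
  rw [isLocalFunctionOf_coord_iff hD hF]
  simp [Fin.forall_fin_succ]

theorem isLocalFunctionOf_v_iff (hD : IsOpen D) (hF : ContDiffOn ℝ ∞ F D) :
    IsLocalFunctionOf D (fun p => p 1) F ↔ ∀ p ∈ D, pd 0 F p = 0 ∧ pd 2 F p = 0 := by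
  rw [isLocalFunctionOf_coord_iff hD hF]
  simp [Fin.forall_fin_succ]

theorem isLocalFunctionOf_u_iff (hD : IsOpen D) (hF : ContDiffOn ℝ ∞ F D) :
    IsLocalFunctionOf D (fun p => p 0) F ↔ ∀ p ∈ D, pd 1 F p = 0 ∧ pd 2 F p = 0 := by
  rw [isLocalFunctionOf_coord_iff hD hF]
  simp [Fin.forall_fin_succ]

theorem C31_zeroOrder_iff (hD : IsOpen D) (hF : ContDiffOn ℝ ∞ F D) {f : ℝ → ℝ → ℝ → ℝ}
    (hf : ∀ p ∈ D, f (p 0) (p 1) (p 2) ≠ 0) :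
    (C31 f).zeroOrder.IsCasimir D F ↔ IsLocalFunctionOf D (fun p => p 2) F := by
  rw [isCasimir_zeroOrder_iff _ hD hF, isLocalFunctionOf_w_iff hD hF]
  refine forall₂_congr fun p hp => ?_
  simp [C31, Fin.forall_fin_succ, Fin.sum_univ_three, hf p hp, and_comm]

/-- With zero metric no second derivatives occur: the rows are w_x F_v = 0 and w_x F_u = 0. -/
theorem C31_firstOrder_iff (hD : IsOpen D) (hF : ContDiffOn ℝ ∞ F D) (f : ℝ → ℝ → ℝ → ℝ) :
    (C31 f).firstOrder.IsCasimir D F ↔ IsLocalFunctionOf D (fun p => p 2) F := by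
  rw [isCasimir_firstOrder_iff _ hD hF, isLocalFunctionOf_w_iff hD hF]
  refine forall₂_congr fun p hp => ?_
  simp [C31, Fin.forall_fin_succ, Fin.sum_univ_three, and_comm]

theorem C31_iff (hD : IsOpen D) (hF : ContDiffOn ℝ ∞ F D) (f : ℝ → ℝ → ℝ → ℝ) :
    (C31 f).IsCasimir D F ↔ IsLocalFunctionOf D (fun p => p 2) F := by
  rw [isCasimir_iff_firstOrder_and_zeroOrder _ hD hF, C31_firstOrder_iff hD hF,
    and_iff_left_iff_imp, isCasimir_zeroOrder_iff _ hD hF, isLocalFunctionOf_w_iff hD hF]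
  intro h p hp
  simp [C31, Fin.forall_fin_succ, Fin.sum_univ_three, h p hp]

theorem C33_zeroOrder_iff (hD : IsOpen D) (hF : ContDiffOn ℝ ∞ F D) {f : ℝ → ℝ → ℝ}
    (hf : ∀ p ∈ D, f (p 1) (p 2) ≠ 0) :
    (C33 f).zeroOrder.IsCasimir D F ↔ IsLocalFunctionOf D (fun p => p 2) F := by
  rw [isCasimir_zeroOrder_iff _ hD hF, isLocalFunctionOf_w_iff hD hF]
  refine forall₂_congr fun p hp => ?_
  simp [C33, Fin.forall_fin_succ, Fin.sum_univ_three, hf p hp, and_comm]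

theorem C33_firstOrder_iff (hD : IsOpen D) (hF : ContDiffOn ℝ ∞ F D) (f : ℝ → ℝ → ℝ) :
    (C33 f).firstOrder.IsCasimir D F ↔ IsLocalFunctionOf D (fun p => p 2) F := by
  rw [isCasimir_firstOrder_iff _ hD hF, isLocalFunctionOf_w_iff hD hF]
  simp only [C33, Fin.forall_fin_succ, Fin.sum_univ_three]
  constructor
  · intro h
    simp at h
    -- The second row is -w_x F_u. Since F_u is then identically zero, its w-derivative drops out of
    -- the first row, leaving F_v = 0.
    have h0 : ∀ p ∈ D, pd 0 F p = 0 := fun p hp => (h p hp).2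
    intro p hp
    have h1 := (h p hp).1.2.2
    rw [pd_eq_zero_of_eq_const_on hD h0 hp, zero_add] at h1
    exact ⟨h0 p hp, h1⟩
  · intro h p hp
    have h0 := fun k => pd_eq_zero_of_eq_const_on hD (fun q hq => (h q hq).1) hp k
    simp [h p hp, h0]

theorem C33_iff (hD : IsOpen D) (hF : ContDiffOn ℝ ∞ F D) (f : ℝ → ℝ → ℝ) :
    (C33 f).IsCasimir D F ↔ IsLocalFunctionOf D (fun p => p 2) F := by
  rw [isCasimir_iff_firstOrder_and_zeroOrder _ hD hF, C33_firstOrder_iff hD hF,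
    and_iff_left_iff_imp, isCasimir_zeroOrder_iff _ hD hF, isLocalFunctionOf_w_iff hD hF]
  intro h p hp
  simp [C33, Fin.forall_fin_succ, Fin.sum_univ_three, h p hp]

theorem C34_zeroOrder_iff (hD : IsOpen D) (hF : ContDiffOn ℝ ∞ F D) {f : ℝ → ℝ → ℝ}
    (hu : ∀ p ∈ D, p 0 ≠ 0) (hf : ∀ p ∈ D, f (p 1) (p 2) ≠ 0) :
    (C34 f).zeroOrder.IsCasimir D F ↔ IsLocalFunctionOf D (fun p => p 1) F := by
  rw [isCasimir_zeroOrder_iff _ hD hF, isLocalFunctionOf_v_iff hD hF]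
  refine forall₂_congr fun p hp => ?_
  simp [C34, Fin.forall_fin_succ, Fin.sum_univ_three, hf p hp, hu p hp, and_comm]

theorem C34_firstOrder_iff (hD : IsOpen D) (hF : ContDiffOn ℝ ∞ F D) (f : ℝ → ℝ → ℝ)
    (hu : ∀ p ∈ D, p 0 ≠ 0) :
    (C34 f).firstOrder.IsCasimir D F ↔ IsLocalFunctionOf D (fun p => p 1) F := by
  rw [isCasimir_firstOrder_iff _ hD hF, isLocalFunctionOf_v_iff hD hF]
  simp only [C34, Fin.forall_fin_succ, Fin.sum_univ_three]
  constructor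
  · intro h
    simp +contextual [hu] at h
    -- Here the third row, w_x F_u / u, kills F_u, and the first row then kills F_w.
    have h0 : ∀ p ∈ D, pd 0 F p = 0 := fun p hp => (h p hp).2
    intro p hp
    have h1 := (h p hp).1.2.2
    rw [pd_eq_zero_of_eq_const_on hD h0 hp, zero_add] at h1
    simpa [h0 p hp, hu p hp] using h1
  · intro h p hp
    have h0 := fun k => pd_eq_zero_of_eq_const_on hD (fun q hq => (h q hq).1) hp k
    simp [h p hp, h0]

theorem C34_iff (hD : IsOpen D) (hF : ContDiffOn ℝ ∞ F D) (f : ℝ → ℝ → ℝ)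
    (hu : ∀ p ∈ D, p 0 ≠ 0) :
    (C34 f).IsCasimir D F ↔ IsLocalFunctionOf D (fun p => p 1) F := by
  rw [isCasimir_iff_firstOrder_and_zeroOrder _ hD hF, C34_firstOrder_iff hD hF f hu,
    and_iff_left_iff_imp, isCasimir_zeroOrder_iff _ hD hF, isLocalFunctionOf_v_iff hD hF]
  intro h p hp
  simp [C34, Fin.forall_fin_succ, Fin.sum_univ_three, h p hp]

theorem C32_zeroOrder_iff (hD : IsOpen D) (hF : ContDiffOn ℝ ∞ F D) (f g h : ℝ → ℝ → ℝ) :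
    (C32 f g h).zeroOrder.IsCasimir D F ↔ UltralocalSystem D f g h F := by
  rw [isCasimir_zeroOrder_iff _ hD hF]
  refine forall₂_congr fun p hp => ?_
  simp only [C32, Fin.forall_fin_succ, Fin.sum_univ_three]
  simp
  grind

theorem C32_firstOrder_iff (hD : IsOpen D) (hc : IsPreconnected D) (hF : ContDiffOn ℝ ∞ F D)
    (f g h : ℝ → ℝ → ℝ) :
    (C32 f g h).firstOrder.IsCasimir D F ↔ ∃ c, ∀ p ∈ D, pd 0 F p = c := by
  rw [isCasimir_firstOrder_iff _ hD hF, ← pd_pd_eq_zero_iff hD hc hF]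
  refine forall₂_congr fun p hp => ?_
  simp [C32, Fin.forall_fin_succ, Fin.sum_univ_three]

theorem C32_iff (hD : IsOpen D) (hc : IsPreconnected D) (hF : ContDiffOn ℝ ∞ F D)
    (f g h : ℝ → ℝ → ℝ) : (C32 f g h).IsCasimir D F ↔
      (∃ c, ∀ p ∈ D, pd 0 F p = c) ∧ UltralocalSystem D f g h F := by
  rw [isCasimir_iff_firstOrder_and_zeroOrder _ hD hF, C32_zeroOrder_iff hD hF,
    C32_firstOrder_iff hD hc hF]

/-- The zero-order matrix is that of `C32` times the nonvanishing factor 1/u, so the kernel is the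
same. -/
theorem C35_zeroOrder_iff (hD : IsOpen D) (hF : ContDiffOn ℝ ∞ F D) (f g h : ℝ → ℝ → ℝ)
    (hu : ∀ p ∈ D, p 0 ≠ 0) :
    (C35 f g h).zeroOrder.IsCasimir D F ↔ UltralocalSystem D f g h F := by
  rw [isCasimir_zeroOrder_iff _ hD hF]
  refine forall₂_congr fun p hp => ?_
  have := hu p hp
  simp only [C35, Fin.forall_fin_succ, Fin.sum_univ_three]
  simp
  grind

theorem C35_firstOrder_iff (hD : IsOpen D) (hc : IsPreconnected D) (hF : ContDiffOn ℝ ∞ F D)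
    (f g h : ℝ → ℝ → ℝ) (hu : ∀ p ∈ D, p 0 ≠ 0) :
    (C35 f g h).firstOrder.IsCasimir D F ↔ IsConstantOn D F := by
  rw [isCasimir_firstOrder_iff _ hD hF, isConstantOn_iff hD hc hF]
  simp only [C35, Fin.forall_fin_succ, Fin.sum_univ_three]
  constructor
  · intro h
    simp +contextual [hu] at h
    -- The second and third rows are multiples of F_u. With F_u identically zero, the v_x and w_x
    -- coefficients of the first row give F_v = 0 and F_w = 0 separately.
    have h0 : ∀ p ∈ D, pd 0 F p = 0 := fun p hp => (h p hp).2
    intro p hp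
    have h1 := (h p hp).1.2
    rw [pd_eq_zero_of_eq_const_on hD h0 hp, pd_eq_zero_of_eq_const_on hD h0 hp] at h1
    simpa [h0 p hp, hu p hp] using h1
  · intro h p hp
    have h0 := fun k => pd_eq_zero_of_eq_const_on hD (fun q hq => (h q hq).1) hp k
    have := h p hp
    simp at this
    simp [this, h0]

theorem C35_iff (hD : IsOpen D) (hc : IsPreconnected D) (hF : ContDiffOn ℝ ∞ F D)
    (f g h : ℝ → ℝ → ℝ) (hu : ∀ p ∈ D, p 0 ≠ 0) :
    (C35 f g h).IsCasimir D F ↔ IsConstantOn D F := by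
  rw [isCasimir_iff_firstOrder_and_zeroOrder _ hD hF, C35_firstOrder_iff hD hc hF f g h hu,
    and_iff_left_iff_imp, isCasimir_zeroOrder_iff _ hD hF, isConstantOn_iff hD hc hF]
  intro h p hp i
  simp [h p hp]

end ThreeComponents

end

/-! ### Primitives, and the kernel criterion for skew matrices. -/

noncomputable section

/-- Order-connectedness keeps the interval of integration inside the set where ℓ is continuous. -/
theorem hasDerivAt_primitive {ℓ : ℝ → ℝ} {J : Set ℝ} (hJ : IsOpen J) (hJ' : J.OrdConnected)
    (hℓ : ContinuousOn ℓ J) {a w : ℝ} (ha : a ∈ J) (hw : w ∈ J) :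
    HasDerivAt (fun w => ∫ s in a..w, ℓ s) (ℓ w) w :=
  intervalIntegral.integral_hasDerivAt_right
    ((hℓ.mono (hJ'.uIcc_subset ha hw)).intervalIntegrable)
    (hℓ.stronglyMeasurableAtFilter hJ w hw) (hℓ.continuousAt (hJ.mem_nhds hw))

theorem contDiffOn_primitive {ℓ : ℝ → ℝ} {J : Set ℝ} (hJ : IsOpen J) (hJ' : J.OrdConnected)
    (hℓ : ContDiffOn ℝ ∞ ℓ J) {a : ℝ} (ha : a ∈ J) :
    ContDiffOn ℝ ∞ (fun w => ∫ s in a..w, ℓ s) J := by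
  have h := fun w hw => hasDerivAt_primitive hJ hJ' hℓ.continuousOn ha (w := w) hw
  rw [contDiffOn_infty_iff_deriv_of_isOpen hJ]
  exact ⟨fun w hw => (h w hw).differentiableAt.differentiableWithinAt,
    hℓ.congr fun w hw => (h w hw).deriv⟩

theorem hasDerivAt_of_contDiffOn {f : ℝ → ℝ} {J : Set ℝ} (hJ : IsOpen J)
    (hf : ContDiffOn ℝ ∞ f J) {w : ℝ} (hw : w ∈ J) : HasDerivAt f (deriv f w) w :=
  ((hf.contDiffAt (hJ.mem_nhds hw)).differentiableAt (by simp)).hasDerivAt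

theorem contDiffOn_comp_coord {n : ℕ} {D : Set (Fin n → ℝ)} {J : Set ℝ} {a : ℝ → ℝ} {i : Fin n}
    (ha : ContDiffOn ℝ ∞ a J) (hJ : ∀ p ∈ D, p i ∈ J) :
    ContDiffOn ℝ ∞ (fun p => a (p i)) D :=
  ha.comp (contDiff_apply ℝ ℝ i).contDiffOn hJ

/-- The skew-symmetric matrix `sk(a, b, d)`. -/
def skewMatrix (a b d : ℝ) : Matrix (Fin 3) (Fin 3) ℝ := !![0, a, b; -a, 0, d; -b, -d, 0]

section

variable {D : Set (Fin 3 → ℝ)} {F θ : (Fin 3 → ℝ) → ℝ}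

/-- Linear algebra at each point: the kernel of a nonzero sk(a, b, d) is the line through (d, -b,
a), and the hypothesis identifies that line with the one through ∇θ. -/
theorem zeroOrder_isCasimir_iff_proportional (C : HydroOperator 3) (hD : IsOpen D)
    (hF : ContDiffOn ℝ ∞ F D)
    (hK : ∀ p ∈ D, ∃ m a b d, C.om p = skewMatrix a b d ∧ m ≠ 0 ∧ (a ≠ 0 ∨ b ≠ 0 ∨ d ≠ 0) ∧
      d = m * pd 0 θ p ∧ -b = m * pd 1 θ p ∧ a = m * pd 2 θ p) :
    C.zeroOrder.IsCasimir D F ↔ ∀ p ∈ D, ∃ l : ℝ, ∀ i, pd i F p = l * pd i θ p := by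
  rw [isCasimir_zeroOrder_iff _ hD hF]
  refine forall₂_congr fun p hp => ?_
  obtain ⟨m, a, b, d, hom, hm, hne, h0, h1, h2⟩ := hK p hp
  simp only [hom, skewMatrix, Fin.forall_fin_succ, Fin.sum_univ_three]
  simp
  generalize pd 0 F p = x at *
  generalize pd 1 F p = y at *
  generalize pd 2 F p = z at *
  have h0' : pd 0 θ p = d / m := by rw [h0]; field_simp
  have h1' : pd 1 θ p = -b / m := by rw [h1]; field_simp
  have h2' : pd 2 θ p = a / m := by rw [h2]; field_simp
  rw [h0', h1', h2']
  constructor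
  · rintro ⟨e0, e1, e2⟩
    -- Whichever entry is nonzero, the corresponding component of ∇F determines the multiplier l;
    -- the rows of the matrix then give the other two components.
    rcases hne with h | h | h
    · refine ⟨z * m / a, ?_, ?_, ?_⟩
      · field_simp; linarith
      · field_simp; linarith
      · field_simp
    · refine ⟨-y * m / b, ?_, ?_, ?_⟩
      · field_simp; linarith
      · field_simp
      · field_simp; linarith
    · refine ⟨x * m / d, ?_, ?_, ?_⟩
      · field_simp
      · field_simp; linarith
      · field_simp; linarith
  · rintro ⟨l, rfl, rfl, rfl⟩
    refine ⟨?_, ?_, ?_⟩ <;> ring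

theorem zeroOrder_isCasimir_iff_isLocalFunctionOf (C : HydroOperator 3) (hD : IsOpen D)
    (hF : ContDiffOn ℝ ∞ F D) (hθ : ContDiffOn ℝ ∞ θ D)
    (hK : ∀ p ∈ D, ∃ m a b d, C.om p = skewMatrix a b d ∧ m ≠ 0 ∧ (a ≠ 0 ∨ b ≠ 0 ∨ d ≠ 0) ∧
      d = m * pd 0 θ p ∧ -b = m * pd 1 θ p ∧ a = m * pd 2 θ p) :
    C.zeroOrder.IsCasimir D F ↔ IsLocalFunctionOf D θ F := by
  rw [zeroOrder_isCasimir_iff_proportional C hD hF hK, isLocalFunctionOf_iff hD hθ hF]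
  intro p hp
  obtain ⟨m, a, b, d, hom, hm, hne, h0, h1, h2⟩ := hK p hp
  -- A vanishing ∇θ would make all three entries a, b, d vanish.
  by_contra! hcon
  simp [hcon] at h0 h1 h2
  simp [h0, h1, h2] at hne

/-! ### The operator `C32` -/

theorem pd_sub_comp_v {ℓ : ℝ → ℝ} {a : ℝ} {p : Fin 3 → ℝ} (h : HasDerivAt ℓ a (p 1)) :
    pd 0 (fun p => p 0 - ℓ (p 1)) p = 1 ∧ pd 1 (fun p => p 0 - ℓ (p 1)) p = -a ∧
      pd 2 (fun p => p 0 - ℓ (p 1)) p = 0 := by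
  have hd : DifferentiableAt ℝ (fun p : Fin 3 → ℝ => ℓ (p 1)) p :=
    h.differentiableAt.comp p (differentiableAt_apply 1 p)
  refine ⟨?_, ?_, ?_⟩ <;> rw [pd_sub (differentiableAt_apply 0 p) hd, pd_coord, pd_comp_coord h] <;>
    simp

theorem pd_add_comp_w {ℓ : ℝ → ℝ} {a : ℝ} {p : Fin 3 → ℝ} (h : HasDerivAt ℓ a (p 2)) :
    pd 0 (fun p => p 0 + ℓ (p 2)) p = 1 ∧ pd 1 (fun p => p 0 + ℓ (p 2)) p = 0 ∧
      pd 2 (fun p => p 0 + ℓ (p 2)) p = a := by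
  have hd : DifferentiableAt ℝ (fun p : Fin 3 → ℝ => ℓ (p 2)) p :=
    h.differentiableAt.comp p (differentiableAt_apply 2 p)
  refine ⟨?_, ?_, ?_⟩ <;> rw [pd_add (differentiableAt_apply 0 p) hd, pd_coord, pd_comp_coord h] <;>
    simp

/-- If the zero-order Casimirs of `C32` are the functions of `θ = u + …`, then the Casimirs
are the affine functions of `θ`. -/
theorem C32_iff_isAffineFunctionOf (hD : IsOpen D) (hc : IsPreconnected D)
    (hF : ContDiffOn ℝ ∞ F D) (hθ : ContDiffOn ℝ ∞ θ D) (f g h : ℝ → ℝ → ℝ)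
    (hK : ∀ p ∈ D, ∃ m a b d, (C32 f g h).om p = skewMatrix a b d ∧ m ≠ 0 ∧
      (a ≠ 0 ∨ b ≠ 0 ∨ d ≠ 0) ∧ d = m * pd 0 θ p ∧ -b = m * pd 1 θ p ∧ a = m * pd 2 θ p)
    (h1 : ∀ p ∈ D, pd 0 θ p = 1) :
    (C32 f g h).IsCasimir D F ↔ IsAffineFunctionOf D θ F := by
  rw [isCasimir_iff_firstOrder_and_zeroOrder _ hD hF, C32_firstOrder_iff hD hc hF,
    zeroOrder_isCasimir_iff_proportional _ hD hF hK, isAffineFunctionOf_iff hD hc hF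
      fun p hp => differentiableAt_of_contDiffOn hD hθ hp]
  constructor
  · rintro ⟨⟨c, hc⟩, hl⟩
    refine ⟨c, fun p hp => ?_⟩
    obtain ⟨l, hl⟩ := hl p hp
    -- Because θ_u = 1, the pointwise multiplier is F_u itself, which the first-order part makes
    -- constant.
    have := hl 0
    rw [hc p hp, h1 p hp, mul_one] at this
    rwa [this]
  · rintro ⟨c, hcF⟩
    exact ⟨⟨c, fun p hp => by rw [hcF p hp, h1 p hp, mul_one]⟩, fun p hp => ⟨c, hcF p hp⟩⟩

theorem hasDerivAt_slice_left {I J : Set ℝ} {k : ℝ → ℝ → ℝ} (hI : IsOpen I) (hJ : IsOpen J)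
    (hk : ContDiffOn ℝ ∞ (Function.uncurry k) (I ×ˢ J)) {v w : ℝ} (hv : v ∈ I) (hw : w ∈ J) :
    HasDerivAt (fun s => k s w) (deriv (fun s => k s w) v) v := by
  have h := (hk.contDiffAt ((hI.prod hJ).mem_nhds
    (show (v, w) ∈ I ×ˢ J from ⟨hv, hw⟩))).differentiableAt (by simp)
  have h2 : DifferentiableAt ℝ (fun s : ℝ => (s, w)) v := by fun_prop
  exact (DifferentiableAt.comp (g := Function.uncurry k) (f := fun s : ℝ => (s, w)) v h h2).hasDerivAt

theorem hasDerivAt_slice_right {I J : Set ℝ} {k : ℝ → ℝ → ℝ} (hI : IsOpen I) (hJ : IsOpen J)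
    (hk : ContDiffOn ℝ ∞ (Function.uncurry k) (I ×ˢ J)) {v w : ℝ} (hv : v ∈ I) (hw : w ∈ J) :
    HasDerivAt (fun s => k v s) (deriv (fun s => k v s) w) w := by
  have h := (hk.contDiffAt ((hI.prod hJ).mem_nhds
    (show (v, w) ∈ I ×ˢ J from ⟨hv, hw⟩))).differentiableAt (by simp)
  have h2 : DifferentiableAt ℝ (fun s : ℝ => (v, s)) w := by fun_prop
  exact (DifferentiableAt.comp (g := Function.uncurry k) (f := fun s : ℝ => (v, s)) w h h2).hasDerivAt

theorem eq_of_hasDerivAt_zero {K : ℝ → ℝ} {J : Set ℝ} (hJ : IsOpen J) (hJ' : J.OrdConnected)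
    (h : ∀ w ∈ J, HasDerivAt K 0 w) {x y : ℝ} (hx : x ∈ J) (hy : y ∈ J) : K x = K y :=
  hJ.is_const_of_deriv_eq_zero hJ'.isPreconnected
    (fun w hw => (h w hw).differentiableAt.differentiableWithinAt)
    (fun w hw => (h w hw).deriv) hx hy

theorem contDiffOn_slice_left {I J : Set ℝ} {k : ℝ → ℝ → ℝ}
    (hk : ContDiffOn ℝ ∞ (Function.uncurry k) (I ×ˢ J)) {w : ℝ} (hw : w ∈ J) :
    ContDiffOn ℝ ∞ (fun v => k v w) I :=
  hk.comp (t := I ×ˢ J) (f := fun v : ℝ => (v, w)) (by fun_prop) fun _ hv => ⟨hv, hw⟩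

theorem contDiffOn_slice_right {I J : Set ℝ} {k : ℝ → ℝ → ℝ}
    (hk : ContDiffOn ℝ ∞ (Function.uncurry k) (I ×ˢ J)) {v : ℝ} (hv : v ∈ I) :
    ContDiffOn ℝ ∞ (fun w => k v w) J :=
  hk.comp (t := I ×ˢ J) (f := fun w : ℝ => (v, w)) (by fun_prop) fun _ hw => ⟨hv, hw⟩

/-- For f = 0 the closure relation becomes g h_w - h g_w = 0, that is, the w-derivative of g/h
vanishes; on the interval `J` the ratio equals its value at any base point. -/
theorem exists_ratio_function_of_v {I J : Set ℝ} {f g h : ℝ → ℝ → ℝ} (hI : IsOpen I)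
    (hJ : IsOpen J) (hJ' : J.OrdConnected)
    (hg : ContDiffOn ℝ ∞ (Function.uncurry g) (I ×ˢ J))
    (hh : ContDiffOn ℝ ∞ (Function.uncurry h) (I ×ˢ J)) (hcl : ClosureRelation I J f g h)
    (hf0 : ∀ v ∈ I, ∀ w ∈ J, f v w = 0) (hh0 : ∀ v ∈ I, ∀ w ∈ J, h v w ≠ 0) :
    ∃ ℓ : ℝ → ℝ, ContDiffOn ℝ ∞ ℓ I ∧ ∀ v ∈ I, ∀ w ∈ J, g v w / h v w = ℓ v := by
  -- Without a base point in `J` the claim about the ratio is vacuous, and any smooth ℓ serves.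
  rcases J.eq_empty_or_nonempty with rfl | ⟨w₀, hw₀⟩
  · exact ⟨fun _ => 0, contDiffOn_const, by simp⟩
  refine ⟨fun v => g v w₀ / h v w₀, (contDiffOn_slice_left hg hw₀).div
    (contDiffOn_slice_left hh hw₀) fun v hv => hh0 v hv w₀ hw₀, fun v hv w hw => ?_⟩
  refine eq_of_hasDerivAt_zero (K := fun w => g v w / h v w) hJ hJ' (fun w hw => ?_) hw hw₀
  have hd : deriv (fun s => f s w) v = 0 := by
    have he : (fun s => f s w) =ᶠ[𝓝 v] fun _ => 0 :=
      Filter.eventually_of_mem (hI.mem_nhds hv) fun s hs => hf0 s hs w hw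
    rw [he.deriv_eq, deriv_const]
  have hrel := hcl v hv w hw
  rw [hf0 v hv w hw, hd] at hrel
  refine ((hasDerivAt_slice_right hI hJ hg hv hw).fun_div (hasDerivAt_slice_right hI hJ hh hv hw)
    (hh0 v hv w hw)).congr_deriv ?_
  rw [div_eq_zero_iff]
  left
  linarith

/-- For g = 0 the closure relation is f h_v - h f_v = 0, the vanishing of the v-derivative of f/h.
-/
theorem exists_ratio_function_of_w {I J : Set ℝ} {f g h : ℝ → ℝ → ℝ} (hI : IsOpen I)
    (hI' : I.OrdConnected) (hJ : IsOpen J)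
    (hf : ContDiffOn ℝ ∞ (Function.uncurry f) (I ×ˢ J))
    (hh : ContDiffOn ℝ ∞ (Function.uncurry h) (I ×ˢ J)) (hcl : ClosureRelation I J f g h)
    (hg0 : ∀ v ∈ I, ∀ w ∈ J, g v w = 0) (hh0 : ∀ v ∈ I, ∀ w ∈ J, h v w ≠ 0) :
    ∃ ℓ : ℝ → ℝ, ContDiffOn ℝ ∞ ℓ J ∧ ∀ v ∈ I, ∀ w ∈ J, f v w / h v w = ℓ w := by
  rcases I.eq_empty_or_nonempty with rfl | ⟨v₀, hv₀⟩
  · exact ⟨fun _ => 0, contDiffOn_const, by simp⟩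
  refine ⟨fun w => f v₀ w / h v₀ w, (contDiffOn_slice_right hf hv₀).div
    (contDiffOn_slice_right hh hv₀) fun w hw => hh0 v₀ hv₀ w hw, fun v hv w hw => ?_⟩
  refine eq_of_hasDerivAt_zero (K := fun v => f v w / h v w) hI hI' (fun v hv => ?_) hv hv₀
  have hd : deriv (fun s => g v s) w = 0 := by
    have he : (fun s => g v s) =ᶠ[𝓝 w] fun _ => 0 :=
      Filter.eventually_of_mem (hJ.mem_nhds hw) fun s hs => hg0 v hv s hs
    rw [he.deriv_eq, deriv_const]
  have hrel := hcl v hv w hw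
  rw [hg0 v hv w hw, hd] at hrel
  refine ((hasDerivAt_slice_left hI hJ hf hv hw).fun_div (hasDerivAt_slice_left hI hJ hh hv hw)
    (hh0 v hv w hw)).congr_deriv ?_
  rw [div_eq_zero_iff]
  left
  linarith

theorem C32_om (f g h : ℝ → ℝ → ℝ) (p : Fin 3 → ℝ) : (C32 f g h).om p
    = skewMatrix (f (p 1) (p 2)) (g (p 1) (p 2)) (h (p 1) (p 2)) := rfl

/-- The kernel direction (h, -g, 0) is h times (1, -ℓ(v), 0), the gradient of u minus a primitive of
ℓ. -/
theorem C32_of_f_eq_zero {I J : Set ℝ} {f g h : ℝ → ℝ → ℝ} (hD : IsOpen D)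
    (hc : IsPreconnected D) (hF : ContDiffOn ℝ ∞ F D) (hI : IsOpen I) (hI' : I.OrdConnected)
    (hDI : ∀ p ∈ D, p 1 ∈ I ∧ p 2 ∈ J) {ℓ : ℝ → ℝ} (hℓ : ContDiffOn ℝ ∞ ℓ I)
    (hℓ' : ∀ v ∈ I, ∀ w ∈ J, g v w / h v w = ℓ v)
    (hf : ∀ v ∈ I, ∀ w ∈ J, f v w = 0) (hh : ∀ v ∈ I, ∀ w ∈ J, h v w ≠ 0)
    {v₀ : ℝ} (hv₀ : v₀ ∈ I) :
    ((C32 f g h).zeroOrder.IsCasimir D F ↔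
      IsLocalFunctionOf D (fun p => p 0 - ∫ s in v₀..(p 1), ℓ s) F) ∧
    ((C32 f g h).IsCasimir D F ↔
      IsAffineFunctionOf D (fun p => p 0 - ∫ s in v₀..(p 1), ℓ s) F) := by
  have hθ : ContDiffOn ℝ ∞ (fun p : Fin 3 → ℝ => p 0 - ∫ s in v₀..(p 1), ℓ s) D :=
    (contDiff_apply ℝ ℝ 0).contDiffOn.sub (contDiffOn_comp_coord
      (contDiffOn_primitive hI hI' hℓ hv₀) fun p hp => (hDI p hp).1)
  have hpd := fun p hp => pd_sub_comp_v (p := p)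
    (hasDerivAt_primitive hI hI' hℓ.continuousOn hv₀ (hDI p hp).1)
  have hK : ∀ p ∈ D, ∃ m a b d, (C32 f g h).om p = skewMatrix a b d ∧ m ≠ 0 ∧
      (a ≠ 0 ∨ b ≠ 0 ∨ d ≠ 0) ∧ d = m * pd 0 (fun p => p 0 - ∫ s in v₀..(p 1), ℓ s) p ∧
      -b = m * pd 1 (fun p => p 0 - ∫ s in v₀..(p 1), ℓ s) p ∧
      a = m * pd 2 (fun p => p 0 - ∫ s in v₀..(p 1), ℓ s) p := by
    intro p hp
    obtain ⟨hv, hw⟩ := hDI p hp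
    obtain ⟨h0, h1, h2⟩ := hpd p hp
    have hh' := hh _ hv _ hw
    refine ⟨_, _, _, _, C32_om f g h p, hh', Or.inr (Or.inr hh'), ?_, ?_, ?_⟩
    · rw [h0, mul_one]
    · rw [h1, ← hℓ' _ hv _ hw]; field_simp
    · rw [h2, hf _ hv _ hw, mul_zero]
  exact ⟨zeroOrder_isCasimir_iff_isLocalFunctionOf _ hD hF hθ hK,
    C32_iff_isAffineFunctionOf hD hc hF hθ f g h hK fun p hp => (hpd p hp).1⟩

/-- The kernel direction (h, 0, f) is h times (1, 0, ℓ(w)), the gradient of u plus a primitive of ℓ.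
-/
theorem C32_of_g_eq_zero {I J : Set ℝ} {f g h : ℝ → ℝ → ℝ} (hD : IsOpen D)
    (hc : IsPreconnected D) (hF : ContDiffOn ℝ ∞ F D) (hJ : IsOpen J) (hJ' : J.OrdConnected)
    (hDI : ∀ p ∈ D, p 1 ∈ I ∧ p 2 ∈ J) {ℓ : ℝ → ℝ} (hℓ : ContDiffOn ℝ ∞ ℓ J)
    (hℓ' : ∀ v ∈ I, ∀ w ∈ J, f v w / h v w = ℓ w)
    (hg : ∀ v ∈ I, ∀ w ∈ J, g v w = 0) (hh : ∀ v ∈ I, ∀ w ∈ J, h v w ≠ 0)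
    {w₀ : ℝ} (hw₀ : w₀ ∈ J) :
    ((C32 f g h).zeroOrder.IsCasimir D F ↔
      IsLocalFunctionOf D (fun p => p 0 + ∫ s in w₀..(p 2), ℓ s) F) ∧
    ((C32 f g h).IsCasimir D F ↔
      IsAffineFunctionOf D (fun p => p 0 + ∫ s in w₀..(p 2), ℓ s) F) := by
  have hθ : ContDiffOn ℝ ∞ (fun p : Fin 3 → ℝ => p 0 + ∫ s in w₀..(p 2), ℓ s) D :=
    (contDiff_apply ℝ ℝ 0).contDiffOn.add (contDiffOn_comp_coord
      (contDiffOn_primitive hJ hJ' hℓ hw₀) fun p hp => (hDI p hp).2)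
  have hpd := fun p hp => pd_add_comp_w (p := p)
    (hasDerivAt_primitive hJ hJ' hℓ.continuousOn hw₀ (hDI p hp).2)
  have hK : ∀ p ∈ D, ∃ m a b d, (C32 f g h).om p = skewMatrix a b d ∧ m ≠ 0 ∧
      (a ≠ 0 ∨ b ≠ 0 ∨ d ≠ 0) ∧ d = m * pd 0 (fun p => p 0 + ∫ s in w₀..(p 2), ℓ s) p ∧
      -b = m * pd 1 (fun p => p 0 + ∫ s in w₀..(p 2), ℓ s) p ∧
      a = m * pd 2 (fun p => p 0 + ∫ s in w₀..(p 2), ℓ s) p := by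
    intro p hp
    obtain ⟨hv, hw⟩ := hDI p hp
    obtain ⟨h0, h1, h2⟩ := hpd p hp
    have hh' := hh _ hv _ hw
    refine ⟨_, _, _, _, C32_om f g h p, hh', Or.inr (Or.inr hh'), ?_, ?_, ?_⟩
    · rw [h0, mul_one]
    · rw [h1, hg _ hv _ hw, mul_zero, neg_zero]
    · rw [h2, ← hℓ' _ hv _ hw]; field_simp
  exact ⟨zeroOrder_isCasimir_iff_isLocalFunctionOf _ hD hF hθ hK,
    C32_iff_isAffineFunctionOf hD hc hF hθ f g h hK fun p hp => (hpd p hp).1⟩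

theorem C32_of_f_g_eq_zero {f g h : ℝ → ℝ → ℝ} (hD : IsOpen D)
    (hc : IsPreconnected D) (hF : ContDiffOn ℝ ∞ F D)
    (hfgh : ∀ p ∈ D, f (p 1) (p 2) = 0 ∧ g (p 1) (p 2) = 0 ∧ h (p 1) (p 2) ≠ 0) :
    ((C32 f g h).zeroOrder.IsCasimir D F ↔ IsLocalFunctionOf D (fun p => p 0) F) ∧
    ((C32 f g h).IsCasimir D F ↔ IsAffineFunctionOf D (fun p => p 0) F) := by
  have hθ : ContDiffOn ℝ ∞ (fun p : Fin 3 → ℝ => p 0) D := (contDiff_apply ℝ ℝ 0).contDiffOn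
  have hK : ∀ p ∈ D, ∃ m a b d, (C32 f g h).om p = skewMatrix a b d ∧ m ≠ 0 ∧
      (a ≠ 0 ∨ b ≠ 0 ∨ d ≠ 0) ∧ d = m * pd 0 (fun p => p 0) p ∧
      -b = m * pd 1 (fun p => p 0) p ∧ a = m * pd 2 (fun p => p 0) p := by
    intro p hp
    obtain ⟨hf, hg, hh⟩ := hfgh p hp
    refine ⟨_, _, _, _, C32_om f g h p, hh, Or.inr (Or.inr hh), ?_, ?_, ?_⟩
    · simp [pd_coord]
    · simp [pd_coord, hg]
    · simp [pd_coord, hf]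
  exact ⟨zeroOrder_isCasimir_iff_isLocalFunctionOf _ hD hF hθ hK,
    C32_iff_isAffineFunctionOf hD hc hF hθ f g h hK fun p hp => by simp [pd_coord]⟩

theorem C32_of_f_h_eq_zero {f g h : ℝ → ℝ → ℝ} (hD : IsOpen D)
    (hc : IsPreconnected D) (hF : ContDiffOn ℝ ∞ F D)
    (hfgh : ∀ p ∈ D, f (p 1) (p 2) = 0 ∧ g (p 1) (p 2) ≠ 0 ∧ h (p 1) (p 2) = 0) :
    ((C32 f g h).zeroOrder.IsCasimir D F ↔ IsLocalFunctionOf D (fun p => p 1) F) ∧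
    ((C32 f g h).IsCasimir D F ↔ IsLocalFunctionOf D (fun p => p 1) F) := by
  have hS : UltralocalSystem D f g h F ↔ ∀ p ∈ D, pd 0 F p = 0 ∧ pd 2 F p = 0 := by
    refine forall₂_congr fun p hp => ?_
    simp [hfgh p hp, and_comm]
  rw [C32_iff hD hc hF, C32_zeroOrder_iff hD hF, isLocalFunctionOf_v_iff hD hF, hS]
  exact ⟨Iff.rfl, ⟨fun h => h.2, fun h => ⟨⟨0, fun p hp => (h p hp).1⟩, h⟩⟩⟩

theorem C32_of_g_h_eq_zero {f g h : ℝ → ℝ → ℝ} (hD : IsOpen D)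
    (hc : IsPreconnected D) (hF : ContDiffOn ℝ ∞ F D)
    (hfgh : ∀ p ∈ D, f (p 1) (p 2) ≠ 0 ∧ g (p 1) (p 2) = 0 ∧ h (p 1) (p 2) = 0) :
    ((C32 f g h).zeroOrder.IsCasimir D F ↔ IsLocalFunctionOf D (fun p => p 2) F) ∧
    ((C32 f g h).IsCasimir D F ↔ IsLocalFunctionOf D (fun p => p 2) F) := by
  have hS : UltralocalSystem D f g h F ↔ ∀ p ∈ D, pd 0 F p = 0 ∧ pd 1 F p = 0 := by
    refine forall₂_congr fun p hp => ?_
    simp [hfgh p hp, and_comm]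
  rw [C32_iff hD hc hF, C32_zeroOrder_iff hD hF, isLocalFunctionOf_w_iff hD hF, hS]
  exact ⟨Iff.rfl, ⟨fun h => h.2, fun h => ⟨⟨0, fun p hp => (h p hp).1⟩, h⟩⟩⟩

/-- The second equation of the system becomes f F_u = 0. So F_u = 0, which makes the third equation
trivial and already satisfies the first-order condition, with constant 0. -/
theorem C32_of_h_eq_zero {f g h : ℝ → ℝ → ℝ} (hD : IsOpen D)
    (hc : IsPreconnected D) (hF : ContDiffOn ℝ ∞ F D)
    (hfh : ∀ p ∈ D, f (p 1) (p 2) ≠ 0 ∧ h (p 1) (p 2) = 0) :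
    ((C32 f g h).zeroOrder.IsCasimir D F ↔ IsLocalFunctionOf D (fun p => (p 1, p 2)) F ∧
      ∀ p ∈ D, f (p 1) (p 2) * pd 1 F p + g (p 1) (p 2) * pd 2 F p = 0) ∧
    ((C32 f g h).IsCasimir D F ↔ IsLocalFunctionOf D (fun p => (p 1, p 2)) F ∧
      ∀ p ∈ D, f (p 1) (p 2) * pd 1 F p + g (p 1) (p 2) * pd 2 F p = 0) := by
  have hS : UltralocalSystem D f g h F ↔ (∀ p ∈ D, pd 0 F p = 0) ∧
      ∀ p ∈ D, f (p 1) (p 2) * pd 1 F p + g (p 1) (p 2) * pd 2 F p = 0 := by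
    rw [← forall₂_and]
    refine forall₂_congr fun p hp => ?_
    simp +contextual [hfh p hp, and_comm]
  rw [C32_iff hD hc hF, C32_zeroOrder_iff hD hF, isLocalFunctionOf_vw_iff hD hF, hS]
  exact ⟨Iff.rfl, ⟨fun h => h.2, fun h => ⟨⟨0, h.1⟩, h⟩⟩⟩

theorem pd_zero_of_hasDerivAt {Θ : ℝ → ℝ → ℝ → ℝ} {a : ℝ} {p : Fin 3 → ℝ}
    (hd : DifferentiableAt ℝ (fun q : Fin 3 → ℝ => Θ (q 0) (q 1) (q 2)) p)
    (h : HasDerivAt (fun t => Θ t (p 1) (p 2)) a (p 0)) :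
    pd 0 (fun q => Θ (q 0) (q 1) (q 2)) p = a :=
  pd_eq_of_hasDerivAt hd (by simpa using h)

theorem pd_one_of_hasDerivAt {Θ : ℝ → ℝ → ℝ → ℝ} {a : ℝ} {p : Fin 3 → ℝ}
    (hd : DifferentiableAt ℝ (fun q : Fin 3 → ℝ => Θ (q 0) (q 1) (q 2)) p)
    (h : HasDerivAt (fun t => Θ (p 0) t (p 2)) a (p 1)) :
    pd 1 (fun q => Θ (q 0) (q 1) (q 2)) p = a :=
  pd_eq_of_hasDerivAt hd (by simpa using h)

theorem pd_two_of_hasDerivAt {Θ : ℝ → ℝ → ℝ → ℝ} {a : ℝ} {p : Fin 3 → ℝ}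
    (hd : DifferentiableAt ℝ (fun q : Fin 3 → ℝ => Θ (q 0) (q 1) (q 2)) p)
    (h : HasDerivAt (fun t => Θ (p 0) (p 1) t) a (p 2)) :
    pd 2 (fun q => Θ (q 0) (q 1) (q 2)) p = a :=
  pd_eq_of_hasDerivAt hd (by simpa using h)

/-! ### The operators `C36`, `C39`, `C37` -/

theorem pd_add_mul_add {a : ℝ → ℝ} {a' x y : ℝ} {p : Fin 3 → ℝ} (h : HasDerivAt a a' (p 2)) :
    pd 0 (fun p => x * p 0 + y * p 1 + a (p 2)) p = x ∧
    pd 1 (fun p => x * p 0 + y * p 1 + a (p 2)) p = y ∧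
      pd 2 (fun p => x * p 0 + y * p 1 + a (p 2)) p = a' := by
  have hd : DifferentiableAt ℝ (fun p : Fin 3 → ℝ => a (p 2)) p :=
    h.differentiableAt.comp p (differentiableAt_apply 2 p)
  refine ⟨?_, ?_, ?_⟩ <;>
    rw [pd_add (F := fun p => x * p 0 + y * p 1) (by fun_prop) hd,
      pd_add (F := fun p => x * p 0) (by fun_prop) (by fun_prop),
      pd_const_mul (differentiableAt_apply 0 p), pd_const_mul (differentiableAt_apply 1 p),
      pd_coord, pd_coord, pd_comp_coord h] <;> simp

theorem C36_firstOrder_iff (hD : IsOpen D) (hc : IsPreconnected D) (hF : ContDiffOn ℝ ∞ F D)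
    (f g : ℝ → ℝ) (c : ℝ) : (C36 f g c).firstOrder.IsCasimir D F ↔
      (∃ c, ∀ p ∈ D, pd 0 F p = c) ∧ ∃ c, ∀ p ∈ D, pd 1 F p = c := by
  rw [isCasimir_firstOrder_iff _ hD hF, ← pd_pd_eq_zero_iff hD hc hF,
    ← pd_pd_eq_zero_iff hD hc hF, ← forall₂_and]
  refine forall₂_congr fun p hp => ?_
  simp [C36, Fin.forall_fin_succ, Fin.sum_univ_three]

theorem C39_firstOrder_iff (hD : IsOpen D) (hc : IsPreconnected D) (hF : ContDiffOn ℝ ∞ F D)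
    (f g : ℝ → ℝ) (c : ℝ) : (C39 f g c).firstOrder.IsCasimir D F ↔
      (∃ c, ∀ p ∈ D, pd 0 F p = c) ∧ ∃ c, ∀ p ∈ D, pd 1 F p = c := by
  rw [isCasimir_firstOrder_iff _ hD hF, ← pd_pd_eq_zero_iff hD hc hF,
    ← pd_pd_eq_zero_iff hD hc hF, ← forall₂_and]
  refine forall₂_congr fun p hp => ?_
  simp [C39, Fin.forall_fin_succ, Fin.sum_univ_three]
  tauto

/-- If `C` has the same first-order Casimirs as `C36` and its zero-order Casimirs are the
functions of `θ = x u + y v + a(w)`, then its Casimirs are the affine functions of `θ`. -/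
theorem isCasimir_iff_isAffineFunctionOf_of_linear (C : HydroOperator 3) (hD : IsOpen D)
    (hc : IsPreconnected D) (hF : ContDiffOn ℝ ∞ F D) (hθ : ContDiffOn ℝ ∞ θ D)
    (hfirst : C.firstOrder.IsCasimir D F ↔
      (∃ c, ∀ p ∈ D, pd 0 F p = c) ∧ ∃ c, ∀ p ∈ D, pd 1 F p = c)
    (hzero : C.zeroOrder.IsCasimir D F ↔ ∀ p ∈ D, ∃ l : ℝ, ∀ i, pd i F p = l * pd i θ p)
    {x y : ℝ} (hxy : x ≠ 0 ∨ y ≠ 0) (h0 : ∀ p ∈ D, pd 0 θ p = x) (h1 : ∀ p ∈ D, pd 1 θ p = y) :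
    C.IsCasimir D F ↔ IsAffineFunctionOf D θ F := by
  rw [isCasimir_iff_firstOrder_and_zeroOrder _ hD hF, hfirst, hzero,
    isAffineFunctionOf_iff hD hc hF fun p hp => differentiableAt_of_contDiffOn hD hθ hp]
  constructor
  · rintro ⟨⟨⟨c₁, hc₁⟩, c₂, hc₂⟩, hl⟩
    -- A nonzero component of the constant covector (x, y) expresses the multiplier through the
    -- constant value of F_u or of F_v.
    rcases hxy with hx | hy
    · refine ⟨c₁ / x, fun p hp => ?_⟩
      obtain ⟨l, hl⟩ := hl p hp
      have := hl 0
      rw [hc₁ p hp, h0 p hp] at this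
      rwa [this, mul_div_cancel_right₀ l hx]
    · refine ⟨c₂ / y, fun p hp => ?_⟩
      obtain ⟨l, hl⟩ := hl p hp
      have := hl 1
      rw [hc₂ p hp, h1 p hp] at this
      rwa [this, mul_div_cancel_right₀ l hy]
  · rintro ⟨c, hcF⟩
    exact ⟨⟨⟨c * x, fun p hp => by rw [hcF p hp, h0 p hp]⟩,
      ⟨c * y, fun p hp => by rw [hcF p hp, h1 p hp]⟩⟩, fun p hp => ⟨c, hcF p hp⟩⟩

theorem C36_of_g_eq_zero {f g : ℝ → ℝ} (c : ℝ) (hD : IsOpen D) (hc : IsPreconnected D)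
    (hF : ContDiffOn ℝ ∞ F D) (hfg : ∀ p ∈ D, g (p 2) = 0 ∧ f (p 2) ≠ 0) :
    ((C36 f g c).zeroOrder.IsCasimir D F ↔ IsLocalFunctionOf D (fun p => p 2) F) ∧
    ((C36 f g c).IsCasimir D F ↔ IsLocalFunctionOf D (fun p => p 2) F) := by
  have hz : (C36 f g c).zeroOrder.IsCasimir D F ↔ ∀ p ∈ D, pd 0 F p = 0 ∧ pd 1 F p = 0 := by
    rw [isCasimir_zeroOrder_iff _ hD hF]
    refine forall₂_congr fun p hp => ?_
    simp [C36, Fin.forall_fin_succ, Fin.sum_univ_three, hfg p hp, and_comm]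
  rw [isCasimir_iff_firstOrder_and_zeroOrder (C36 f g c) hD hF, hz, C36_firstOrder_iff hD hc hF,
    isLocalFunctionOf_w_iff hD hF]
  exact ⟨Iff.rfl, ⟨fun h => h.2,
    fun h => ⟨⟨⟨0, fun p hp => (h p hp).1⟩, ⟨0, fun p hp => (h p hp).2⟩⟩, h⟩⟩⟩

theorem C39_of_g_eq_zero {f g : ℝ → ℝ} (c : ℝ) (hD : IsOpen D) (hc : IsPreconnected D)
    (hF : ContDiffOn ℝ ∞ F D) (hfg : ∀ p ∈ D, g (p 2) = 0 ∧ f (p 2) ≠ 0) :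
    ((C39 f g c).zeroOrder.IsCasimir D F ↔ IsLocalFunctionOf D (fun p => p 2) F) ∧
    ((C39 f g c).IsCasimir D F ↔ IsLocalFunctionOf D (fun p => p 2) F) := by
  have hz : (C39 f g c).zeroOrder.IsCasimir D F ↔ ∀ p ∈ D, pd 0 F p = 0 ∧ pd 1 F p = 0 := by
    rw [isCasimir_zeroOrder_iff _ hD hF]
    refine forall₂_congr fun p hp => ?_
    simp [C39, Fin.forall_fin_succ, Fin.sum_univ_three, hfg p hp, and_comm]
  rw [isCasimir_iff_firstOrder_and_zeroOrder (C39 f g c) hD hF, hz, C39_firstOrder_iff hD hc hF,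
    isLocalFunctionOf_w_iff hD hF]
  exact ⟨Iff.rfl, ⟨fun h => h.2,
    fun h => ⟨⟨⟨0, fun p hp => (h p hp).1⟩, ⟨0, fun p hp => (h p hp).2⟩⟩, h⟩⟩⟩

theorem contDiffOn_linear_add_comp_w {J : Set ℝ} {a : ℝ → ℝ} (ha : ContDiffOn ℝ ∞ a J)
    (hJ : ∀ p ∈ D, p 2 ∈ J) (x y : ℝ) :
    ContDiffOn ℝ ∞ (fun p : Fin 3 → ℝ => x * p 0 + y * p 1 + a (p 2)) D :=
  ContDiffOn.add (by fun_prop) (contDiffOn_comp_coord ha hJ)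

/-- The kernel direction (cg, -g, f) is -g times (-c, 1, -f/g), the gradient of the stated
invariant. -/
theorem C36_of_g_ne_zero {J : Set ℝ} {f g : ℝ → ℝ} (c : ℝ) (hD : IsOpen D)
    (hc : IsPreconnected D) (hF : ContDiffOn ℝ ∞ F D) (hJ : IsOpen J) (hJ' : J.OrdConnected)
    (hDJ : ∀ p ∈ D, p 2 ∈ J) (hf : ContDiffOn ℝ ∞ f J) (hg : ContDiffOn ℝ ∞ g J)
    (hg0 : ∀ w ∈ J, g w ≠ 0) {w₀ : ℝ} (hw₀ : w₀ ∈ J) :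
    ((C36 f g c).zeroOrder.IsCasimir D F ↔
      IsLocalFunctionOf D (fun p => p 1 - (∫ s in w₀..(p 2), f s / g s) - c * p 0) F) ∧
    ((C36 f g c).IsCasimir D F ↔
      IsAffineFunctionOf D (fun p => p 1 - (∫ s in w₀..(p 2), f s / g s) - c * p 0) F) := by
  have hfg : ContDiffOn ℝ ∞ (fun s => f s / g s) J := hf.div hg hg0
  rw [show (fun p : Fin 3 → ℝ => p 1 - (∫ s in w₀..(p 2), f s / g s) - c * p 0)
    = fun p => (-c) * p 0 + 1 * p 1 + (-∫ s in w₀..(p 2), f s / g s) by ext p; ring]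
  have hθ := contDiffOn_linear_add_comp_w (contDiffOn_primitive hJ hJ' hfg hw₀).neg hDJ (-c) 1
  have hpd := fun p hp => pd_add_mul_add (p := p) (x := -c) (y := 1)
    (hasDerivAt_primitive hJ hJ' hfg.continuousOn hw₀ (hDJ p hp)).fun_neg
  have hK : ∀ p ∈ D, ∃ m a b d, (C36 f g c).om p = skewMatrix a b d ∧ m ≠ 0 ∧
      (a ≠ 0 ∨ b ≠ 0 ∨ d ≠ 0) ∧
      d = m * pd 0 (fun p => (-c) * p 0 + 1 * p 1 + (-∫ s in w₀..(p 2), f s / g s)) p ∧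
      -b = m * pd 1 (fun p => (-c) * p 0 + 1 * p 1 + (-∫ s in w₀..(p 2), f s / g s)) p ∧
      a = m * pd 2 (fun p => (-c) * p 0 + 1 * p 1 + (-∫ s in w₀..(p 2), f s / g s)) p := by
    intro p hp
    obtain ⟨h0, h1, h2⟩ := hpd p hp
    have hg' := hg0 _ (hDJ p hp)
    refine ⟨-g (p 2), f (p 2), g (p 2), c * g (p 2), rfl, neg_ne_zero.2 hg',
      Or.inr (Or.inl hg'), by rw [h0]; ring, by rw [h1]; ring, by rw [h2]; field_simp⟩
  exact ⟨zeroOrder_isCasimir_iff_isLocalFunctionOf _ hD hF hθ hK,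
    isCasimir_iff_isAffineFunctionOf_of_linear _ hD hc hF hθ (C36_firstOrder_iff hD hc hF f g c)
      (zeroOrder_isCasimir_iff_proportional _ hD hF hK) (Or.inr one_ne_zero)
      (fun p hp => (hpd p hp).1) (fun p hp => (hpd p hp).2.1)⟩

/-- The kernel direction (g, -cg, f) is -g times (-1, c, -f/g). -/
theorem C39_of_g_ne_zero {J : Set ℝ} {f g : ℝ → ℝ} (c : ℝ) (hD : IsOpen D)
    (hc : IsPreconnected D) (hF : ContDiffOn ℝ ∞ F D) (hJ : IsOpen J) (hJ' : J.OrdConnected)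
    (hDJ : ∀ p ∈ D, p 2 ∈ J) (hf : ContDiffOn ℝ ∞ f J) (hg : ContDiffOn ℝ ∞ g J)
    (hg0 : ∀ w ∈ J, g w ≠ 0) {w₀ : ℝ} (hw₀ : w₀ ∈ J) :
    ((C39 f g c).zeroOrder.IsCasimir D F ↔
      IsLocalFunctionOf D (fun p => c * p 1 - (∫ s in w₀..(p 2), f s / g s) - p 0) F) ∧
    ((C39 f g c).IsCasimir D F ↔
      IsAffineFunctionOf D (fun p => c * p 1 - (∫ s in w₀..(p 2), f s / g s) - p 0) F) := by
  have hfg : ContDiffOn ℝ ∞ (fun s => f s / g s) J := hf.div hg hg0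
  rw [show (fun p : Fin 3 → ℝ => c * p 1 - (∫ s in w₀..(p 2), f s / g s) - p 0)
    = fun p => (-1) * p 0 + c * p 1 + (-∫ s in w₀..(p 2), f s / g s) by ext p; ring]
  have hθ := contDiffOn_linear_add_comp_w (contDiffOn_primitive hJ hJ' hfg hw₀).neg hDJ (-1) c
  have hpd := fun p hp => pd_add_mul_add (p := p) (x := -1) (y := c)
    (hasDerivAt_primitive hJ hJ' hfg.continuousOn hw₀ (hDJ p hp)).fun_neg
  have hK : ∀ p ∈ D, ∃ m a b d, (C39 f g c).om p = skewMatrix a b d ∧ m ≠ 0 ∧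
      (a ≠ 0 ∨ b ≠ 0 ∨ d ≠ 0) ∧
      d = m * pd 0 (fun p => (-1) * p 0 + c * p 1 + (-∫ s in w₀..(p 2), f s / g s)) p ∧
      -b = m * pd 1 (fun p => (-1) * p 0 + c * p 1 + (-∫ s in w₀..(p 2), f s / g s)) p ∧
      a = m * pd 2 (fun p => (-1) * p 0 + c * p 1 + (-∫ s in w₀..(p 2), f s / g s)) p := by
    intro p hp
    obtain ⟨h0, h1, h2⟩ := hpd p hp
    have hg' := hg0 _ (hDJ p hp)
    refine ⟨-g (p 2), f (p 2), c * g (p 2), g (p 2), rfl, neg_ne_zero.2 hg',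
      Or.inr (Or.inr hg'), by rw [h0]; ring, by rw [h1]; ring, by rw [h2]; field_simp⟩
  exact ⟨zeroOrder_isCasimir_iff_isLocalFunctionOf _ hD hF hθ hK,
    isCasimir_iff_isAffineFunctionOf_of_linear _ hD hc hF hθ (C39_firstOrder_iff hD hc hF f g c)
      (zeroOrder_isCasimir_iff_proportional _ hD hF hK) (Or.inl (by norm_num))
      (fun p hp => (hpd p hp).1) (fun p hp => (hpd p hp).2.1)⟩

theorem isAffineFunctionOf_u_iff (hD : IsOpen D) (hc : IsPreconnected D)
    (hF : ContDiffOn ℝ ∞ F D) : IsAffineFunctionOf D (fun p => p 0) F ↔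
      ∃ c, ∀ p ∈ D, pd 0 F p = c ∧ pd 1 F p = 0 ∧ pd 2 F p = 0 := by
  rw [isAffineFunctionOf_iff hD hc hF fun p _ => differentiableAt_apply 0 p]
  simp [Fin.forall_fin_succ, pd_coord]

theorem isAffineFunctionOf_v_iff (hD : IsOpen D) (hc : IsPreconnected D)
    (hF : ContDiffOn ℝ ∞ F D) : IsAffineFunctionOf D (fun p => p 1) F ↔
      ∃ c, ∀ p ∈ D, pd 0 F p = 0 ∧ pd 1 F p = c ∧ pd 2 F p = 0 := by
  rw [isAffineFunctionOf_iff hD hc hF fun p _ => differentiableAt_apply 1 p]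
  simp [Fin.forall_fin_succ, pd_coord]

theorem C37_firstOrder_iff (hD : IsOpen D) (hc : IsPreconnected D) (hF : ContDiffOn ℝ ∞ F D)
    (f : ℝ → ℝ) (c : ℝ) (hv : ∀ p ∈ D, p 1 ≠ 0) :
    (C37 f c).firstOrder.IsCasimir D F ↔ IsAffineFunctionOf D (fun p => p 0) F := by
  rw [isCasimir_firstOrder_iff _ hD hF, isAffineFunctionOf_u_iff hD hc hF]
  simp only [C37, Fin.forall_fin_succ, Fin.sum_univ_three]
  constructor
  · intro h
    simp +contextual [hv] at h
    -- The third row is w_x F_v / v. After F_v = 0 the second row gives F_w = 0, while the first row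
    -- makes F_u constant.
    have h1 : ∀ p ∈ D, pd 1 F p = 0 := fun p hp => (h p hp).2.2
    obtain ⟨k, hk⟩ := (pd_pd_eq_zero_iff hD hc hF 0).1
      (fun p hp => by simpa [Fin.forall_fin_succ] using (h p hp).1)
    refine ⟨k, fun p hp => ⟨hk p hp, h1 p hp, ?_⟩⟩
    have h2 := (h p hp).2.1.2.2
    rw [pd_eq_zero_of_eq_const_on hD h1 hp, zero_add] at h2
    simpa [h1 p hp, hv p hp] using h2
  · rintro ⟨k, h⟩ p hp
    have h0 := fun k => pd_eq_zero_of_eq_const_on hD (fun q hq => (h q hq).1) hp k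
    have h1 := fun k => pd_eq_zero_of_eq_const_on hD (fun q hq => (h q hq).2.1) hp k
    simp [h p hp, h0, h1]

theorem C37_zeroOrder_iff_of_c_eq_zero (hD : IsOpen D) (hF : ContDiffOn ℝ ∞ F D)
    {f : ℝ → ℝ} (hv : ∀ p ∈ D, p 1 ≠ 0) (hf : ∀ p ∈ D, f (p 2) ≠ 0) :
    (C37 f 0).zeroOrder.IsCasimir D F ↔ IsLocalFunctionOf D (fun p => p 0) F := by
  rw [isCasimir_zeroOrder_iff _ hD hF, isLocalFunctionOf_u_iff hD hF]
  refine forall₂_congr fun p hp => ?_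
  simp [C37, Fin.forall_fin_succ, Fin.sum_univ_three, hf p hp, hv p hp, and_comm]

theorem C37_iff_of_c_eq_zero (hD : IsOpen D) (hc : IsPreconnected D) (hF : ContDiffOn ℝ ∞ F D)
    {f : ℝ → ℝ} (hv : ∀ p ∈ D, p 1 ≠ 0) (hf : ∀ p ∈ D, f (p 2) ≠ 0) :
    (C37 f 0).IsCasimir D F ↔ IsAffineFunctionOf D (fun p => p 0) F := by
  rw [isCasimir_iff_firstOrder_and_zeroOrder _ hD hF, C37_firstOrder_iff hD hc hF f 0 hv,
    C37_zeroOrder_iff_of_c_eq_zero hD hF hv hf, and_iff_left_iff_imp,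
    isLocalFunctionOf_u_iff hD hF, isAffineFunctionOf_u_iff hD hc hF]
  rintro ⟨k, h⟩ p hp
  exact (h p hp).2

theorem C37_zeroOrder_iff_of_c_ne_zero (hD : IsOpen D) (hF : ContDiffOn ℝ ∞ F D)
    {f : ℝ → ℝ} {c : ℝ} (hc0 : c ≠ 0) (hv : ∀ p ∈ D, p 1 ≠ 0) (hf : ∀ p ∈ D, f (p 2) ≠ 0) :
    (C37 f c).zeroOrder.IsCasimir D F ↔
      IsLocalFunctionOf D (fun p => (c * (p 0 ^ 2 + p 1 ^ 2) - 2 * p 0) / c) F := by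
  have hθ : ContDiff ℝ ∞ (fun p : Fin 3 → ℝ => (c * (p 0 ^ 2 + p 1 ^ 2) - 2 * p 0) / c) := by
    fun_prop
  refine zeroOrder_isCasimir_iff_isLocalFunctionOf _ hD hF hθ.contDiffOn fun p hp => ?_
  have hd := hθ.contDiffAt.differentiableAt (x := p) (by simp)
  have hf' := hf p hp
  have hv' := hv p hp
  have h0 := pd_zero_of_hasDerivAt (Θ := fun u v _ => (c * (u ^ 2 + v ^ 2) - 2 * u) / c)
    hd ((((((hasDerivAt_pow 2 (p 0)).add_const (p 1 ^ 2)).const_mul c).fun_sub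
      ((hasDerivAt_id' (p 0)).const_mul 2)).div_const c))
  have h1 := pd_one_of_hasDerivAt (Θ := fun u v _ => (c * (u ^ 2 + v ^ 2) - 2 * u) / c)
    hd ((((hasDerivAt_pow 2 (p 1)).const_add (p 0 ^ 2)).const_mul c).sub_const
      (2 * p 0) |>.div_const c)
  have h2 := pd_two_of_hasDerivAt (Θ := fun u v _ => (c * (u ^ 2 + v ^ 2) - 2 * u) / c)
    hd (hasDerivAt_const (p 2) _)
  -- The multiplier m is read off from the v-component: -cf = m · 2v.
  refine ⟨-c * f (p 2) / (2 * p 1), 0, c * f (p 2), (1 - c * p 0) * f (p 2) / p 1, ?_, by simp [*],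
    by simp [*], ?_, ?_, ?_⟩
  · simp [C37, skewMatrix]
  · rw [h0]; push_cast; field_simp; ring
  · rw [h1]; push_cast; field_simp
  · rw [h2, mul_zero]

theorem C37_iff_of_c_ne_zero (hD : IsOpen D) (hc : IsPreconnected D) (hF : ContDiffOn ℝ ∞ F D)
    {f : ℝ → ℝ} {c : ℝ} (hc0 : c ≠ 0) (hv : ∀ p ∈ D, p 1 ≠ 0) (hf : ∀ p ∈ D, f (p 2) ≠ 0) :
    (C37 f c).IsCasimir D F ↔ IsConstantOn D F := by
  rw [isCasimir_iff_firstOrder_and_zeroOrder _ hD hF, C37_firstOrder_iff hD hc hF f c hv,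
    isCasimir_zeroOrder_iff _ hD hF, isAffineFunctionOf_u_iff hD hc hF, isConstantOn_iff hD hc hF]
  constructor
  · rintro ⟨⟨k, hk⟩, h⟩ p hp
    -- For F = ku + const the third row of the zero-order part is -cfk, which forces k = 0.
    have := h p hp 2
    simp [C37, Fin.sum_univ_three, hk p hp, hc0, hf p hp] at this
    simp [Fin.forall_fin_succ, hk p hp, this]
  · intro h
    exact ⟨⟨0, fun p hp => by simp [h p hp]⟩, fun p hp i => by simp [h p hp]⟩

end

end

noncomputable section

section

variable {D : Set (Fin 3 → ℝ)} {F : (Fin 3 → ℝ) → ℝ}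

/-! ### The operator `C38` -/

theorem hasDerivAt_sqrt_sq_add_one (w : ℝ) :
    HasDerivAt (fun t : ℝ => √(t ^ 2 + 1)) (w / √(w ^ 2 + 1)) w := by
  refine (((hasDerivAt_pow 2 w).add_const 1).sqrt (by positivity)).congr_deriv ?_
  field_simp
  norm_num

theorem contDiff_sqrt_sq_add_one :
    ContDiff ℝ ∞ (fun p : Fin 3 → ℝ => √(p 2 ^ 2 + 1)) :=
  ContDiff.sqrt (by fun_prop) fun p => by positivity

theorem contDiff_C38_casimir :
    ContDiff ℝ ∞ (fun p : Fin 3 → ℝ => (p 1 * p 2 + p 0) / √(p 2 ^ 2 + 1)) :=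
  ContDiff.div (by fun_prop) contDiff_sqrt_sq_add_one fun p => by positivity

theorem pd_C38_casimir (p : Fin 3 → ℝ) :
    pd 0 (fun p => (p 1 * p 2 + p 0) / √(p 2 ^ 2 + 1)) p = 1 / √(p 2 ^ 2 + 1) ∧
    pd 1 (fun p => (p 1 * p 2 + p 0) / √(p 2 ^ 2 + 1)) p = p 2 / √(p 2 ^ 2 + 1) ∧
    pd 2 (fun p => (p 1 * p 2 + p 0) / √(p 2 ^ 2 + 1)) p
      = -(p 0 * p 2 - p 1) / √(p 2 ^ 2 + 1) ^ 3 := by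
  have hd := contDiff_C38_casimir.contDiffAt.differentiableAt (x := p) (by simp)
  have hS : √(p 2 ^ 2 + 1) ^ 2 = p 2 ^ 2 + 1 := Real.sq_sqrt (by positivity)
  have hS0 : √(p 2 ^ 2 + 1) ≠ 0 := by positivity
  refine ⟨pd_zero_of_hasDerivAt (Θ := fun u v w => (v * w + u) / √(w ^ 2 + 1)) hd
      (((hasDerivAt_id' (p 0)).const_add _).div_const _),
    pd_one_of_hasDerivAt (Θ := fun u v w => (v * w + u) / √(w ^ 2 + 1)) hd
      (((((hasDerivAt_id' (p 1)).mul_const _).add_const _).div_const _).congr_deriv (by ring)),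
    pd_two_of_hasDerivAt (Θ := fun u v w => (v * w + u) / √(w ^ 2 + 1)) hd
      (((((hasDerivAt_id' (p 2)).const_mul (p 1)).add_const (p 0)).fun_div
        (hasDerivAt_sqrt_sq_add_one _) hS0).congr_deriv ?_)⟩
  field_simp
  linear_combination p 1 * hS

/-- Write Δ = uw - v. The third row gives F_v = wF_u; the others say that F_u and F_v have only
w-derivatives, wF_w/Δ and -F_w/Δ. Differentiating the first relation in w yields (w² + 1)F_w =
-ΔF_u, so F_u solves a linear ODE in w with integrating factor √(w² + 1). -/
theorem C38_firstOrder_iff (hD : IsOpen D) (hc : IsPreconnected D) (hF : ContDiffOn ℝ ∞ F D)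
    (f : ℝ → ℝ) (c : ℝ) (hΔ : ∀ p ∈ D, p 0 * p 2 - p 1 ≠ 0) :
    (C38 f c).firstOrder.IsCasimir D F ↔
      IsAffineFunctionOf D (fun p => (p 1 * p 2 + p 0) / √(p 2 ^ 2 + 1)) F := by
  rw [isCasimir_firstOrder_iff _ hD hF, isAffineFunctionOf_iff hD hc hF
    fun p _ => contDiff_C38_casimir.contDiffAt.differentiableAt (by simp)]
  simp only [C38, Fin.forall_fin_succ, Fin.sum_univ_three]
  simp [pd_C38_casimir]
  have hS : ∀ p : Fin 3 → ℝ, √(p 2 ^ 2 + 1) ^ 2 = p 2 ^ 2 + 1 :=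
    fun p => Real.sq_sqrt (by positivity)
  have hS0 : ∀ p : Fin 3 → ℝ, √(p 2 ^ 2 + 1) ≠ 0 := fun p => by positivity
  constructor
  · intro h
    have e1 : ∀ p ∈ D, pd 1 F p = p 2 * pd 0 F p := by
      intro p hp
      have := (h p hp).2.2
      have hΔ' : p 2 * p 0 - p 1 ≠ 0 := mul_comm (p 0) (p 2) ▸ hΔ p hp
      field_simp at this
      linarith
    have hd0 : ∀ p ∈ D, DifferentiableAt ℝ (pd 0 F) p := fun p hp =>
      differentiableAt_of_contDiffOn hD (contDiffOn_pd hD hF 0) hp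
    have e2 : ∀ p ∈ D, pd 2 F p * (p 2 ^ 2 + 1) = -(p 0 * p 2 - p 1) * pd 0 F p := by
      intro p hp
      have h1 := (h p hp).2.1.2.2
      rw [pd_congr_on hD e1 hp, pd_coord_mul (a := fun x => x) (hasDerivAt_id' _) (hd0 p hp)] at h1
      have h0 := (h p hp).1.2.2
      have hΔ' : p 2 * p 0 - p 1 ≠ 0 := mul_comm (p 0) (p 2) ▸ hΔ p hp
      simp at h1
      field_simp at h1 h0
      linear_combination h1 - p 2 * h0
    obtain ⟨k, hk⟩ := exists_const_of_pd_eq_zero (F := fun q => √(q 2 ^ 2 + 1) * pd 0 F q) hD hc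
      (fun p hp => (contDiff_sqrt_sq_add_one.contDiffAt.differentiableAt (by simp)).mul (hd0 p hp))
      (fun p hp i => by
        rw [pd_coord_mul (a := fun w => √(w ^ 2 + 1)) (hasDerivAt_sqrt_sq_add_one _) (hd0 p hp)]
        fin_cases i
        · simp [(h p hp).1.1]
        · simp [(h p hp).1.2.1]
        · have h0 := (h p hp).1.2.2
          have h2 := e2 p hp
          have hΔ' : p 2 * p 0 - p 1 ≠ 0 := mul_comm (p 0) (p 2) ▸ hΔ p hp
          have hS' := hS p
          have hS0' := hS0 p
          simp
          field_simp at h0 ⊢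
          rw [hS']
          -- Eliminating F_w leaves Δ times the ODE (w² + 1)F_uw + wF_u = 0, and Δ ≠ 0 can be
          -- cancelled.
          have : (p 2 * p 0 - p 1) * (p 2 * pd 0 F p + pd 2 (pd 0 F) p * (p 2 ^ 2 + 1)) = 0 := by
            linear_combination (p 2 ^ 2 + 1) * h0 + p 2 * h2
          simpa [hΔ'] using this)
    refine ⟨k, fun p hp => ?_⟩
    have hk' := hk p hp
    have hS' := hS p
    have hS0' := hS0 p
    have h2 := e2 p hp
    rw [← hS'] at h2
    refine ⟨?_, ?_, ?_⟩
    · field_simp; linarith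
    · rw [e1 p hp, ← hk']; field_simp
    · rw [← hk']; field_simp; linear_combination h2
  · rintro ⟨k, h⟩ p hp
    have hS' := hS p
    have hS0' := hS0 p
    have hΔ' : p 2 * p 0 - p 1 ≠ 0 := mul_comm (p 0) (p 2) ▸ hΔ p hp
    have hw := hasDerivAt_sqrt_sq_add_one (p 2)
    -- F_u = k/√(w² + 1) and F_v = kw/√(w² + 1) depend on w only, so their second-order data follow
    -- from one-variable derivatives.
    have h0 : ∀ i, pd i (pd 0 F) p = _ := fun i =>
      (pd_congr_on hD (fun q hq => (h q hq).1) hp i).trans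
        (pd_comp_coord (a := fun w => k * (√(w ^ 2 + 1))⁻¹) ((hw.fun_inv hS0').const_mul k) i)
    have h1 : ∀ i, pd i (pd 1 F) p = _ := fun i =>
      (pd_congr_on hD (fun q hq => (h q hq).2.1) hp i).trans
        (pd_comp_coord (a := fun w => k * (w / √(w ^ 2 + 1)))
          (((hasDerivAt_id' (p 2)).fun_div hw hS0').const_mul k) i)
    obtain ⟨e0, e1, e2⟩ := h p hp
    rw [h0, h0, h0, h1, h1, h1, e0, e1, e2]
    simp
    refine ⟨?_, ?_, ?_⟩
    · field_simp; ring
    · field_simp; rw [hS']; ring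
    · field_simp; ring

theorem C38_om (f : ℝ → ℝ) (c : ℝ) (p : Fin 3 → ℝ) : (C38 f c).om p = skewMatrix (f (p 2))
    (√(p 2 ^ 2 + 1) ^ 2 * f (p 2) * (p 2 - c * p 1 * √(p 2 ^ 2 + 1)) / (p 0 * p 2 - p 1))
    (-(√(p 2 ^ 2 + 1) ^ 2 * f (p 2) * (1 - c * p 0 * √(p 2 ^ 2 + 1)) / (p 0 * p 2 - p 1))) := by
  have h : p 2 ^ 2 + 1 ≠ 0 := by positivity
  rw [Real.sq_sqrt (by positivity)]
  ext i j
  fin_cases i <;> fin_cases j <;> simp [C38, skewMatrix, add_comm (1 : ℝ)] <;> field_simp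


theorem C38_om_of_c_eq_zero {f : ℝ → ℝ} {p : Fin 3 → ℝ} (hΔ : p 0 * p 2 - p 1 ≠ 0)
    (hf : f (p 2) ≠ 0) : ∃ m a b d, (C38 f 0).om p = skewMatrix a b d ∧ m ≠ 0 ∧
      (a ≠ 0 ∨ b ≠ 0 ∨ d ≠ 0) ∧
      d = m * pd 0 (fun p => (p 1 * p 2 + p 0) / √(p 2 ^ 2 + 1)) p ∧
      -b = m * pd 1 (fun p => (p 1 * p 2 + p 0) / √(p 2 ^ 2 + 1)) p ∧
      a = m * pd 2 (fun p => (p 1 * p 2 + p 0) / √(p 2 ^ 2 + 1)) p := by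
  obtain ⟨h0, h1, h2⟩ := pd_C38_casimir p
  have hS0 : √(p 2 ^ 2 + 1) ≠ 0 := by positivity
  have hΔ' : p 2 * p 0 - p 1 ≠ 0 := mul_comm (p 0) (p 2) ▸ hΔ
  -- The entry a = f must equal m times the w-derivative of ξ, which is -(uw - v)/√(w² + 1)³; this
  -- fixes m. Nonvanishing of the matrix is also visible in that entry.
  refine ⟨-(f (p 2) * √(p 2 ^ 2 + 1) ^ 3 / (p 0 * p 2 - p 1)), _, _, _, C38_om f 0 p,
    by simp [hf, hS0, hΔ], Or.inl hf, ?_, ?_, ?_⟩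
  · rw [h0]; field_simp; ring
  · rw [h1]; field_simp; ring
  · rw [h2]; field_simp

theorem C38_zeroOrder_iff_of_c_eq_zero (hD : IsOpen D) (hF : ContDiffOn ℝ ∞ F D)
    {f : ℝ → ℝ} (hΔ : ∀ p ∈ D, p 0 * p 2 - p 1 ≠ 0) (hf : ∀ p ∈ D, f (p 2) ≠ 0) :
    (C38 f 0).zeroOrder.IsCasimir D F ↔
      IsLocalFunctionOf D (fun p => (p 1 * p 2 + p 0) / √(p 2 ^ 2 + 1)) F :=
  zeroOrder_isCasimir_iff_isLocalFunctionOf _ hD hF contDiff_C38_casimir.contDiffOn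
    fun p hp => C38_om_of_c_eq_zero (hΔ p hp) (hf p hp)

theorem C38_iff_of_c_eq_zero (hD : IsOpen D) (hc : IsPreconnected D) (hF : ContDiffOn ℝ ∞ F D)
    {f : ℝ → ℝ} (hΔ : ∀ p ∈ D, p 0 * p 2 - p 1 ≠ 0) (hf : ∀ p ∈ D, f (p 2) ≠ 0) :
    (C38 f 0).IsCasimir D F ↔
      IsAffineFunctionOf D (fun p => (p 1 * p 2 + p 0) / √(p 2 ^ 2 + 1)) F := by
  rw [isCasimir_iff_firstOrder_and_zeroOrder _ hD hF, C38_firstOrder_iff hD hc hF f 0 hΔ,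
    and_iff_left_iff_imp, zeroOrder_isCasimir_iff_proportional _ hD hF
      fun p hp => C38_om_of_c_eq_zero (hΔ p hp) (hf p hp),
    isAffineFunctionOf_iff hD hc hF
      fun p _ => contDiff_C38_casimir.contDiffAt.differentiableAt (by simp)]
  exact fun ⟨k, hk⟩ p hp => ⟨k, hk p hp⟩

theorem contDiff_C38_zeroOrder_casimir (c : ℝ) : ContDiff ℝ ∞ (fun p : Fin 3 → ℝ =>
    2 * (p 1 * p 2 + p 0) / √(p 2 ^ 2 + 1) - c * (p 0 ^ 2 + p 1 ^ 2)) :=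
  (ContDiff.div (by fun_prop) contDiff_sqrt_sq_add_one fun p => by positivity).sub (by fun_prop)

theorem pd_C38_zeroOrder_casimir (c : ℝ) (p : Fin 3 → ℝ) :
    pd 0 (fun p => 2 * (p 1 * p 2 + p 0) / √(p 2 ^ 2 + 1) - c * (p 0 ^ 2 + p 1 ^ 2)) p
      = 2 / √(p 2 ^ 2 + 1) - 2 * c * p 0 ∧
    pd 1 (fun p => 2 * (p 1 * p 2 + p 0) / √(p 2 ^ 2 + 1) - c * (p 0 ^ 2 + p 1 ^ 2)) p
      = 2 * p 2 / √(p 2 ^ 2 + 1) - 2 * c * p 1 ∧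
    pd 2 (fun p => 2 * (p 1 * p 2 + p 0) / √(p 2 ^ 2 + 1) - c * (p 0 ^ 2 + p 1 ^ 2)) p
      = -2 * (p 0 * p 2 - p 1) / √(p 2 ^ 2 + 1) ^ 3 := by
  have hd := (contDiff_C38_zeroOrder_casimir c).contDiffAt.differentiableAt (x := p) (by simp)
  have hS : √(p 2 ^ 2 + 1) ^ 2 = p 2 ^ 2 + 1 := Real.sq_sqrt (by positivity)
  have hS0 : √(p 2 ^ 2 + 1) ≠ 0 := by positivity
  refine ⟨pd_zero_of_hasDerivAt
      (Θ := fun u v w => 2 * (v * w + u) / √(w ^ 2 + 1) - c * (u ^ 2 + v ^ 2)) hd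
      ((((((hasDerivAt_id' (p 0)).const_add _).const_mul 2).div_const _).fun_sub
        (((hasDerivAt_pow 2 (p 0)).add_const _).const_mul c)).congr_deriv (by norm_num; ring)),
    pd_one_of_hasDerivAt
      (Θ := fun u v w => 2 * (v * w + u) / √(w ^ 2 + 1) - c * (u ^ 2 + v ^ 2)) hd
      (((((((hasDerivAt_id' (p 1)).mul_const _).add_const _).const_mul 2).div_const _).fun_sub
        (((hasDerivAt_pow 2 (p 1)).const_add _).const_mul c)).congr_deriv (by norm_num; ring)),
    pd_two_of_hasDerivAt
      (Θ := fun u v w => 2 * (v * w + u) / √(w ^ 2 + 1) - c * (u ^ 2 + v ^ 2)) hd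
      ((((((hasDerivAt_id' (p 2)).const_mul (p 1)).add_const (p 0)).const_mul 2 |>.fun_div
        (hasDerivAt_sqrt_sq_add_one _) hS0).sub_const _).congr_deriv ?_)⟩
  field_simp
  linear_combination p 1 * hS

theorem C38_om_proportional {f : ℝ → ℝ} (c : ℝ) {p : Fin 3 → ℝ} (hΔ : p 0 * p 2 - p 1 ≠ 0)
    (hf : f (p 2) ≠ 0) : ∃ m a b d, (C38 f c).om p = skewMatrix a b d ∧ m ≠ 0 ∧
      (a ≠ 0 ∨ b ≠ 0 ∨ d ≠ 0) ∧
      d = m * pd 0 (fun p => 2 * (p 1 * p 2 + p 0) / √(p 2 ^ 2 + 1)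
        - c * (p 0 ^ 2 + p 1 ^ 2)) p ∧
      -b = m * pd 1 (fun p => 2 * (p 1 * p 2 + p 0) / √(p 2 ^ 2 + 1)
        - c * (p 0 ^ 2 + p 1 ^ 2)) p ∧
      a = m * pd 2 (fun p => 2 * (p 1 * p 2 + p 0) / √(p 2 ^ 2 + 1)
        - c * (p 0 ^ 2 + p 1 ^ 2)) p := by
  obtain ⟨h0, h1, h2⟩ := pd_C38_zeroOrder_casimir c p
  have hS0 : √(p 2 ^ 2 + 1) ≠ 0 := by positivity
  have hΔ' : p 2 * p 0 - p 1 ≠ 0 := mul_comm (p 0) (p 2) ▸ hΔ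
  refine ⟨-(f (p 2) * √(p 2 ^ 2 + 1) ^ 3 / (2 * (p 0 * p 2 - p 1))), _, _, _, C38_om f c p,
    by simp [hf, hS0, hΔ], Or.inl hf, ?_, ?_, ?_⟩
  · rw [h0]; field_simp
  · rw [h1]; field_simp
  · rw [h2]; field_simp

theorem C38_zeroOrder_iff (hD : IsOpen D) (hF : ContDiffOn ℝ ∞ F D) {f : ℝ → ℝ} (c : ℝ)
    (hΔ : ∀ p ∈ D, p 0 * p 2 - p 1 ≠ 0) (hf : ∀ p ∈ D, f (p 2) ≠ 0) :
    (C38 f c).zeroOrder.IsCasimir D F ↔ IsLocalFunctionOf D (fun p =>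
      2 * (p 1 * p 2 + p 0) / √(p 2 ^ 2 + 1) - c * (p 0 ^ 2 + p 1 ^ 2)) F :=
  zeroOrder_isCasimir_iff_isLocalFunctionOf _ hD hF (contDiff_C38_zeroOrder_casimir c).contDiffOn
    fun p hp => C38_om_proportional c (hΔ p hp) (hf p hp)

theorem C38_iff_of_c_ne_zero (hD : IsOpen D) (hc : IsPreconnected D) (hF : ContDiffOn ℝ ∞ F D)
    {f : ℝ → ℝ} {c : ℝ} (hc0 : c ≠ 0) (hΔ : ∀ p ∈ D, p 0 * p 2 - p 1 ≠ 0)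
    (hf : ∀ p ∈ D, f (p 2) ≠ 0) : (C38 f c).IsCasimir D F ↔ IsConstantOn D F := by
  rw [isCasimir_iff_firstOrder_and_zeroOrder _ hD hF, C38_firstOrder_iff hD hc hF f c hΔ,
    zeroOrder_isCasimir_iff_proportional _ hD hF
      fun p hp => C38_om_proportional c (hΔ p hp) (hf p hp), isConstantOn_iff hD hc hF,
    isAffineFunctionOf_iff hD hc hF
      fun p _ => contDiff_C38_casimir.contDiffAt.differentiableAt (by simp)]
  constructor
  · rintro ⟨⟨k, hk⟩, h⟩ p hp
    obtain ⟨l, hl⟩ := h p hp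
    have hS0 : √(p 2 ^ 2 + 1) ≠ 0 := by positivity
    obtain ⟨t0, t1, t2⟩ := pd_C38_zeroOrder_casimir c p
    obtain ⟨s0, s1, s2⟩ := pd_C38_casimir p
    have e0 := (hk p hp 0).symm.trans (hl 0)
    have e1 := (hk p hp 1).symm.trans (hl 1)
    have e2 := (hk p hp 2).symm.trans (hl 2)
    rw [s0, t0] at e0
    rw [s1, t1] at e1
    rw [s2, t2] at e2
    -- The quadratic term of θ = 2ξ - c(u² + v²) has no w-derivative, so the w-components compare k
    -- with 2l. The other components then give lu = lv = 0, and uw ≠ v forces l = 0.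
    have hkl : k = 2 * l := by
      refine mul_right_cancel₀ (div_ne_zero (hΔ p hp) (pow_ne_zero 3 hS0)) ?_
      linear_combination -e2
    have hu : l * p 0 = 0 := by
      refine (mul_eq_zero.1 (?_ : 2 * c * (l * p 0) = 0)).resolve_left (by simpa using hc0)
      rw [hkl] at e0
      linear_combination e0
    have hv : l * p 1 = 0 := by
      refine (mul_eq_zero.1 (?_ : 2 * c * (l * p 1) = 0)).resolve_left (by simpa using hc0)
      rw [hkl] at e1
      linear_combination e1
    have hl0 : l = 0 := by
      refine (mul_eq_zero.1 (?_ : l * (p 0 * p 2 - p 1) = 0)).resolve_right (hΔ p hp)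
      linear_combination p 2 * hu - hv
    intro i
    rw [hl i, hl0, zero_mul]
  · intro h
    exact ⟨⟨0, fun p hp i => by simp [h p hp]⟩, fun p hp => ⟨0, fun i => by simp [h p hp]⟩⟩

end

end

noncomputable section

section

variable {D : Set (Fin 3 → ℝ)} {F : (Fin 3 → ℝ) → ℝ}

/-! ### The operator `C310` -/

/-- The third row gives F_u = 0, which makes the second row trivial; the first row, after symmetry
of second derivatives, is F_vv = 0 and vF_vw = F_w. -/
theorem C310_firstOrder_iff_pd (hD : IsOpen D) (hF : ContDiffOn ℝ ∞ F D) (f g h : ℝ → ℝ)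
    (hv : ∀ p ∈ D, p 1 ≠ 0) : (C310 f g h).firstOrder.IsCasimir D F ↔
      ∀ p ∈ D, pd 0 F p = 0 ∧ pd 1 (pd 1 F) p = 0 ∧ p 1 * pd 2 (pd 1 F) p = pd 2 F p := by
  rw [isCasimir_firstOrder_iff _ hD hF]
  simp only [C310, Fin.forall_fin_succ, Fin.sum_univ_three]
  simp
  constructor
  · intro H p hp
    have hv' := hv p hp
    obtain ⟨⟨-, h1, h2⟩, -, h3⟩ := H p hp
    refine ⟨by simpa [hv'] using h3, h1, ?_⟩
    field_simp at h2
    linarith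
  · intro H p hp
    have hv' := hv p hp
    have h0 : ∀ k, pd k (pd 0 F) p = 0 := fun k =>
      pd_eq_zero_of_eq_const_on hD (fun q hq => (H q hq).1) hp k
    obtain ⟨h3, h1, h2⟩ := H p hp
    refine ⟨⟨?_, h1, ?_⟩, ⟨h0 0, h0 1, h0 2⟩, Or.inr h3⟩
    · rw [pd_comm hD hF hp]
      exact h0 1
    · rw [← h2]
      field_simp
      ring

theorem C310_firstOrder_iff (hD : IsOpen D) (hc : IsPreconnected D) (hF : ContDiffOn ℝ ∞ F D)
    (f g h : ℝ → ℝ) (hv : ∀ p ∈ D, p 1 ≠ 0) : (C310 f g h).firstOrder.IsCasimir D F ↔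
      ∃ (c₂ : ℝ) (G : (Fin 3 → ℝ) → ℝ), IsLocalFunctionOf D (fun p => p 2) G ∧
        ∀ p ∈ D, F p = G p * p 1 + c₂ := by
  rw [C310_firstOrder_iff_pd hD hF f g h hv]
  constructor
  · intro H
    have hF1 := contDiffOn_pd hD hF 1
    have hd1 := fun p (hp : p ∈ D) => differentiableAt_of_contDiffOn hD hF1 hp
    have h01 : ∀ p ∈ D, pd 0 (pd 1 F) p = 0 := fun p hp => by
      rw [pd_comm hD hF hp]
      exact pd_eq_zero_of_eq_const_on hD (fun q hq => (H q hq).1) hp 1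
    -- The reduced system says exactly that F - vF_v has zero gradient; the factor multiplying v is
    -- then F_v, which depends on w alone.
    obtain ⟨k, hk⟩ := exists_const_of_pd_eq_zero (F := fun q => F q - q 1 * pd 1 F q) hD hc
      (fun p hp => (differentiableAt_of_contDiffOn hD hF hp).sub
        ((differentiableAt_apply 1 p).mul (hd1 p hp)))
      (fun p hp i => by
        rw [pd_sub (differentiableAt_of_contDiffOn hD hF hp)
          ((differentiableAt_apply 1 p).fun_mul (hd1 p hp)),
          pd_coord_mul (a := fun x => x) (hasDerivAt_id' _) (hd1 p hp)]
        obtain ⟨h0, h1, h2⟩ := H p hp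
        fin_cases i
        · simp [h0, h01 p hp]
        · simp [h1]
        · simp [h2])
    refine ⟨k, pd 1 F, (isLocalFunctionOf_w_iff hD hF1).2 fun p hp => ⟨h01 p hp, (H p hp).2.1⟩,
      fun p hp => by linarith [hk p hp]⟩
  · rintro ⟨k, G, hG, hFG⟩
    have hGs := contDiffOn_of_isLocalFunctionOf hG (contDiff_apply ℝ ℝ 2)
    rw [isLocalFunctionOf_w_iff hD hGs] at hG
    have hGd := fun p (hp : p ∈ D) => differentiableAt_of_contDiffOn hD hGs hp
    have key : ∀ p ∈ D, ∀ i, pd i F p = pd i G p * p 1 + G p * if i = 1 then 1 else 0 := by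
      intro p hp i
      rw [pd_congr_on hD hFG hp, pd_add ((hGd p hp).fun_mul (differentiableAt_apply 1 p))
        (differentiableAt_const k), pd_mul (hGd p hp) (differentiableAt_apply 1 p), pd_coord,
        pd_const, add_zero]
    have key1 : ∀ p ∈ D, pd 1 F p = G p := fun p hp => by simp [key p hp, hG p hp]
    intro p hp
    rw [pd_congr_on hD key1 hp, pd_congr_on hD key1 hp, key p hp, key p hp]
    simp [hG p hp, mul_comm]

theorem C310_zeroOrder_iff_pd (hD : IsOpen D) (hF : ContDiffOn ℝ ∞ F D) (f g h : ℝ → ℝ) :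
    (C310 f g h).zeroOrder.IsCasimir D F ↔ ∀ p ∈ D,
      f (p 2) * pd 1 F p + (h (p 2) - p 0 * g (p 2)) / p 1 * pd 2 F p = 0 ∧
      -(f (p 2) * pd 0 F p) + g (p 2) * pd 2 F p = 0 ∧
      -((h (p 2) - p 0 * g (p 2)) / p 1 * pd 0 F p) + -(g (p 2) * pd 1 F p) = 0 := by
  rw [isCasimir_zeroOrder_iff _ hD hF]
  simp [C310, Fin.forall_fin_succ, Fin.sum_univ_three]

/-- With F_u = 0 from the first-order part, the last two rows of the zero-order part reduce to gF_w
= 0 and gF_v = 0. -/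
theorem C310_iff_of_g_ne_zero (hD : IsOpen D) (hc : IsPreconnected D) (hF : ContDiffOn ℝ ∞ F D)
    {f g h : ℝ → ℝ} (hv : ∀ p ∈ D, p 1 ≠ 0) (hg : ∀ p ∈ D, g (p 2) ≠ 0) :
    (C310 f g h).IsCasimir D F ↔ IsConstantOn D F := by
  rw [isCasimir_iff_firstOrder_and_zeroOrder _ hD hF, C310_firstOrder_iff_pd hD hF f g h hv,
    C310_zeroOrder_iff_pd hD hF, isConstantOn_iff hD hc hF]
  constructor
  · rintro ⟨H1, H0⟩ p hp
    have h0 := (H1 p hp).1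
    obtain ⟨-, h2, h1⟩ := H0 p hp
    simp [h0, hg p hp] at h1 h2
    simp [Fin.forall_fin_succ, h0, h1, h2]
  · intro H
    exact ⟨fun p hp => by
      simp [H p hp, pd_eq_zero_of_eq_const_on hD (fun q hq => H q hq 1) hp], fun p hp => by
      simp [H p hp]⟩

theorem C310_of_f_g_eq_zero (hD : IsOpen D) (hc : IsPreconnected D) (hF : ContDiffOn ℝ ∞ F D)
    {f g h : ℝ → ℝ} (hv : ∀ p ∈ D, p 1 ≠ 0)
    (hfgh : ∀ p ∈ D, f (p 2) = 0 ∧ g (p 2) = 0 ∧ h (p 2) ≠ 0) :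
    ((C310 f g h).zeroOrder.IsCasimir D F ↔ IsLocalFunctionOf D (fun p => p 1) F) ∧
    ((C310 f g h).IsCasimir D F ↔ IsAffineFunctionOf D (fun p => p 1) F) := by
  have hz : (C310 f g h).zeroOrder.IsCasimir D F ↔ ∀ p ∈ D, pd 0 F p = 0 ∧ pd 2 F p = 0 := by
    rw [C310_zeroOrder_iff_pd hD hF]
    refine forall₂_congr fun p hp => ?_
    simp [hfgh p hp, hv p hp, and_comm]
  rw [isCasimir_iff_firstOrder_and_zeroOrder (C310 f g h) hD hF,
    C310_firstOrder_iff_pd hD hF f g h hv, hz, isLocalFunctionOf_v_iff hD hF,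
    isAffineFunctionOf_v_iff hD hc hF]
  refine ⟨Iff.rfl, ?_, ?_⟩
  · rintro ⟨H1, H0⟩
    obtain ⟨k, hk⟩ := (pd_pd_eq_zero_iff hD hc hF 1).1 (fun p hp i => by
      rw [pd_comm hD hF hp]
      fin_cases i
      · exact pd_eq_zero_of_eq_const_on hD (fun q hq => (H0 q hq).1) hp 1
      · exact (H1 p hp).2.1
      · exact pd_eq_zero_of_eq_const_on hD (fun q hq => (H0 q hq).2) hp 1)
    exact ⟨k, fun p hp => ⟨(H0 p hp).1, hk p hp, (H0 p hp).2⟩⟩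
  · rintro ⟨k, hk⟩
    refine ⟨fun p hp => ?_, fun p hp => ⟨(hk p hp).1, (hk p hp).2.2⟩⟩
    have h1 := fun i => pd_eq_zero_of_eq_const_on hD (fun q hq => (hk q hq).2.1) hp i
    simp [h1, hk p hp]

theorem C310_of_g_h_eq_zero (hD : IsOpen D) (hc : IsPreconnected D) (hF : ContDiffOn ℝ ∞ F D)
    {f g h : ℝ → ℝ} (hv : ∀ p ∈ D, p 1 ≠ 0)
    (hfgh : ∀ p ∈ D, f (p 2) ≠ 0 ∧ g (p 2) = 0 ∧ h (p 2) = 0) :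
    ((C310 f g h).zeroOrder.IsCasimir D F ↔ IsLocalFunctionOf D (fun p => p 2) F) ∧
    ((C310 f g h).IsCasimir D F ↔ IsConstantOn D F) := by
  have hz : (C310 f g h).zeroOrder.IsCasimir D F ↔ ∀ p ∈ D, pd 0 F p = 0 ∧ pd 1 F p = 0 := by
    rw [C310_zeroOrder_iff_pd hD hF]
    refine forall₂_congr fun p hp => ?_
    simp [hfgh p hp, and_comm]
  rw [isCasimir_iff_firstOrder_and_zeroOrder (C310 f g h) hD hF,
    C310_firstOrder_iff_pd hD hF f g h hv, hz, isLocalFunctionOf_w_iff hD hF,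
    isConstantOn_iff hD hc hF]
  refine ⟨Iff.rfl, ?_, ?_⟩
  · rintro ⟨H1, H0⟩ p hp
    -- F_v vanishes identically, so F_w = vF_vw = 0 as well.
    have h2 := (H1 p hp).2.2
    rw [pd_eq_zero_of_eq_const_on hD (fun q hq => (H0 q hq).2) hp, mul_zero] at h2
    simp [Fin.forall_fin_succ, H0 p hp, ← h2]
  · intro H
    exact ⟨fun p hp => by
      simp [H p hp, pd_eq_zero_of_eq_const_on hD (fun q hq => H q hq 1) hp],
      fun p hp => ⟨H p hp 0, H p hp 1⟩⟩

theorem C310_zeroOrder_iff_of_f_h_eq_zero (hD : IsOpen D) (hF : ContDiffOn ℝ ∞ F D)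
    {f g h : ℝ → ℝ} (hv : ∀ p ∈ D, p 1 ≠ 0)
    (hfgh : ∀ p ∈ D, f (p 2) = 0 ∧ g (p 2) ≠ 0 ∧ h (p 2) = 0) :
    (C310 f g h).zeroOrder.IsCasimir D F ↔ IsLocalFunctionOf D (fun p => p 0 * p 1) F := by
  have hθ : ContDiff ℝ ∞ (fun p : Fin 3 → ℝ => p 0 * p 1) := by fun_prop
  refine zeroOrder_isCasimir_iff_isLocalFunctionOf _ hD hF hθ.contDiffOn fun p hp => ?_
  obtain ⟨hf, hg, hh⟩ := hfgh p hp
  have hv' := hv p hp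
  have hpd : ∀ i, pd i (fun p : Fin 3 → ℝ => p 0 * p 1) p
      = (if i = 0 then 1 else 0) * p 1 + p 0 * if i = 1 then 1 else 0 := fun i => by
    rw [pd_mul (differentiableAt_apply 0 p) (differentiableAt_apply 1 p), pd_coord, pd_coord]
  refine ⟨g (p 2) / p 1, _, _, _, rfl, div_ne_zero hg hv', Or.inr (Or.inr hg), ?_, ?_, ?_⟩
  · rw [hpd]; simp; field_simp
  · rw [hpd, hh]; simp; field_simp
  · rw [hpd, hf]; simp

/-- For θ = v(u - h/g) the vector (g/v)∇θ has first components g and (ug - h)/v. Its last one is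
-g(h/g)', and the closure relation is precisely the statement that this equals f. -/
theorem C310_zeroOrder_iff_of_g_ne_zero {J : Set ℝ} (hD : IsOpen D) (hF : ContDiffOn ℝ ∞ F D)
    {f g h : ℝ → ℝ} (hJ : IsOpen J) (hDJ : ∀ p ∈ D, p 2 ∈ J) (hv : ∀ p ∈ D, p 1 ≠ 0)
    (hg : ContDiffOn ℝ ∞ g J) (hh : ContDiffOn ℝ ∞ h J)
    (hcl : ∀ w ∈ J, f w * g w + g w * deriv h w - h w * deriv g w = 0)
    (hg0 : ∀ w ∈ J, g w ≠ 0) :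
    (C310 f g h).zeroOrder.IsCasimir D F ↔
      IsLocalFunctionOf D (fun p => p 1 * ((p 0 * g (p 2) - h (p 2)) / g (p 2))) F := by
  have hgD : ContDiffOn ℝ ∞ (fun p : Fin 3 → ℝ => g (p 2)) D := contDiffOn_comp_coord hg hDJ
  have hhD : ContDiffOn ℝ ∞ (fun p : Fin 3 → ℝ => h (p 2)) D := contDiffOn_comp_coord hh hDJ
  have hθ : ContDiffOn ℝ ∞
      (fun p : Fin 3 → ℝ => p 1 * ((p 0 * g (p 2) - h (p 2)) / g (p 2))) D :=
    (contDiff_apply ℝ ℝ 1).contDiffOn.mul ((((contDiff_apply ℝ ℝ 0).contDiffOn.mul hgD).sub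
      hhD).div hgD fun p hp => hg0 _ (hDJ p hp))
  refine zeroOrder_isCasimir_iff_isLocalFunctionOf _ hD hF hθ fun p hp => ?_
  have hv' := hv p hp
  have hw := hDJ p hp
  have hg' := hg0 _ hw
  have hdg := hasDerivAt_of_contDiffOn hJ hg hw
  have hdh := hasDerivAt_of_contDiffOn hJ hh hw
  have hd := differentiableAt_of_contDiffOn hD hθ hp
  have h0 := pd_zero_of_hasDerivAt (Θ := fun u v w => v * ((u * g w - h w) / g w)) hd
    (((((hasDerivAt_id' (p 0)).mul_const _).sub_const _).div_const _).const_mul (p 1))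
  have h1 := pd_one_of_hasDerivAt (Θ := fun u v w => v * ((u * g w - h w) / g w)) hd
    ((hasDerivAt_id' (p 1)).mul_const _)
  have h2 := pd_two_of_hasDerivAt (Θ := fun u v w => v * ((u * g w - h w) / g w)) hd
    ((((hdg.const_mul (p 0)).fun_sub hdh).fun_div hdg hg').const_mul (p 1))
  have hcl' := hcl _ hw
  refine ⟨g (p 2) / p 1, _, _, _, rfl, div_ne_zero hg' hv', Or.inr (Or.inr hg'), ?_, ?_, ?_⟩
  · rw [h0]; field_simp
  · rw [h1]; field_simp; ring
  · rw [h2]; field_simp; linear_combination hcl'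

/-- Only the equation E' = -(f/h)E and E ≠ 0 matter: the kernel direction (0, -h/v, f) is -h/(vE)
times the gradient of vE(w). -/
theorem C310_of_g_eq_zero_of_hasDerivAt {J : Set ℝ} (hD : IsOpen D) (hc : IsPreconnected D)
    (hF : ContDiffOn ℝ ∞ F D) {f g h E : ℝ → ℝ} (hDJ : ∀ p ∈ D, p 2 ∈ J)
    (hv : ∀ p ∈ D, p 1 ≠ 0) (hfgh : ∀ w ∈ J, f w ≠ 0 ∧ g w = 0 ∧ h w ≠ 0)
    (hEs : ContDiffOn ℝ ∞ E J) (hEd : ∀ w ∈ J, HasDerivAt E (-(f w / h w) * E w) w)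
    (hE0 : ∀ w, E w ≠ 0) :
    ((C310 f g h).zeroOrder.IsCasimir D F ↔ IsLocalFunctionOf D (fun p => p 1 * E (p 2)) F) ∧
    ((C310 f g h).IsCasimir D F ↔ IsAffineFunctionOf D (fun p => p 1 * E (p 2)) F) := by
  have hθ : ContDiffOn ℝ ∞ (fun p : Fin 3 → ℝ => p 1 * E (p 2)) D :=
    (contDiff_apply ℝ ℝ 1).contDiffOn.mul (contDiffOn_comp_coord hEs hDJ)
  have hθd := fun p (hp : p ∈ D) => differentiableAt_of_contDiffOn hD hθ hp
  have hpd : ∀ p ∈ D, pd 0 (fun p => p 1 * E (p 2)) p = 0 ∧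
      pd 1 (fun p => p 1 * E (p 2)) p = E (p 2) ∧
      pd 2 (fun p => p 1 * E (p 2)) p = p 1 * (-(f (p 2) / h (p 2)) * E (p 2)) := fun p hp =>
    ⟨pd_zero_of_hasDerivAt (Θ := fun _ v w => v * E w) (hθd p hp) (hasDerivAt_const _ _),
      pd_one_of_hasDerivAt (Θ := fun _ v w => v * E w) (hθd p hp)
        (((hasDerivAt_id' (p 1)).mul_const _).congr_deriv (one_mul _)),
      pd_two_of_hasDerivAt (Θ := fun _ v w => v * E w) (hθd p hp)
        ((hEd _ (hDJ p hp)).const_mul (p 1))⟩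
  have hK : ∀ p ∈ D, ∃ m a b d, (C310 f g h).om p = skewMatrix a b d ∧ m ≠ 0 ∧
      (a ≠ 0 ∨ b ≠ 0 ∨ d ≠ 0) ∧ d = m * pd 0 (fun p => p 1 * E (p 2)) p ∧
      -b = m * pd 1 (fun p => p 1 * E (p 2)) p ∧ a = m * pd 2 (fun p => p 1 * E (p 2)) p := by
    intro p hp
    obtain ⟨h0, h1, h2⟩ := hpd p hp
    obtain ⟨hf', hg', hh'⟩ := hfgh _ (hDJ p hp)
    have hv' := hv p hp
    have hE' := hE0 (p 2)
    refine ⟨-(h (p 2) / (p 1 * E (p 2))), _, _, _, rfl,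
      neg_ne_zero.2 (div_ne_zero hh' (mul_ne_zero hv' hE')), Or.inl hf', ?_, ?_, ?_⟩
    · rw [h0, hg', mul_zero]
    · rw [h1, hg']; field_simp; simp
    · rw [h2]; field_simp
  refine ⟨zeroOrder_isCasimir_iff_isLocalFunctionOf _ hD hF hθ hK, ?_⟩
  rw [isCasimir_iff_firstOrder_and_zeroOrder _ hD hF, C310_firstOrder_iff_pd hD hF f g h hv,
    zeroOrder_isCasimir_iff_proportional _ hD hF hK, isAffineFunctionOf_iff hD hc hF hθd]
  have hinv : ∀ p ∈ D, HasDerivAt (fun w => (E w)⁻¹) (f (p 2) / h (p 2) * (E (p 2))⁻¹) (p 2) := by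
    intro p hp
    refine ((hEd _ (hDJ p hp)).fun_inv (hE0 _)).congr_deriv ?_
    have hE' := hE0 (p 2)
    have hh' := (hfgh _ (hDJ p hp)).2.2
    field_simp
  have hd1 : ∀ p ∈ D, DifferentiableAt ℝ (pd 1 F) p := fun p hp =>
    differentiableAt_of_contDiffOn hD (contDiffOn_pd hD hF 1) hp
  constructor
  · rintro ⟨H1, H0⟩
    have hrel : ∀ p ∈ D, pd 2 F p = p 1 * (-(f (p 2) / h (p 2)) * pd 1 F p) := by
      intro p hp
      obtain ⟨l, hl⟩ := H0 p hp
      rw [hl, hl, (hpd p hp).2.1, (hpd p hp).2.2]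
      ring
    -- Combining F_w = -v(f/h)F_v with vF_vw = F_w gives F_vw = -(f/h)F_v, the equation solved by E;
    -- hence F_v/E is constant.
    obtain ⟨k, hk⟩ := exists_const_of_pd_eq_zero (F := fun q => (E (q 2))⁻¹ * pd 1 F q) hD hc
      (fun p hp => (DifferentiableAt.comp (g := fun w => (E w)⁻¹) (f := fun q : Fin 3 → ℝ => q 2) p
        (hinv p hp).differentiableAt (differentiableAt_apply 2 p)).mul (hd1 p hp))
      (fun p hp i => by
        rw [pd_coord_mul (a := fun w => (E w)⁻¹) (hinv p hp) (hd1 p hp)]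
        obtain ⟨h0, h1, h2⟩ := H1 p hp
        fin_cases i
        · simp [pd_comm hD hF hp 0 1, pd_eq_zero_of_eq_const_on hD (fun q hq => (H1 q hq).1) hp]
        · simp [h1]
        · have hv' := hv p hp
          rw [hrel p hp] at h2
          have h2' := mul_left_cancel₀ hv' h2
          simp [h2']
          ring)
    refine ⟨k, fun p hp => ?_⟩
    obtain ⟨h0, h1, h2⟩ := hpd p hp
    have e1 : pd 1 F p = k * E (p 2) := by
      rw [← hk p hp]
      have hE' := hE0 (p 2)
      field_simp
    simp only [Fin.forall_fin_succ, Fin.succ_zero_eq_one, Fin.succ_one_eq_two, h0, h1, h2,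
      IsEmpty.forall_iff, and_true]
    refine ⟨by simp [(H1 p hp).1], e1, ?_⟩
    rw [hrel p hp, e1]
    ring
  · rintro ⟨k, hk⟩
    refine ⟨fun p hp => ?_, fun p hp => ⟨k, hk p hp⟩⟩
    obtain ⟨h0, h1, h2⟩ := hpd p hp
    have e1 : ∀ i, pd i (pd 1 F) p = _ := fun i =>
      (pd_congr_on hD (fun q hq => (hk q hq 1).trans (by rw [(hpd q hq).2.1])) hp i).trans
        (pd_comp_coord (a := fun w => k * E w) ((hEd _ (hDJ p hp)).const_mul k) i)
    rw [e1, e1, hk p hp, hk p hp, h0, h2]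
    simp
    ring

theorem C310_of_g_eq_zero {J : Set ℝ} (hD : IsOpen D) (hc : IsPreconnected D)
    (hF : ContDiffOn ℝ ∞ F D) {f g h : ℝ → ℝ} (hJ : IsOpen J) (hJ' : J.OrdConnected)
    (hDJ : ∀ p ∈ D, p 2 ∈ J) (hv : ∀ p ∈ D, p 1 ≠ 0)
    (hf : ContDiffOn ℝ ∞ f J) (hh : ContDiffOn ℝ ∞ h J)
    (hfgh : ∀ w ∈ J, f w ≠ 0 ∧ g w = 0 ∧ h w ≠ 0) {w₀ : ℝ} (hw₀ : w₀ ∈ J) :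
    ((C310 f g h).zeroOrder.IsCasimir D F ↔ IsLocalFunctionOf D
      (fun p => p 1 * Real.exp (-∫ s in w₀..(p 2), f s / h s)) F) ∧
    ((C310 f g h).IsCasimir D F ↔ IsAffineFunctionOf D
      (fun p => p 1 * Real.exp (-∫ s in w₀..(p 2), f s / h s)) F) := by
  have hfh : ContDiffOn ℝ ∞ (fun s => f s / h s) J := hf.div hh fun w hw => (hfgh w hw).2.2
  exact C310_of_g_eq_zero_of_hasDerivAt
    (E := fun w => Real.exp (-∫ s in w₀..w, f s / h s)) hD hc hF hDJ hv hfgh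
    (contDiffOn_primitive hJ hJ' hfh hw₀).neg.exp
    (fun w hw => (hasDerivAt_primitive hJ hJ' hfh.continuousOn hw₀
      hw).fun_neg.exp.congr_deriv (mul_comm _ _))
    fun _ => Real.exp_ne_zero _

/-! ### The operator `C311` -/

theorem contDiffOn_sqrt_w (hw : ∀ p ∈ D, 0 < p 2) :
    ContDiffOn ℝ ∞ (fun p : Fin 3 → ℝ => √(p 2)) D :=
  ContDiffOn.sqrt (by fun_prop) fun p hp => (hw p hp).ne'

theorem contDiffOn_C311_casimir (hw : ∀ p ∈ D, 0 < p 2) :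
    ContDiffOn ℝ ∞ (fun p : Fin 3 → ℝ => p 1 / √(p 2) + √(p 2) * p 0) D :=
  (ContDiffOn.div (by fun_prop) (contDiffOn_sqrt_w hw)
    fun p hp => (Real.sqrt_pos.2 (hw p hp)).ne').add
    ((contDiffOn_sqrt_w hw).mul (by fun_prop))

theorem hasDerivAt_sqrt_of_pos {w : ℝ} (hw : 0 < w) :
    HasDerivAt (fun t => √t) (1 / (2 * √w)) w :=
  Real.hasDerivAt_sqrt hw.ne'

theorem pd_C311_casimir (hD : IsOpen D) (hw : ∀ p ∈ D, 0 < p 2) {p : Fin 3 → ℝ} (hp : p ∈ D) :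
    pd 0 (fun p => p 1 / √(p 2) + √(p 2) * p 0) p = √(p 2) ∧
    pd 1 (fun p => p 1 / √(p 2) + √(p 2) * p 0) p = 1 / √(p 2) ∧
    pd 2 (fun p => p 1 / √(p 2) + √(p 2) * p 0) p
      = (p 0 * p 2 - p 1) / (2 * √(p 2) ^ 3) := by
  have hd := differentiableAt_of_contDiffOn hD (contDiffOn_C311_casimir hw) hp
  have hS : √(p 2) ^ 2 = p 2 := Real.sq_sqrt (hw p hp).le
  have hS0 : √(p 2) ≠ 0 := (Real.sqrt_pos.2 (hw p hp)).ne'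
  have hs := hasDerivAt_sqrt_of_pos (hw p hp)
  refine ⟨pd_zero_of_hasDerivAt (Θ := fun u v w => v / √w + √w * u) hd
      ((((hasDerivAt_id' (p 0)).const_mul _).const_add _).congr_deriv (mul_one _)),
    pd_one_of_hasDerivAt (Θ := fun u v w => v / √w + √w * u) hd
      (((hasDerivAt_id' (p 1)).div_const _).add_const _),
    pd_two_of_hasDerivAt (Θ := fun u v w => v / √w + √w * u) hd
      ((((hasDerivAt_const (p 2) (p 1)).fun_div hs hS0).fun_add
        (hs.mul_const (p 0))).congr_deriv ?_)⟩
  field_simp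
  rw [hS]
  ring

/-- With Δ = uw - v the third row gives F_u = wF_v, and the others give F_vw = -F_w/Δ and F_uw =
wF_w/Δ. Differentiating the first relation in w yields 2wF_w = ΔF_v, so 2wF_vw = -F_v and √w F_v is
constant. -/
theorem C311_firstOrder_iff (hD : IsOpen D) (hc : IsPreconnected D) (hF : ContDiffOn ℝ ∞ F D)
    (f : ℝ → ℝ) (c : ℝ) (hw : ∀ p ∈ D, 0 < p 2) (hΔ : ∀ p ∈ D, p 0 * p 2 - p 1 ≠ 0) :
    (C311 f c).firstOrder.IsCasimir D F ↔
      IsAffineFunctionOf D (fun p => p 1 / √(p 2) + √(p 2) * p 0) F := by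
  rw [isCasimir_firstOrder_iff _ hD hF, isAffineFunctionOf_iff hD hc hF
    fun p hp => differentiableAt_of_contDiffOn hD (contDiffOn_C311_casimir hw) hp]
  simp only [C311, Fin.forall_fin_succ, Fin.sum_univ_three]
  simp
  have hS : ∀ p ∈ D, √(p 2) ^ 2 = p 2 := fun p hp => Real.sq_sqrt (hw p hp).le
  have hS0 : ∀ p ∈ D, √(p 2) ≠ 0 := fun p hp => (Real.sqrt_pos.2 (hw p hp)).ne'
  constructor
  · intro h
    have e0 : ∀ p ∈ D, pd 0 F p = p 2 * pd 1 F p := by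
      intro p hp
      have := (h p hp).2.2
      have hΔ' := hΔ p hp
      field_simp at this
      linarith
    have hd1 : ∀ p ∈ D, DifferentiableAt ℝ (pd 1 F) p := fun p hp =>
      differentiableAt_of_contDiffOn hD (contDiffOn_pd hD hF 1) hp
    have e2 : ∀ p ∈ D, 2 * p 2 * pd 2 F p = (p 0 * p 2 - p 1) * pd 1 F p := by
      intro p hp
      have h0 := (h p hp).2.1.2.2
      rw [pd_congr_on hD e0 hp, pd_coord_mul (a := fun x => x) (hasDerivAt_id' _) (hd1 p hp)] at h0
      have h1 := (h p hp).1.2.2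
      have hΔ' := hΔ p hp
      simp at h0
      field_simp at h1 h0
      linear_combination p 2 * h1 - h0
    obtain ⟨k, hk⟩ := exists_const_of_pd_eq_zero (F := fun q => √(q 2) * pd 1 F q) hD hc
      (fun p hp => (differentiableAt_of_contDiffOn hD (contDiffOn_sqrt_w hw) hp).mul (hd1 p hp))
      (fun p hp i => by
        rw [pd_coord_mul (a := fun w => √w) (hasDerivAt_sqrt_of_pos (hw p hp)) (hd1 p hp)]
        fin_cases i
        · simp [(h p hp).1.1]
        · simp [(h p hp).1.2.1]
        · have h1 := (h p hp).1.2.2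
          have h2 := e2 p hp
          have hΔ' := hΔ p hp
          have hS' := hS p hp
          have hS0' := hS0 p hp
          simp
          field_simp at h1 ⊢
          rw [hS']
          have : (p 0 * p 2 - p 1) * (pd 1 F p + p 2 * 2 * pd 2 (pd 1 F) p) = 0 := by
            linear_combination 2 * p 2 * h1 - h2
          -- The ODE for F_v appears multiplied by Δ, which is nonzero on the domain.
          have := (mul_eq_zero.1 this).resolve_left hΔ'
          linear_combination this)
    refine ⟨k, fun p hp => ?_⟩
    obtain ⟨t0, t1, t2⟩ := pd_C311_casimir hD hw hp
    rw [t0, t1, t2, ← hk p hp]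
    have hS' := hS p hp
    have hS0' := hS0 p hp
    have h2 := e2 p hp
    refine ⟨?_, ?_, ?_⟩
    · rw [e0 p hp]; linear_combination -pd 1 F p * hS'
    · field_simp
    · field_simp; rw [hS']; linear_combination h2
  · rintro ⟨k, h⟩ p hp
    have hS' := hS p hp
    have hS0' := hS0 p hp
    have hΔ' := hΔ p hp
    have hΔ1 : p 2 * p 0 - p 1 ≠ 0 := mul_comm (p 0) (p 2) ▸ hΔ p hp
    have hs := hasDerivAt_sqrt_of_pos (hw p hp)
    have h0 : ∀ i, pd i (pd 0 F) p = _ := fun i =>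
      (pd_congr_on hD (fun q hq => (h q hq).1.trans (by rw [(pd_C311_casimir hD hw hq).1]))
        hp i).trans (pd_comp_coord (a := fun w => k * √w) (hs.const_mul k) i)
    have h1 : ∀ i, pd i (pd 1 F) p = _ := fun i =>
      (pd_congr_on hD (fun q hq => (h q hq).2.1.trans
        (by rw [(pd_C311_casimir hD hw hq).2.1])) hp i).trans
        (pd_comp_coord (a := fun w => k * (1 / √w))
          (((hasDerivAt_const (p 2) 1).fun_div hs hS0').const_mul k) i)
    obtain ⟨e0, e1, e2⟩ := h p hp
    obtain ⟨t0, t1, t2⟩ := pd_C311_casimir hD hw hp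
    rw [h0, h0, h0, h1, h1, h1, e0, e1, e2, t0, t1, t2]
    simp
    refine ⟨?_, ?_, ?_⟩
    · field_simp; ring
    · field_simp; rw [hS']; ring
    · field_simp; rw [hS']; ring

theorem contDiffOn_C311_zeroOrder_casimir (c : ℝ) (hw : ∀ p ∈ D, 0 < p 2) :
    ContDiffOn ℝ ∞ (fun p : Fin 3 → ℝ =>
      2 * c * p 0 * √(p 2) + 2 * p 1 * c / √(p 2) - p 0 * p 1) D :=
  ((ContDiffOn.mul (by fun_prop) (contDiffOn_sqrt_w hw)).add (ContDiffOn.div (by fun_prop)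
    (contDiffOn_sqrt_w hw) fun p hp => (Real.sqrt_pos.2 (hw p hp)).ne')).sub (by fun_prop)

theorem pd_C311_zeroOrder_casimir (c : ℝ) (hD : IsOpen D) (hw : ∀ p ∈ D, 0 < p 2)
    {p : Fin 3 → ℝ} (hp : p ∈ D) :
    pd 0 (fun p => 2 * c * p 0 * √(p 2) + 2 * p 1 * c / √(p 2) - p 0 * p 1) p
      = 2 * c * √(p 2) - p 1 ∧
    pd 1 (fun p => 2 * c * p 0 * √(p 2) + 2 * p 1 * c / √(p 2) - p 0 * p 1) p
      = 2 * c / √(p 2) - p 0 ∧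
    pd 2 (fun p => 2 * c * p 0 * √(p 2) + 2 * p 1 * c / √(p 2) - p 0 * p 1) p
      = c * (p 0 * p 2 - p 1) / √(p 2) ^ 3 := by
  have hd := differentiableAt_of_contDiffOn hD (contDiffOn_C311_zeroOrder_casimir c hw) hp
  have hS : √(p 2) ^ 2 = p 2 := Real.sq_sqrt (hw p hp).le
  have hS0 : √(p 2) ≠ 0 := (Real.sqrt_pos.2 (hw p hp)).ne'
  have hs := hasDerivAt_sqrt_of_pos (hw p hp)
  refine ⟨pd_zero_of_hasDerivAt
      (Θ := fun u v w => 2 * c * u * √w + 2 * v * c / √w - u * v) hd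
      ((((((hasDerivAt_id' (p 0)).const_mul (2 * c)).mul_const _).add_const _).fun_sub
        ((hasDerivAt_id' (p 0)).mul_const _)).congr_deriv (by ring)),
    pd_one_of_hasDerivAt
      (Θ := fun u v w => 2 * c * u * √w + 2 * v * c / √w - u * v) hd
      (((((((hasDerivAt_id' (p 1)).const_mul 2).mul_const c).div_const _).const_add _).fun_sub
        ((hasDerivAt_id' (p 1)).const_mul _)).congr_deriv (by ring)),
    pd_two_of_hasDerivAt
      (Θ := fun u v w => 2 * c * u * √w + 2 * v * c / √w - u * v) hd
      ((((hs.const_mul _).fun_add ((hasDerivAt_const (p 2) (2 * p 1 * c)).fun_div hs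
        hS0)).sub_const _).congr_deriv ?_)⟩
  field_simp
  rw [hS]
  ring

theorem C311_om_proportional {f : ℝ → ℝ} (c : ℝ) (hD : IsOpen D) (hw : ∀ p ∈ D, 0 < p 2)
    (hΔ : ∀ p ∈ D, p 0 * p 2 - p 1 ≠ 0) (hf : ∀ p ∈ D, f (p 2) ≠ 0) :
    ∀ p ∈ D, ∃ m a b d, (C311 f c).om p = skewMatrix a b d ∧ m ≠ 0 ∧
      (a ≠ 0 ∨ b ≠ 0 ∨ d ≠ 0) ∧
      d = m * pd 0 (fun p => 2 * c * p 0 * √(p 2) + 2 * p 1 * c / √(p 2) - p 0 * p 1) p ∧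
      -b = m * pd 1 (fun p => 2 * c * p 0 * √(p 2) + 2 * p 1 * c / √(p 2) - p 0 * p 1) p ∧
      a = m * pd 2 (fun p => 2 * c * p 0 * √(p 2) + 2 * p 1 * c / √(p 2) - p 0 * p 1) p := by
  intro p hp
  obtain ⟨h0, h1, h2⟩ := pd_C311_zeroOrder_casimir c hD hw hp
  have hS : √(p 2) ^ 2 = p 2 := Real.sq_sqrt (hw p hp).le
  have hS0 : √(p 2) ≠ 0 := (Real.sqrt_pos.2 (hw p hp)).ne'
  have hw0 := (hw p hp).ne'
  have hf' := hf p hp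
  have hΔ1 := hΔ p hp
  have hΔ' : p 2 * p 0 - p 1 ≠ 0 := mul_comm (p 0) (p 2) ▸ hΔ p hp
  refine ⟨f (p 2) * p 2 / (p 0 * p 2 - p 1), f (p 2) * (c / √(p 2)),
    f (p 2) * ((p 0 * p 2 - 2 * c * √(p 2)) / (p 0 * p 2 - p 1)),
    -(f (p 2) * (p 2 * (p 1 - 2 * c * √(p 2)) / (p 0 * p 2 - p 1))), ?_,
    div_ne_zero (mul_ne_zero hf' hw0) hΔ1, ?_, ?_, ?_, ?_⟩
  · ext i j
    fin_cases i <;> fin_cases j <;> simp [C311, skewMatrix]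
  -- The three entries vanish together only if c = 0 and then u = v = 0, which contradicts uw ≠ v.
  · by_contra! hcon
    obtain ⟨ha, hb, hd⟩ := hcon
    have hc : c = 0 := by simpa [hf', hS0] using ha
    subst hc
    have hu : p 0 = 0 := by simpa [hf', hw0, hΔ1] using hb
    have hv : p 1 = 0 := by simpa [hf', hw0, hΔ1] using hd
    exact hΔ1 (by simp [hu, hv])
  · rw [h0]; field_simp; ring
  · rw [h1]; field_simp; linear_combination 2 * c * hS
  · rw [h2]; field_simp; rw [hS]

theorem C311_zeroOrder_iff (hD : IsOpen D) (hF : ContDiffOn ℝ ∞ F D) {f : ℝ → ℝ} (c : ℝ)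
    (hw : ∀ p ∈ D, 0 < p 2) (hΔ : ∀ p ∈ D, p 0 * p 2 - p 1 ≠ 0) (hf : ∀ p ∈ D, f (p 2) ≠ 0) :
    (C311 f c).zeroOrder.IsCasimir D F ↔ IsLocalFunctionOf D
      (fun p => 2 * c * p 0 * √(p 2) + 2 * p 1 * c / √(p 2) - p 0 * p 1) F :=
  zeroOrder_isCasimir_iff_isLocalFunctionOf _ hD hF (contDiffOn_C311_zeroOrder_casimir c hw)
    (C311_om_proportional c hD hw hΔ hf)

theorem C311_iff (hD : IsOpen D) (hc : IsPreconnected D) (hF : ContDiffOn ℝ ∞ F D)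
    {f : ℝ → ℝ} (c : ℝ) (hw : ∀ p ∈ D, 0 < p 2) (hΔ : ∀ p ∈ D, p 0 * p 2 - p 1 ≠ 0)
    (hf : ∀ p ∈ D, f (p 2) ≠ 0) : (C311 f c).IsCasimir D F ↔ IsConstantOn D F := by
  rw [isCasimir_iff_firstOrder_and_zeroOrder _ hD hF, C311_firstOrder_iff hD hc hF f c hw hΔ,
    zeroOrder_isCasimir_iff_proportional _ hD hF (C311_om_proportional c hD hw hΔ hf),
    isConstantOn_iff hD hc hF, isAffineFunctionOf_iff hD hc hF
      fun p hp => differentiableAt_of_contDiffOn hD (contDiffOn_C311_casimir hw) hp]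
  constructor
  · rintro ⟨⟨k, hk⟩, h⟩ p hp
    obtain ⟨l, hl⟩ := h p hp
    have hS : √(p 2) ^ 2 = p 2 := Real.sq_sqrt (hw p hp).le
    have hS0 : √(p 2) ≠ 0 := (Real.sqrt_pos.2 (hw p hp)).ne'
    obtain ⟨t0, t1, t2⟩ := pd_C311_zeroOrder_casimir c hD hw hp
    obtain ⟨s0, s1, s2⟩ := pd_C311_casimir hD hw hp
    have e0 := (hk p hp 0).symm.trans (hl 0)
    have e1 := (hk p hp 1).symm.trans (hl 1)
    have e2 := (hk p hp 2).symm.trans (hl 2)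
    rw [s0, t0] at e0
    rw [s1, t1] at e1
    rw [s2, t2] at e2
    -- The w-components give k = 2cl, also when c = 0. Substituted in the other components this
    -- leaves lu = lv = 0, so l(uw - v) = 0.
    have hkl : k = 2 * c * l := by
      refine mul_right_cancel₀
        (div_ne_zero (hΔ p hp) (mul_ne_zero two_ne_zero (pow_ne_zero 3 hS0))) ?_
      linear_combination e2
    rw [hkl] at e0 e1
    have hv : l * p 1 = 0 := by linear_combination e0
    have hu : l * p 0 = 0 := by linear_combination e1
    have hl0 : l = 0 := by
      refine (mul_eq_zero.1 (?_ : l * (p 0 * p 2 - p 1) = 0)).resolve_right (hΔ p hp)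
      linear_combination p 2 * hu - hv
    intro i
    rw [hl i, hl0, zero_mul]
  · intro h
    exact ⟨⟨0, fun p hp i => by simp [h p hp]⟩, fun p hp => ⟨0, fun i => by simp [h p hp]⟩⟩

end

end

/-! ### The classification for all operators. -/

theorem mainTheorem8 :
    -- the operator C_{2,1}
    (∀ (D : Set (Fin 2 → ℝ)) (J : Set ℝ) (f : ℝ → ℝ) (F : (Fin 2 → ℝ) → ℝ),
      IsOpen D → IsPreconnected D → IsOpen J → J.OrdConnected → (∀ p ∈ D, p 1 ∈ J) →
      ContDiffOn ℝ ∞ f J → ContDiffOn ℝ ∞ F D →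
      ((∀ v ∈ J, f v ≠ 0) → ((C21 f).zeroOrder.IsCasimir D F ↔ IsConstantOn D F)) ∧
      ((C21 f).firstOrder.IsCasimir D F ↔
        ∃ (c₁ : ℝ) (G : (Fin 2 → ℝ) → ℝ), IsLocalFunctionOf D (fun p => p 1) G ∧
          ∀ p ∈ D, F p = c₁ * p 0 + G p) ∧
      ((∀ v ∈ J, f v ≠ 0) → ((C21 f).IsCasimir D F ↔ IsConstantOn D F))) ∧
    -- the operator C_{2,2}
    (∀ (D : Set (Fin 2 → ℝ)) (J : Set ℝ) (f : ℝ → ℝ) (F : (Fin 2 → ℝ) → ℝ),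
      IsOpen D → IsPreconnected D → IsOpen J → J.OrdConnected → (∀ p ∈ D, p 1 ∈ J) →
      (∀ p ∈ D, p 0 ≠ 0) →
      ContDiffOn ℝ ∞ f J → ContDiffOn ℝ ∞ F D →
      ((∀ v ∈ J, f v ≠ 0) → ((C22 f).zeroOrder.IsCasimir D F ↔ IsConstantOn D F)) ∧
      ((C22 f).firstOrder.IsCasimir D F ↔ IsConstantOn D F) ∧
      ((C22 f).IsCasimir D F ↔ IsConstantOn D F)) ∧
    -- the operator C_{3,1}
    (∀ (D : Set (Fin 3 → ℝ)) (f : ℝ → ℝ → ℝ → ℝ) (F : (Fin 3 → ℝ) → ℝ),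
      IsOpen D → IsPreconnected D →
      ContDiffOn ℝ ∞ (fun p : Fin 3 → ℝ => f (p 0) (p 1) (p 2)) D → ContDiffOn ℝ ∞ F D →
      ((∀ p ∈ D, f (p 0) (p 1) (p 2) ≠ 0) →
        ((C31 f).zeroOrder.IsCasimir D F ↔ IsLocalFunctionOf D (fun p => p 2) F)) ∧
      ((C31 f).firstOrder.IsCasimir D F ↔ IsLocalFunctionOf D (fun p => p 2) F) ∧
      ((C31 f).IsCasimir D F ↔ IsLocalFunctionOf D (fun p => p 2) F)) ∧
    -- the operators C_{3,2} and C_{3,5}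
    (∀ (D : Set (Fin 3 → ℝ)) (I J : Set ℝ) (f g h : ℝ → ℝ → ℝ),
      IsOpen D → IsPreconnected D →
      IsOpen I → I.OrdConnected → IsOpen J → J.OrdConnected →
      (∀ p ∈ D, p 1 ∈ I ∧ p 2 ∈ J) →
      ContDiffOn ℝ ∞ (Function.uncurry f) (I ×ˢ J) →
      ContDiffOn ℝ ∞ (Function.uncurry g) (I ×ˢ J) →
      ContDiffOn ℝ ∞ (Function.uncurry h) (I ×ˢ J) →
      ClosureRelation I J f g h →
      -- general form
      (∀ F : (Fin 3 → ℝ) → ℝ, ContDiffOn ℝ ∞ F D →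
        ((C32 f g h).firstOrder.IsCasimir D F ↔ IsLinearPlusFunctionVW D F) ∧
        ((C32 f g h).zeroOrder.IsCasimir D F ↔ UltralocalSystem D f g h F) ∧
        ((C32 f g h).IsCasimir D F ↔
          IsLinearPlusFunctionVW D F ∧ UltralocalSystem D f g h F) ∧
        ((∀ p ∈ D, p 0 ≠ 0) →
          ((C35 f g h).firstOrder.IsCasimir D F ↔ IsConstantOn D F) ∧
          ((C35 f g h).zeroOrder.IsCasimir D F ↔ UltralocalSystem D f g h F) ∧
          ((C35 f g h).zeroOrder.IsCasimir D F ↔ (C32 f g h).zeroOrder.IsCasimir D F) ∧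
          ((C35 f g h).IsCasimir D F ↔ IsConstantOn D F))) ∧
      -- case f = 0, g ≠ 0, h ≠ 0
      ((∀ v ∈ I, ∀ w ∈ J, f v w = 0 ∧ g v w ≠ 0 ∧ h v w ≠ 0) →
        ∃ ℓ : ℝ → ℝ, ContDiffOn ℝ ∞ ℓ I ∧ (∀ v ∈ I, ∀ w ∈ J, g v w / h v w = ℓ v) ∧
          ∀ v₀ ∈ I, ∀ F : (Fin 3 → ℝ) → ℝ, ContDiffOn ℝ ∞ F D →
            ((C32 f g h).zeroOrder.IsCasimir D F ↔
              IsLocalFunctionOf D (fun p => p 0 - ∫ s in v₀..(p 1), ℓ s) F) ∧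
            ((C32 f g h).IsCasimir D F ↔
              IsAffineFunctionOf D (fun p => p 0 - ∫ s in v₀..(p 1), ℓ s) F)) ∧
      -- case f = g = 0, h ≠ 0
      ((∀ v ∈ I, ∀ w ∈ J, f v w = 0 ∧ g v w = 0 ∧ h v w ≠ 0) →
        ∀ F : (Fin 3 → ℝ) → ℝ, ContDiffOn ℝ ∞ F D →
          ((C32 f g h).zeroOrder.IsCasimir D F ↔ IsLocalFunctionOf D (fun p => p 0) F) ∧
          ((C32 f g h).IsCasimir D F ↔ IsAffineFunctionOf D (fun p => p 0) F)) ∧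
      -- case f = h = 0, g ≠ 0
      ((∀ v ∈ I, ∀ w ∈ J, f v w = 0 ∧ g v w ≠ 0 ∧ h v w = 0) →
        ∀ F : (Fin 3 → ℝ) → ℝ, ContDiffOn ℝ ∞ F D →
          ((C32 f g h).zeroOrder.IsCasimir D F ↔ IsLocalFunctionOf D (fun p => p 1) F) ∧
          ((C32 f g h).IsCasimir D F ↔ IsLocalFunctionOf D (fun p => p 1) F)) ∧
      -- case g = 0, f ≠ 0, h ≠ 0
      ((∀ v ∈ I, ∀ w ∈ J, f v w ≠ 0 ∧ g v w = 0 ∧ h v w ≠ 0) →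
        ∃ ℓ : ℝ → ℝ, ContDiffOn ℝ ∞ ℓ J ∧ (∀ v ∈ I, ∀ w ∈ J, f v w / h v w = ℓ w) ∧
          ∀ w₀ ∈ J, ∀ F : (Fin 3 → ℝ) → ℝ, ContDiffOn ℝ ∞ F D →
            ((C32 f g h).zeroOrder.IsCasimir D F ↔
              IsLocalFunctionOf D (fun p => p 0 + ∫ s in w₀..(p 2), ℓ s) F) ∧
            ((C32 f g h).IsCasimir D F ↔
              IsAffineFunctionOf D (fun p => p 0 + ∫ s in w₀..(p 2), ℓ s) F)) ∧
      -- case g = h = 0, f ≠ 0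
      ((∀ v ∈ I, ∀ w ∈ J, f v w ≠ 0 ∧ g v w = 0 ∧ h v w = 0) →
        ∀ F : (Fin 3 → ℝ) → ℝ, ContDiffOn ℝ ∞ F D →
          ((C32 f g h).zeroOrder.IsCasimir D F ↔ IsLocalFunctionOf D (fun p => p 2) F) ∧
          ((C32 f g h).IsCasimir D F ↔ IsLocalFunctionOf D (fun p => p 2) F)) ∧
      -- case h = 0, f ≠ 0, g ≠ 0
      ((∀ v ∈ I, ∀ w ∈ J, f v w ≠ 0 ∧ g v w ≠ 0 ∧ h v w = 0) →
        ∀ F : (Fin 3 → ℝ) → ℝ, ContDiffOn ℝ ∞ F D →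
          ((C32 f g h).zeroOrder.IsCasimir D F ↔
            IsLocalFunctionOf D (fun p => (p 1, p 2)) F ∧
            ∀ p ∈ D, f (p 1) (p 2) * pd 1 F p + g (p 1) (p 2) * pd 2 F p = 0) ∧
          ((C32 f g h).IsCasimir D F ↔
            IsLocalFunctionOf D (fun p => (p 1, p 2)) F ∧
            ∀ p ∈ D, f (p 1) (p 2) * pd 1 F p + g (p 1) (p 2) * pd 2 F p = 0))) ∧
    -- the operator C_{3,3}
    (∀ (D : Set (Fin 3 → ℝ)) (I J : Set ℝ) (f : ℝ → ℝ → ℝ) (F : (Fin 3 → ℝ) → ℝ),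
      IsOpen D → IsPreconnected D →
      IsOpen I → I.OrdConnected → IsOpen J → J.OrdConnected →
      (∀ p ∈ D, p 1 ∈ I ∧ p 2 ∈ J) →
      ContDiffOn ℝ ∞ (Function.uncurry f) (I ×ˢ J) → ContDiffOn ℝ ∞ F D →
      ((∀ v ∈ I, ∀ w ∈ J, f v w ≠ 0) →
        ((C33 f).zeroOrder.IsCasimir D F ↔ IsLocalFunctionOf D (fun p => p 2) F)) ∧
      ((C33 f).firstOrder.IsCasimir D F ↔ IsLocalFunctionOf D (fun p => p 2) F) ∧
      ((C33 f).IsCasimir D F ↔ IsLocalFunctionOf D (fun p => p 2) F)) ∧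
    -- the operator C_{3,4}
    (∀ (D : Set (Fin 3 → ℝ)) (I J : Set ℝ) (f : ℝ → ℝ → ℝ) (F : (Fin 3 → ℝ) → ℝ),
      IsOpen D → IsPreconnected D →
      IsOpen I → I.OrdConnected → IsOpen J → J.OrdConnected →
      (∀ p ∈ D, p 1 ∈ I ∧ p 2 ∈ J) → (∀ p ∈ D, p 0 ≠ 0) →
      ContDiffOn ℝ ∞ (Function.uncurry f) (I ×ˢ J) → ContDiffOn ℝ ∞ F D →
      ((∀ v ∈ I, ∀ w ∈ J, f v w ≠ 0) →
        ((C34 f).zeroOrder.IsCasimir D F ↔ IsLocalFunctionOf D (fun p => p 1) F)) ∧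
      ((C34 f).firstOrder.IsCasimir D F ↔ IsLocalFunctionOf D (fun p => p 1) F) ∧
      ((C34 f).IsCasimir D F ↔ IsLocalFunctionOf D (fun p => p 1) F)) ∧
    -- the operator C_{3,6}
    (∀ (D : Set (Fin 3 → ℝ)) (J : Set ℝ) (f g : ℝ → ℝ) (c : ℝ) (F : (Fin 3 → ℝ) → ℝ),
      IsOpen D → IsPreconnected D → IsOpen J → J.OrdConnected → (∀ p ∈ D, p 2 ∈ J) →
      ContDiffOn ℝ ∞ f J → ContDiffOn ℝ ∞ g J → ContDiffOn ℝ ∞ F D →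
      ((C36 f g c).firstOrder.IsCasimir D F ↔ IsLinearPlusFunctionW D F) ∧
      ((∀ w ∈ J, g w = 0 ∧ f w ≠ 0) →
        ((C36 f g c).zeroOrder.IsCasimir D F ↔ IsLocalFunctionOf D (fun p => p 2) F) ∧
        ((C36 f g c).IsCasimir D F ↔ IsLocalFunctionOf D (fun p => p 2) F)) ∧
      ((∀ w ∈ J, g w ≠ 0) → ∀ w₀ ∈ J,
        ((C36 f g c).zeroOrder.IsCasimir D F ↔
          IsLocalFunctionOf D (fun p => p 1 - (∫ s in w₀..(p 2), f s / g s) - c * p 0) F) ∧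
        ((C36 f g c).IsCasimir D F ↔
          IsAffineFunctionOf D (fun p => p 1 - (∫ s in w₀..(p 2), f s / g s) - c * p 0) F))) ∧
    -- the operator C_{3,7}
    (∀ (D : Set (Fin 3 → ℝ)) (J : Set ℝ) (f : ℝ → ℝ) (c : ℝ) (F : (Fin 3 → ℝ) → ℝ),
      IsOpen D → IsPreconnected D → IsOpen J → J.OrdConnected → (∀ p ∈ D, p 2 ∈ J) →
      (∀ p ∈ D, p 1 ≠ 0) →
      ContDiffOn ℝ ∞ f J → ContDiffOn ℝ ∞ F D →
      ((C37 f c).firstOrder.IsCasimir D F ↔ IsAffineFunctionOf D (fun p => p 0) F) ∧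
      (c = 0 → (∀ w ∈ J, f w ≠ 0) →
        ((C37 f c).zeroOrder.IsCasimir D F ↔ IsLocalFunctionOf D (fun p => p 0) F) ∧
        ((C37 f c).IsCasimir D F ↔ IsAffineFunctionOf D (fun p => p 0) F)) ∧
      (c ≠ 0 → (∀ w ∈ J, f w ≠ 0) →
        ((C37 f c).zeroOrder.IsCasimir D F ↔
          IsLocalFunctionOf D (fun p => (c * (p 0 ^ 2 + p 1 ^ 2) - 2 * p 0) / c) F) ∧
        ((C37 f c).IsCasimir D F ↔ IsConstantOn D F))) ∧
    -- the operator C_{3,8}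
    (∀ (D : Set (Fin 3 → ℝ)) (J : Set ℝ) (f : ℝ → ℝ) (c : ℝ) (F : (Fin 3 → ℝ) → ℝ),
      IsOpen D → IsPreconnected D → IsOpen J → J.OrdConnected → (∀ p ∈ D, p 2 ∈ J) →
      (∀ p ∈ D, p 0 * p 2 - p 1 ≠ 0) →
      ContDiffOn ℝ ∞ f J → ContDiffOn ℝ ∞ F D →
      ((C38 f c).firstOrder.IsCasimir D F ↔
        IsAffineFunctionOf D (fun p => (p 1 * p 2 + p 0) / √(p 2 ^ 2 + 1)) F) ∧
      (c = 0 → (∀ w ∈ J, f w ≠ 0) →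
        ((C38 f c).zeroOrder.IsCasimir D F ↔
          IsLocalFunctionOf D (fun p => (p 1 * p 2 + p 0) / √(p 2 ^ 2 + 1)) F) ∧
        ((C38 f c).IsCasimir D F ↔
          IsAffineFunctionOf D (fun p => (p 1 * p 2 + p 0) / √(p 2 ^ 2 + 1)) F)) ∧
      (c ≠ 0 → (∀ w ∈ J, f w ≠ 0) →
        ((C38 f c).zeroOrder.IsCasimir D F ↔
          IsLocalFunctionOf D (fun p => 2 * (p 1 * p 2 + p 0) / √(p 2 ^ 2 + 1)
            - c * (p 0 ^ 2 + p 1 ^ 2)) F) ∧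
        ((C38 f c).IsCasimir D F ↔ IsConstantOn D F))) ∧
    -- the operator C_{3,9}
    (∀ (D : Set (Fin 3 → ℝ)) (J : Set ℝ) (f g : ℝ → ℝ) (c : ℝ) (F : (Fin 3 → ℝ) → ℝ),
      IsOpen D → IsPreconnected D → IsOpen J → J.OrdConnected → (∀ p ∈ D, p 2 ∈ J) →
      ContDiffOn ℝ ∞ f J → ContDiffOn ℝ ∞ g J → ContDiffOn ℝ ∞ F D →
      ((C39 f g c).firstOrder.IsCasimir D F ↔ IsLinearPlusFunctionW D F) ∧
      ((∀ w ∈ J, g w = 0 ∧ f w ≠ 0) →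
        ((C39 f g c).zeroOrder.IsCasimir D F ↔ IsLocalFunctionOf D (fun p => p 2) F) ∧
        ((C39 f g c).IsCasimir D F ↔ IsLocalFunctionOf D (fun p => p 2) F)) ∧
      ((∀ w ∈ J, g w ≠ 0) → ∀ w₀ ∈ J,
        ((C39 f g c).zeroOrder.IsCasimir D F ↔
          IsLocalFunctionOf D (fun p => c * p 1 - (∫ s in w₀..(p 2), f s / g s) - p 0) F) ∧
        ((C39 f g c).IsCasimir D F ↔
          IsAffineFunctionOf D (fun p => c * p 1 - (∫ s in w₀..(p 2), f s / g s) - p 0) F))) ∧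
    -- the operator C_{3,10}
    (∀ (D : Set (Fin 3 → ℝ)) (J : Set ℝ) (f g h : ℝ → ℝ) (F : (Fin 3 → ℝ) → ℝ),
      IsOpen D → IsPreconnected D → IsOpen J → J.OrdConnected → (∀ p ∈ D, p 2 ∈ J) →
      (∀ p ∈ D, p 1 ≠ 0) →
      ContDiffOn ℝ ∞ f J → ContDiffOn ℝ ∞ g J → ContDiffOn ℝ ∞ h J →
      -- closure relation (Jacobi identity of the zero-order part)
      (∀ w ∈ J, f w * g w + g w * deriv h w - h w * deriv g w = 0) →
      ContDiffOn ℝ ∞ F D →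
      ((C310 f g h).firstOrder.IsCasimir D F ↔
        ∃ (c₂ : ℝ) (G : (Fin 3 → ℝ) → ℝ), IsLocalFunctionOf D (fun p => p 2) G ∧
          ∀ p ∈ D, F p = G p * p 1 + c₂) ∧
      ((∀ w ∈ J, f w = 0 ∧ g w = 0 ∧ h w ≠ 0) →
        ((C310 f g h).zeroOrder.IsCasimir D F ↔ IsLocalFunctionOf D (fun p => p 1) F) ∧
        ((C310 f g h).IsCasimir D F ↔ IsAffineFunctionOf D (fun p => p 1) F)) ∧
      ((∀ w ∈ J, f w = 0 ∧ g w ≠ 0 ∧ h w = 0) →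
        ((C310 f g h).zeroOrder.IsCasimir D F ↔
          IsLocalFunctionOf D (fun p => p 0 * p 1) F) ∧
        ((C310 f g h).IsCasimir D F ↔ IsConstantOn D F)) ∧
      ((∀ w ∈ J, f w ≠ 0 ∧ g w = 0 ∧ h w = 0) →
        ((C310 f g h).zeroOrder.IsCasimir D F ↔ IsLocalFunctionOf D (fun p => p 2) F) ∧
        ((C310 f g h).IsCasimir D F ↔ IsConstantOn D F)) ∧
      ((∀ w ∈ J, f w ≠ 0 ∧ g w = 0 ∧ h w ≠ 0) → ∀ w₀ ∈ J,
        ((C310 f g h).zeroOrder.IsCasimir D F ↔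
          IsLocalFunctionOf D
            (fun p => p 1 * Real.exp (-∫ s in w₀..(p 2), f s / h s)) F) ∧
        ((C310 f g h).IsCasimir D F ↔
          IsAffineFunctionOf D
            (fun p => p 1 * Real.exp (-∫ s in w₀..(p 2), f s / h s)) F)) ∧
      ((∀ w ∈ J, g w ≠ 0) →
        ((C310 f g h).zeroOrder.IsCasimir D F ↔
          IsLocalFunctionOf D
            (fun p => p 1 * ((p 0 * g (p 2) - h (p 2)) / g (p 2))) F) ∧
        ((C310 f g h).IsCasimir D F ↔ IsConstantOn D F))) ∧
    -- the operator C_{3,11}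
    (∀ (D : Set (Fin 3 → ℝ)) (J : Set ℝ) (f : ℝ → ℝ) (c : ℝ) (F : (Fin 3 → ℝ) → ℝ),
      IsOpen D → IsPreconnected D → IsOpen J → J.OrdConnected → (∀ p ∈ D, p 2 ∈ J) →
      (∀ p ∈ D, 0 < p 2) → (∀ p ∈ D, p 0 * p 2 - p 1 ≠ 0) →
      ContDiffOn ℝ ∞ f J → ContDiffOn ℝ ∞ F D →
      ((∀ w ∈ J, f w ≠ 0) →
        ((C311 f c).zeroOrder.IsCasimir D F ↔
          IsLocalFunctionOf D
            (fun p => 2 * c * p 0 * √(p 2) + 2 * p 1 * c / √(p 2) - p 0 * p 1) F)) ∧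
      ((C311 f c).firstOrder.IsCasimir D F ↔
        ∃ c₁ c₂ : ℝ, ∀ p ∈ D, F p = c₁ * p 1 / √(p 2) + √(p 2) * c₁ * p 0 + c₂) ∧
      ((∀ w ∈ J, f w ≠ 0) → ((C311 f c).IsCasimir D F ↔ IsConstantOn D F))) := by
  refine ⟨?_, ?_, ?_, ?_, ?_, ?_, ?_, ?_, ?_, ?_, ?_, ?_⟩
  · intro D J f F hD hc hJ hJ' hDJ hf hF
    exact ⟨fun h => C21_zeroOrder_iff hD hc hF fun p hp => h _ (hDJ p hp),
      (C21_firstOrder_iff hD hc hF f).trans (exists_linear_add_local_function_iff hD hF).symm,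
      fun h => C21_iff hD hc hF fun p hp => h _ (hDJ p hp)⟩
  · intro D J f F hD hc hJ hJ' hDJ hu hf hF
    exact ⟨fun h => C22_zeroOrder_iff hD hc hF hu fun p hp => h _ (hDJ p hp),
      C22_firstOrder_iff hD hc hF f hu, C22_iff hD hc hF f hu⟩
  · intro D f F hD hc hf hF
    exact ⟨fun h => C31_zeroOrder_iff hD hF h, C31_firstOrder_iff hD hF f, C31_iff hD hF f⟩
  · intro D I J f g h hD hc hI hI' hJ hJ' hDI hf hg hh hcl
    refine ⟨fun F hF => ⟨?_, C32_zeroOrder_iff hD hF f g h, ?_, fun hu =>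
      ⟨C35_firstOrder_iff hD hc hF f g h hu, C35_zeroOrder_iff hD hF f g h hu, ?_,
        C35_iff hD hc hF f g h hu⟩⟩, ?_, ?_, ?_, ?_, ?_, ?_⟩
    · exact (C32_firstOrder_iff hD hc hF f g h).trans (isLinearPlusFunctionVW_iff hD hF).symm
    · rw [C32_iff hD hc hF, isLinearPlusFunctionVW_iff hD hF]
    · rw [C35_zeroOrder_iff hD hF f g h hu, C32_zeroOrder_iff hD hF]
    · intro H
      have hf0 := fun v hv w hw => (H v hv w hw).1
      have hh0 := fun v hv w hw => (H v hv w hw).2.2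
      obtain ⟨ℓ, hℓ, hℓ'⟩ := exists_ratio_function_of_v hI hJ hJ' hg hh hcl hf0 hh0
      exact ⟨ℓ, hℓ, hℓ', fun v₀ hv₀ F hF =>
        C32_of_f_eq_zero hD hc hF hI hI' hDI hℓ hℓ' hf0 hh0 hv₀⟩
    · exact fun H F hF => C32_of_f_g_eq_zero hD hc hF
        fun p hp => H _ (hDI p hp).1 _ (hDI p hp).2
    · exact fun H F hF => C32_of_f_h_eq_zero hD hc hF
        fun p hp => H _ (hDI p hp).1 _ (hDI p hp).2
    · intro H
      have hg0 := fun v hv w hw => (H v hv w hw).2.1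
      have hh0 := fun v hv w hw => (H v hv w hw).2.2
      obtain ⟨ℓ, hℓ, hℓ'⟩ := exists_ratio_function_of_w hI hI' hJ hf hh hcl hg0 hh0
      exact ⟨ℓ, hℓ, hℓ', fun w₀ hw₀ F hF =>
        C32_of_g_eq_zero hD hc hF hJ hJ' hDI hℓ hℓ' hg0 hh0 hw₀⟩
    · exact fun H F hF => C32_of_g_h_eq_zero hD hc hF
        fun p hp => H _ (hDI p hp).1 _ (hDI p hp).2
    · exact fun H F hF => C32_of_h_eq_zero hD hc hF fun p hp =>
        ⟨(H _ (hDI p hp).1 _ (hDI p hp).2).1, (H _ (hDI p hp).1 _ (hDI p hp).2).2.2⟩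
  · intro D I J f F hD hc hI hI' hJ hJ' hDI hf hF
    exact ⟨fun h => C33_zeroOrder_iff hD hF fun p hp => h _ (hDI p hp).1 _ (hDI p hp).2,
      C33_firstOrder_iff hD hF f, C33_iff hD hF f⟩
  · intro D I J f F hD hc hI hI' hJ hJ' hDI hu hf hF
    exact ⟨fun h => C34_zeroOrder_iff hD hF hu fun p hp => h _ (hDI p hp).1 _ (hDI p hp).2,
      C34_firstOrder_iff hD hF f hu, C34_iff hD hF f hu⟩
  · intro D J f g c F hD hc hJ hJ' hDJ hf hg hF
    exact ⟨(C36_firstOrder_iff hD hc hF f g c).trans (isLinearPlusFunctionW_iff hD hF).symm,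
      fun h => C36_of_g_eq_zero c hD hc hF fun p hp => h _ (hDJ p hp),
      fun h w₀ hw₀ => C36_of_g_ne_zero c hD hc hF hJ hJ' hDJ hf hg h hw₀⟩
  · intro D J f c F hD hc hJ hJ' hDJ hv hf hF
    refine ⟨C37_firstOrder_iff hD hc hF f c hv, ?_, ?_⟩
    · rintro rfl h
      have hf0 := fun p hp => h _ (hDJ p hp)
      exact ⟨C37_zeroOrder_iff_of_c_eq_zero hD hF hv hf0, C37_iff_of_c_eq_zero hD hc hF hv hf0⟩
    · intro hc0 h
      have hf0 := fun p hp => h _ (hDJ p hp)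
      exact ⟨C37_zeroOrder_iff_of_c_ne_zero hD hF hc0 hv hf0,
        C37_iff_of_c_ne_zero hD hc hF hc0 hv hf0⟩
  · intro D J f c F hD hc hJ hJ' hDJ hΔ hf hF
    refine ⟨C38_firstOrder_iff hD hc hF f c hΔ, ?_, ?_⟩
    · rintro rfl h
      have hf0 := fun p hp => h _ (hDJ p hp)
      exact ⟨C38_zeroOrder_iff_of_c_eq_zero hD hF hΔ hf0, C38_iff_of_c_eq_zero hD hc hF hΔ hf0⟩
    · intro hc0 h
      have hf0 := fun p hp => h _ (hDJ p hp)
      exact ⟨C38_zeroOrder_iff hD hF c hΔ hf0, C38_iff_of_c_ne_zero hD hc hF hc0 hΔ hf0⟩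
  · intro D J f g c F hD hc hJ hJ' hDJ hf hg hF
    exact ⟨(C39_firstOrder_iff hD hc hF f g c).trans (isLinearPlusFunctionW_iff hD hF).symm,
      fun h => C39_of_g_eq_zero c hD hc hF fun p hp => h _ (hDJ p hp),
      fun h w₀ hw₀ => C39_of_g_ne_zero c hD hc hF hJ hJ' hDJ hf hg h hw₀⟩
  · intro D J f g h F hD hc hJ hJ' hDJ hv hf hg hh hcl hF
    refine ⟨C310_firstOrder_iff hD hc hF f g h hv,
      fun H => C310_of_f_g_eq_zero hD hc hF hv fun p hp => H _ (hDJ p hp),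
      fun H => ⟨C310_zeroOrder_iff_of_f_h_eq_zero hD hF hv fun p hp => H _ (hDJ p hp),
        C310_iff_of_g_ne_zero hD hc hF hv fun p hp => (H _ (hDJ p hp)).2.1⟩,
      fun H => C310_of_g_h_eq_zero hD hc hF hv fun p hp => H _ (hDJ p hp),
      fun H w₀ hw₀ => C310_of_g_eq_zero hD hc hF hJ hJ' hDJ hv hf hh H hw₀,
      fun H => ⟨C310_zeroOrder_iff_of_g_ne_zero hD hF hJ hDJ hv hg hh hcl H,
        C310_iff_of_g_ne_zero hD hc hF hv fun p hp => H _ (hDJ p hp)⟩⟩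
  · intro D J f c F hD hc hJ hJ' hDJ hw hΔ hf hF
    refine ⟨fun h => C311_zeroOrder_iff hD hF c hw hΔ fun p hp => h _ (hDJ p hp),
      (C311_firstOrder_iff hD hc hF f c hw hΔ).trans ?_,
      fun h => C311_iff hD hc hF c hw hΔ fun p hp => h _ (hDJ p hp)⟩
    refine exists_congr fun c₁ => exists_congr fun c₂ => forall₂_congr fun p _ => ?_
    rw [show c₁ * (p 1 / √(p 2) + √(p 2) * p 0) + c₂
      = c₁ * p 1 / √(p 2) + √(p 2) * c₁ * p 0 + c₂ by ring]
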